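/- **Theorem 1.** Let $K$ be a triangulation of a closed connected surface (finitely many triangles with three distinct corners each, glued in pairs along their sides; several links may have the same end points), with links $1,\dots,L$ and triangles $1,\dots,T$. For link lengths $l=(l_1,\dots,l_L)\in(0,\infty)^L$ that satisfy the strict triangle inequality in every triangle, let $A_t=A_t(l)$ be the area of the flat triangle $t$ and $A(l)=\sum_t A_t$. Write $\delta(\Delta)$ for the restriction to such $l$ and consider, for real $\alpha,\beta$, the local measures $$d\mu_{\alpha,\beta}=\prod_{t}A_t^{-\beta}\prod_{i}l_i^{-\alpha}\,dl_i\;\delta(\Delta)$$ and the DeWitt-like measures $$d\mu_{\beta}=\frac{\sqrt{|P(A_1^{2\beta/3},\dots,A_T^{2\beta/3})|}}{\prod_t A_t^{\beta}}\prod_i l_i\,dl_i\;\delta(\Delta),\qquad P(A)=\det M(A)\prod_tA_t^{3},$$ where $M(A)$ is the $L\times L$ matrix to which each triangle $t$ contributes $1/A_t$ at the diagonal entries of its three sides and $-1/A_t$ at the off-diagonal entries of pairs of its sides. For $V>0$ and $f\ge 0$ put $$Z_V(f)=\lim_{\varepsilon\downarrow0}\frac1{2\varepsilon}\int_{|A(l)-V|<\varepsilon}f\,d\mu,\qquad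 \langle f\rangle_V=\frac{Z_V(f)}{Z_V(1)},$$ and say that $\langle f\rangle_V=\infty$ if $Z_V(f)=\infty$ and, whenever $Z_V(1)<\infty$, the quotient is infinite. Let $R$ be the geodesic distance of two points of the piecewise flat surface, and let $R^n$ as an observable be its $n$-th power averaged over both points with respect to area. 1. For all $\alpha,\beta$ there is $n_0$ such that for every real $n\ge n_0$ and every $V>0$, with respect to $\mu_{\alpha,\beta}$, $\langle l_i^n\rangle_V=\infty$ for every link $i$, and $\langle R^n\rangle_V=\infty$. 2. For every $\beta$ for which $\mu_\beta$ is not the zero measure there is $n_0$ such that for every real $n\ge n_0$ and every $V>0$, with respect to $\mu_{\beta}$, $\langle l_i^n\rangle_V=\infty$ for every link $i$, and $\langle R^n\rangle_V=\infty$. 3. If $v$ is a vertex of order $N$ and $\alpha+2\beta<3-\frac1N$, then with respect to $\mu_{\alpha,\beta}$, $\langle l_i^n\rangle_V=\infty$ for every link $i$ that ends in $v$, every real $n\ge N(3-\beta)-2$ and every $V>0$. -/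

import Mathlib

open MeasureTheory Filter Topology
open scoped ENNReal

/-- A triangulation of a closed connected surface, with vertices `Vert`, links `Link` and
triangles `Tri`: finitely many triangles glued in pairs along their sides.  Each triangle has three
distinct corners; the side `side t k` is opposite to the corner `vert t k`.  Every simplicial complex
whose realization is a closed connected surface is of this form; several links with the same end
points are allowed.  (`Vert` is automatically finite when `Tri` is.) -/
structure ClosedTriangulation (Vert Link Tri : Type*) where
  /-- the three corners of a triangle -/
  vert : Tri → Fin 3 → Vert
  /-- the three sides of a triangle -/
  side : Tri → Fin 3 → Link
  /-- the two end points of a link -/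
  ends : Link → Sym2 Vert
  vert_injective : ∀ t, Function.Injective (vert t)
  ends_side : ∀ t k, ends (side t k) = s(vert t (k + 1), vert t (k + 2))
  /-- every link is a side of exactly two triangles -/
  two_triangles : ∀ e, Set.ncard {t | e ∈ Set.range (side t)} = 2
  /-- the triangles around a vertex form one cycle, so the vertex has a disc neighbourhood -/
  star_connected : ∀ v t t', v ∈ Set.range (vert t) → v ∈ Set.range (vert t') →
    Relation.ReflTransGen
      (fun s s' => ∃ e, v ∈ ends e ∧ e ∈ Set.range (side s) ∧ e ∈ Set.range (side s')) t t'
  /-- the surface is connected -/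
  connected : ∀ v w, Relation.ReflTransGen (fun x y => ∃ e, ends e = s(x, y)) v w
  nonempty : Nonempty Tri

namespace ClosedTriangulation

noncomputable section

variable {Vert Link Tri : Type*} (K : ClosedTriangulation Vert Link Tri)

/-- The order of a vertex: the number of links that end in it. -/
def order (v : Vert) : ℕ := Set.ncard {e | v ∈ K.ends e}

/-- The link length assignments that obey all triangle inequalities. -/
def admissible : Set (Link → ℝ) :=
  {l | (∀ e, 0 < l e) ∧
    ∀ t k, l (K.side t k) < l (K.side t (k + 1)) + l (K.side t (k + 2))}

/-- The area of a triangle, as a function of the link lengths. -/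
def area (l : Link → ℝ) (t : Tri) : ℝ :=
  let x : Fin 3 → ℝ := fun k => l (K.side t k) ^ 2
  1 / 2 * Real.sqrt (x 0 * x 1 - 1 / 4 * (x 0 + x 1 - x 2) ^ 2)

/-- The total area of the surface. -/
def totalArea [Fintype Tri] (l : Link → ℝ) : ℝ := ∑ t, K.area l t

/-! ### The measures -/

/-- The measure on link length assignments which has density `J` with respect to
`∏ dl_i δ(Δ)`, i.e. to Lebesgue measure on the admissible region. -/
def measureOfDensity [Fintype Link] (J : (Link → ℝ) → ℝ) : Measure (Link → ℝ) :=
  (volume.restrict K.admissible).withDensity fun l => ENNReal.ofReal (J l)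

/-- The local measure `∏_t A_t ^ (-β) ∏_i l_i ^ (-α) dl_i δ(Δ)`. -/
def localMeasure [Fintype Link] [Fintype Tri] (α β : ℝ) : Measure (Link → ℝ) :=
  K.measureOfDensity fun l => (∏ t, K.area l t ^ (-β)) * ∏ e, l e ^ (-α)

/-- The matrix of the DeWitt-like metric for triangles of areas `A`: a triangle `t` contributes
`1 / A t` to the diagonal entries of its three sides and `-1 / A t` to the off-diagonal ones. -/
def deWittMatrix [Fintype Tri] [DecidableEq Link] (A : Tri → ℝ) : Matrix Link Link ℝ :=
  open Classical in
  Matrix.of fun i j => ∑ t with i ∈ Set.range (K.side t) ∧ j ∈ Set.range (K.side t),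
    if i = j then 1 / A t else -(1 / A t)

/-- For positive `A`, the polynomial `P` defined by `det M = P(A) ∏_t A_t ^ (-3)`. -/
def deWittPoly [Fintype Link] [Fintype Tri] [DecidableEq Link] (A : Tri → ℝ) : ℝ :=
  (∏ t, A t ^ 3) * (K.deWittMatrix A).det

/-- The DeWitt-like measure
`√|P(A_1 ^ (2β/3), …, A_T ^ (2β/3))| ∏_t A_t ^ (-β) ∏_i l_i dl_i δ(Δ)`.
(The metric is indefinite, so the volume density is the root of an absolute value.) -/
def deWittMeasure [Fintype Link] [Fintype Tri] [DecidableEq Link] (β : ℝ) : Measure (Link → ℝ) :=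
  K.measureOfDensity fun l =>
    Real.sqrt |K.deWittPoly fun t => K.area l t ^ (2 * β / 3)|
      * (∏ t, K.area l t ^ (-β)) * ∏ e, l e

/-! ### Expectation values at fixed area -/

/-- The integral `∫ f(l) δ(A(l) - V) dμ(l)` of `f ≥ 0` over the assignments of total area `V`, as
the limit of the integrals over the shells `|A(l) - V| < ε` divided by their width `2 ε`.  (The lower
limit is the limit whenever that exists; it does, possibly infinite, when `μ` and `f`
are homogeneous under rescaling of all lengths.) -/
def fixedAreaIntegral [Fintype Tri] (μ : Measure (Link → ℝ)) (V : ℝ) (f : (Link → ℝ) → ℝ≥0∞) :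
    ℝ≥0∞ :=
  liminf (fun ε : ℝ => (∫⁻ l in {l | |K.totalArea l - V| < ε}, f l ∂μ) / ENNReal.ofReal (2 * ε))
    (𝓝[>] 0)

/-- The partition function at fixed area. -/
def partitionFunction [Fintype Tri] (μ : Measure (Link → ℝ)) (V : ℝ) : ℝ≥0∞ :=
  K.fixedAreaIntegral μ V fun _ => 1

/-- The expectation value `⟨f⟩_V` at fixed area; meaningful if the partition function is neither
`0` nor `∞`. -/
def expectation [Fintype Tri] (μ : Measure (Link → ℝ)) (V : ℝ) (f : (Link → ℝ) → ℝ≥0∞) : ℝ≥0∞ :=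
  K.fixedAreaIntegral μ V f / K.partitionFunction μ V

/-- `⟨f⟩_V = ∞`: the integral of `f` at fixed area is infinite, and so is its ratio to the
partition function whenever the latter is finite. -/
def Diverges [Fintype Tri] (μ : Measure (Link → ℝ)) (V : ℝ) (f : (Link → ℝ) → ℝ≥0∞) : Prop :=
  K.fixedAreaIntegral μ V f = ∞ ∧ (K.partitionFunction μ V ≠ ∞ → K.expectation μ V f = ∞)

/-- The observable `l_e ^ n`. -/
def linkPower (e : Link) (n : ℝ) (l : Link → ℝ) : ℝ≥0∞ := ENNReal.ofReal (l e ^ n)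

/-! ### Geodesic distance on the piecewise flat surface

A point of the surface is given by a triangle and barycentric coordinates in it. -/

/-- Euclidean distance of the points with barycentric coordinates `b`, `b'` in the flat
triangle `t`. -/
def segmentLength (l : Link → ℝ) (t : Tri) (b b' : Fin 3 → ℝ) : ℝ :=
  Real.sqrt (-∑ k, l (K.side t k) ^ 2 * (b (k + 1) - b' (k + 1)) * (b (k + 2) - b' (k + 2)))

/-- `p` and `q` describe the same point of a link shared by their triangles. -/
def Glued (p q : Tri × (Fin 3 → ℝ)) : Prop :=
  ∃ k k', K.side p.1 k = K.side q.1 k' ∧ p.2 k = 0 ∧ q.2 k' = 0 ∧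
    ∀ i j, i ≠ k → j ≠ k' → K.vert p.1 i = K.vert q.1 j → p.2 i = q.2 j

/-- There is a piecewise straight path of length `r` from `p` to `q` on the surface. -/
inductive HasPath (l : Link → ℝ) (p : Tri × (Fin 3 → ℝ)) : Tri × (Fin 3 → ℝ) → ℝ → Prop
  | refl : HasPath l p p 0
  | straight {t : Tri} {b b' : Fin 3 → ℝ} {r : ℝ} (hb : b ∈ stdSimplex ℝ (Fin 3))
      (hb' : b' ∈ stdSimplex ℝ (Fin 3)) (h : HasPath l p (t, b) r) :
      HasPath l p (t, b') (r + K.segmentLength l t b b')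
  | glue {q q' : Tri × (Fin 3 → ℝ)} {r : ℝ} (hq : K.Glued q q') (h : HasPath l p q r) :
      HasPath l p q' r

/-- Geodesic distance on the surface. -/
def geodesicDist (l : Link → ℝ) (p q : Tri × (Fin 3 → ℝ)) : ℝ := sInf {r | K.HasPath l p q r}

/-- The parameter domain of barycentric coordinates. -/
def unitTriangle : Set (ℝ × ℝ) := {u | 0 ≤ u.1 ∧ 0 ≤ u.2 ∧ u.1 + u.2 ≤ 1}

/-- Barycentric coordinates; the area element of a triangle of area `A` is `2 A du`. -/
def barycentric (u : ℝ × ℝ) : Fin 3 → ℝ := ![u.1, u.2, 1 - u.1 - u.2]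

/-- The observable `R ^ n`: the `n`-th power of the geodesic distance of two points of the surface,
averaged over both points with respect to area. -/
def radiusPower [Fintype Tri] (n : ℝ) (l : Link → ℝ) : ℝ≥0∞ :=
  (∑ t, ∑ t', ENNReal.ofReal (2 * K.area l t) * ENNReal.ofReal (2 * K.area l t') *
    ∫⁻ u in unitTriangle, ∫⁻ u' in unitTriangle,
      ENNReal.ofReal (K.geodesicDist l (t, barycentric u) (t', barycentric u') ^ n))
    / ENNReal.ofReal (K.totalArea l) ^ 2

end

end ClosedTriangulation

set_option linter.unusedSectionVars false

namespace ClosedTriangulation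

variable {Vert Link Tri : Type*} (K : ClosedTriangulation Vert Link Tri)

/-! ### Areas -/

/-! The densities and observables are homogeneous under rescaling of all lengths. So it is enough to
find infinite weight in a range of total areas bounded away from 0 and ∞
(`diverges_of_homogeneous`): if a shell around V had finite integral, rescaling it would give a
finite integral near every area of the range, and finitely many such neighbourhoods cover the range.

For the existence of some n₀, the surface is stretched. Give the vertices pairwise different heights
h and take the squared lengths k²(Δh)² + s/k², with s near the squared lengths X of a fixed
admissible assignment. In each triangle a rank one form is added to s/k², so the squared area tends
to a positive limit as k → ∞ (`areaSq_ridgeSq`), while every link is at least k long and distances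
are at least k times height differences. A box for s of fixed size gives each length a window of
order k⁻³. Hence the volume falls only like a power of k. If the density, and the tolerance for s
that guarantees it, also fall at most like powers of k, then large n wins (`diverges_of_ridge`). For
the local measures this is immediate. The polynomial of the DeWitt-like measures may vanish in the
limit, but X is chosen where it does not vanish. Along s = X it is analytic in κ = k⁻⁴ ≥ 0, and for
large κ it is, up to scale, close to its value at X. So its zero at κ = 0 has finite order
(`exists_le_ridgePoly`).

The explicit exponent comes from spikes at v, whose N links have lengths near k. A triangle at v
keeps an area of order 1 if its third side is about k⁻¹, or if that side is about 1 and the two long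
sides differ by 1 up to order k⁻². Outside the spike, links have length about 1 or k⁻¹, and no
triangle may have exactly two short sides. `exists_closed` enlarges the set of short links to meet
this condition without loss, and `exists_le_volume_spikeBox` bounds the volume by cutting a box with
slabs. If α + β ≥ 0, all links opposite v are made short. If α + β < 0, a two-colouring that cuts at
least half of the links around v decides which triangles are folded instead. In both cases the power
of k is nonnegative for n ≥ N(3-β)-2. Regions at geometrically growing heights are disjoint and each
contributes at least a fixed amount, so even the logarithmic case, exponent 0, diverges
(`diverges_of_spikeShape`). -/

/-- The square of the area of a triangle, as a function of the squares of its sides. -/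
noncomputable def heron (x y z : ℝ) : ℝ := (x * y - 1 / 4 * (x + y - z) ^ 2) / 4

lemma heron_sq (a b c : ℝ) :
    heron (a ^ 2) (b ^ 2) (c ^ 2) = (a ^ 2 - (b - c) ^ 2) * ((b + c) ^ 2 - a ^ 2) / 16 := by
  unfold heron; ring

lemma heron_rotate (x y z : ℝ) : heron x y z = heron y z x := by unfold heron; ring

lemma area_eq_sqrt_heron (l : Link → ℝ) (t : Tri) (k : Fin 3) :
    K.area l t = √(heron (l (K.side t k) ^ 2) (l (K.side t (k + 1)) ^ 2)
      (l (K.side t (k + 2)) ^ 2)) := by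
  have h0 : K.area l t = √(heron (l (K.side t 0) ^ 2) (l (K.side t 1) ^ 2)
      (l (K.side t 2) ^ 2)) := by
    have : (1 / 2 : ℝ) = √(1 / 4) := by
      rw [show (1 / 4 : ℝ) = (1 / 2) ^ 2 by norm_num, Real.sqrt_sq (by norm_num)]
    simp only [area]
    rw [this, ← Real.sqrt_mul (by norm_num)]
    congr 1
    unfold heron; ring
  rw [h0]
  fin_cases k
  · rfl
  · exact congrArg _ (heron_rotate _ _ _)
  · exact congrArg _ ((heron_rotate _ _ _).trans (heron_rotate _ _ _))

/-- The square of the area of a triangle, as a function of the squares of all link lengths. -/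
noncomputable def areaSq (x : Link → ℝ) (t : Tri) : ℝ :=
  heron (x (K.side t 0)) (x (K.side t 1)) (x (K.side t 2))

lemma areaSq_eq (x : Link → ℝ) (t : Tri) (k : Fin 3) :
    K.areaSq x t = heron (x (K.side t k)) (x (K.side t (k + 1))) (x (K.side t (k + 2))) := by
  fin_cases k
  · rfl
  · exact heron_rotate _ _ _
  · exact (heron_rotate _ _ _).trans (heron_rotate _ _ _)

lemma area_eq (l : Link → ℝ) (t : Tri) : K.area l t = √(K.areaSq (fun e => l e ^ 2) t) :=
  K.area_eq_sqrt_heron l t 0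

lemma triangle_lt_of_heron_pos {a b c : ℝ} (_ : 0 < a) (hb : 0 < b) (hc : 0 < c)
    (h : 0 < heron (a ^ 2) (b ^ 2) (c ^ 2)) : a < b + c := by
  by_contra! hle
  rw [heron_sq] at h
  have h1 : (b + c) ^ 2 ≤ a ^ 2 := by gcongr
  have h2 : (b - c) ^ 2 ≤ a ^ 2 := by nlinarith
  nlinarith [mul_nonneg (sub_nonneg.2 h1) (sub_nonneg.2 h2)]

/-- Sixteen times the squared area is the perimeter times the three triangle excesses. For positive
sides at most one excess can fail to be positive, so positivity of the product recovers all of them.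
In this form admissibility is read off from squared lengths. -/
lemma mem_admissible_iff (l : Link → ℝ) :
    l ∈ K.admissible ↔ (∀ e, 0 < l e) ∧ ∀ t, 0 < K.areaSq (fun e => l e ^ 2) t := by
  refine ⟨fun h => ⟨h.1, fun t => ?_⟩, fun h => ⟨h.1, fun t k => ?_⟩⟩
  · have h0 := h.2 t 0
    have h1 := h.2 t 1
    have h2 := h.2 t 2
    simp only [Fin.isValue, zero_add, show (1 : Fin 3) + 1 = 2 from rfl,
      show (1 : Fin 3) + 2 = 0 from rfl, show (2 : Fin 3) + 1 = 0 from rfl,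
      show (2 : Fin 3) + 2 = 1 from rfl] at h0 h1 h2
    have e : K.areaSq (fun e => l e ^ 2) t =
      (l (K.side t 1) + l (K.side t 2) - l (K.side t 0)) *
      (l (K.side t 2) + l (K.side t 0) - l (K.side t 1)) *
      (l (K.side t 0) + l (K.side t 1) - l (K.side t 2)) *
      (l (K.side t 0) + l (K.side t 1) + l (K.side t 2)) / 16 := by
      unfold areaSq heron; ring
    rw [e]
    have := h.1 (K.side t 0)
    have := h.1 (K.side t 1)
    have := h.1 (K.side t 2)
    have := sub_pos.2 h0
    have := sub_pos.2 h1
    have := sub_pos.2 h2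
    positivity
  · have := h.2 t
    rw [K.areaSq_eq _ t k] at this
    exact triangle_lt_of_heron_pos (h.1 _) (h.1 _) (h.1 _) this

lemma area_nonneg (l : Link → ℝ) (t : Tri) : 0 ≤ K.area l t := by
  rw [area_eq]; positivity

lemma area_smul (c : ℝ) (l : Link → ℝ) (t : Tri) : K.area (c • l) t = c ^ 2 * K.area l t := by
  rw [area_eq, area_eq]
  rw [show K.areaSq (fun e => (c • l) e ^ 2) t = (c ^ 2) ^ 2 * K.areaSq (fun e => l e ^ 2) t by
    simp only [areaSq, heron, Pi.smul_apply, smul_eq_mul]; ring]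
  rw [Real.sqrt_mul (by positivity), Real.sqrt_sq (by positivity)]

lemma smul_mem_admissible {c : ℝ} (hc : 0 < c) {l : Link → ℝ} :
    c • l ∈ K.admissible ↔ l ∈ K.admissible := by
  simp only [admissible, Set.mem_ofPred_eq, Pi.smul_apply, smul_eq_mul]
  refine and_congr (forall_congr' fun e => mul_pos_iff_of_pos_left hc)
    (forall_congr' fun t => forall_congr' fun k => ?_)
  rw [← mul_add]
  exact mul_lt_mul_iff_right₀ hc

lemma continuous_area (t : Tri) : Continuous fun l : Link → ℝ => K.area l t := by
  simp only [area_eq, areaSq, heron]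
  fun_prop

lemma measurableSet_admissible [Fintype Link] [Fintype Tri] : MeasurableSet K.admissible := by
  have : K.admissible = (⋂ e, {l : Link → ℝ | 0 < l e}) ∩ ⋂ t, ⋂ k,
      {l : Link → ℝ | l (K.side t k) < l (K.side t (k + 1)) + l (K.side t (k + 2))} := by
    ext l; simp [admissible]
  rw [this]
  refine (MeasurableSet.iInter fun e => ?_).inter
    (MeasurableSet.iInter fun t => MeasurableSet.iInter fun k => ?_)
  · exact measurableSet_lt measurable_const (measurable_pi_apply e)
  · exact measurableSet_lt (measurable_pi_apply _) (by fun_prop)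

variable [Fintype Tri]

lemma totalArea_smul (c : ℝ) (l : Link → ℝ) : K.totalArea (c • l) = c ^ 2 * K.totalArea l := by
  simp only [totalArea, area_smul, Finset.mul_sum]

lemma continuous_totalArea : Continuous fun l : Link → ℝ => K.totalArea l :=
  continuous_finsetSum _ fun t _ => K.continuous_area t

/-! ### Scaling -/

variable [Fintype Link]

lemma map_smul_measureOfDensity {J : (Link → ℝ) → ℝ} {p : ℝ}
    (hJ : ∀ c : ℝ, 0 < c → ∀ l ∈ K.admissible, J (c • l) = c ^ p * J l) {c : ℝ} (hc : 0 < c) :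
    ∃ w : ℝ≥0∞, w ≠ ∞ ∧ Measure.map (fun l => c • l) (K.measureOfDensity J) =
      w • K.measureOfDensity J := by
  refine ⟨ENNReal.ofReal (c ^ (-p)) *
    ENNReal.ofReal |(c ^ Module.finrank ℝ (Link → ℝ))⁻¹|, by finiteness, ?_⟩
  have hadm := K.measurableSet_admissible
  have hm : MeasurableEmbedding fun l : Link → ℝ => c • l := measurableEmbedding_const_smul₀ hc.ne'
  -- Indicators move all restrictions into the integrand, so the change of variables takes place in
  -- plain Lebesgue measure.
  have key : ∀ B, MeasurableSet B → K.measureOfDensity J B =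
      ∫⁻ l, (B ∩ K.admissible).indicator (fun l => ENNReal.ofReal (J l)) l := by
    intro B hB
    rw [measureOfDensity, withDensity_apply _ hB, Measure.restrict_restrict hB,
      lintegral_indicator (hB.inter hadm)]
  ext B hB
  rw [hm.map_apply, key _ (hm.measurable hB), Measure.smul_apply, key _ hB, smul_eq_mul, mul_assoc]
  have h2 := congrArg (fun m => ∫⁻ l, (B ∩ K.admissible).indicator
    (fun l => ENNReal.ofReal (J l)) l ∂m)
    (Measure.map_addHaar_smul (volume : Measure (Link → ℝ)) hc.ne')
  simp only [lintegral_smul_measure, smul_eq_mul] at h2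
  rw [← h2, hm.lintegral_map, ← lintegral_const_mul' _ _ (by finiteness)]
  refine lintegral_congr fun l => ?_
  by_cases hl : l ∈ K.admissible
  · have hl' := (K.smul_mem_admissible hc).2 hl
    by_cases hb : c • l ∈ B
    · rw [Set.indicator_of_mem (show l ∈ _ ∩ _ from ⟨hb, hl⟩),
        Set.indicator_of_mem (show c • l ∈ _ ∩ _ from ⟨hb, hl'⟩), hJ c hc l hl,
        ← ENNReal.ofReal_mul (by positivity), ← mul_assoc, ← Real.rpow_add hc]
      simp
    · rw [Set.indicator_of_notMem fun h => hb h.1, Set.indicator_of_notMem fun h => hb h.1]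
      simp
  · rw [Set.indicator_of_notMem fun h => hl h.2,
      Set.indicator_of_notMem fun h => hl ((K.smul_mem_admissible hc).1 h.2)]
    simp

lemma ae_mem_admissible (J : (Link → ℝ) → ℝ) : ∀ᵐ l ∂K.measureOfDensity J, l ∈ K.admissible :=
  (withDensity_absolutelyContinuous _ _).ae_le (ae_restrict_mem K.measurableSet_admissible)

/-- If a homogeneous observable has infinite integral over a range of total areas bounded away
from zero and infinity, then its integral over every shell is infinite. -/
lemma setLIntegral_shell_eq_top {J : (Link → ℝ) → ℝ} {p q : ℝ} {f : (Link → ℝ) → ℝ≥0∞}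
    (hJ : ∀ c : ℝ, 0 < c → ∀ l ∈ K.admissible, J (c • l) = c ^ p * J l)
    (hf : ∀ c : ℝ, 0 < c → ∀ l ∈ K.admissible, f (c • l) = ENNReal.ofReal (c ^ q) * f l)
    {a b : ℝ} (ha : 0 < a)
    (h : ∫⁻ l in {l | K.totalArea l ∈ Set.Icc a b}, f l ∂K.measureOfDensity J = ∞)
    {V ε : ℝ} (hV : 0 < V) (hε : 0 < ε) :
    ∫⁻ l in {l | |K.totalArea l - V| < ε}, f l ∂K.measureOfDensity J = ∞ := by
  by_contra hfin
  set μ := K.measureOfDensity J with hμ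
  -- The property of a set of areas to carry a finite integral passes to subsets and finite unions.
  -- By compactness it need only be checked near each area.
  refine absurd h (IsCompact.induction_on (isCompact_Icc (a := a) (b := b))
    (p := fun s => ∫⁻ l in {l | K.totalArea l ∈ s}, f l ∂μ ≠ ∞) (by simp) ?_ ?_ ?_)
  · intro s t hst ht
    exact ne_top_of_le_ne_top ht (lintegral_mono_set fun l hl => hst hl)
  · intro s t hs ht
    exact ne_top_of_le_ne_top (ENNReal.add_ne_top.2 ⟨hs, ht⟩)
      (lintegral_union_le f {l | K.totalArea l ∈ s} {l | K.totalArea l ∈ t})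
  · intro x hx
    have hx0 : 0 < x := ha.trans_le hx.1
    -- Scaling lengths by this factor takes total area x to V.
    set c := √(V / x) with hc
    have hcpos : 0 < c := Real.sqrt_pos.2 (by positivity)
    have hc2 : c ^ 2 = V / x := Real.sq_sqrt (by positivity)
    refine ⟨{y | |c ^ 2 * y - V| < ε}, mem_nhdsWithin_of_mem_nhds
      ((isOpen_lt (by fun_prop) continuous_const).mem_nhds ?_), ?_⟩
    · simp [hc2, div_mul_cancel₀ _ hx0.ne', hε]
    · obtain ⟨w, hw, hmap⟩ := K.map_smul_measureOfDensity hJ hcpos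
      have hm : MeasurableEmbedding fun l : Link → ℝ => c • l :=
        measurableEmbedding_const_smul₀ hcpos.ne'
      have hB : MeasurableSet {l : Link → ℝ | |K.totalArea l - V| < ε} :=
        (isOpen_lt (by have := K.continuous_totalArea; fun_prop) continuous_const).measurableSet
      have h1 : ∫⁻ l in {l | |K.totalArea l - V| < ε}, f l ∂(Measure.map (fun l => c • l) μ) ≠ ∞ := by
        rw [hmap, Measure.restrict_smul, lintegral_smul_measure]
        exact ENNReal.mul_ne_top hw hfin
      rw [hm.restrict_map, hm.lintegral_map] at h1
      have h2 : ∫⁻ l in {l | K.totalArea l ∈ {y | |c ^ 2 * y - V| < ε}},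
          ENNReal.ofReal (c ^ q) * f l ∂μ ≠ ∞ := by
        convert h1 using 1
        have hs : {l | K.totalArea l ∈ {y | |c ^ 2 * y - V| < ε}} =
            (fun l => c • l) ⁻¹' {l : Link → ℝ | |K.totalArea l - V| < ε} := by
          ext l; simp [totalArea_smul]
        rw [hs]
        refine lintegral_congr_ae (ae_restrict_of_ae ?_)
        filter_upwards [K.ae_mem_admissible J] with l hl
        rw [hf c hcpos l hl]
      rw [lintegral_const_mul' _ _ (by finiteness)] at h2
      intro h3
      rw [h3, ENNReal.mul_top] at h2
      · exact h2 rfl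
      · simpa using Real.rpow_pos_of_pos hcpos q

lemma diverges_of_homogeneous {J : (Link → ℝ) → ℝ} {p q : ℝ} {f : (Link → ℝ) → ℝ≥0∞}
    (hJ : ∀ c : ℝ, 0 < c → ∀ l ∈ K.admissible, J (c • l) = c ^ p * J l)
    (hf : ∀ c : ℝ, 0 < c → ∀ l ∈ K.admissible, f (c • l) = ENNReal.ofReal (c ^ q) * f l)
    {a b : ℝ} (ha : 0 < a)
    (h : ∫⁻ l in {l | K.totalArea l ∈ Set.Icc a b}, f l ∂K.measureOfDensity J = ∞)
    {V : ℝ} (hV : 0 < V) : K.Diverges (K.measureOfDensity J) V f := by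
  have h0 : K.fixedAreaIntegral (K.measureOfDensity J) V f = ∞ := by
    unfold fixedAreaIntegral
    -- Every shell already has infinite integral, so the quotient is constantly ∞ and no limit has
    -- to be computed.
    have : (fun ε : ℝ => (∫⁻ l in {l | |K.totalArea l - V| < ε}, f l ∂K.measureOfDensity J) /
        ENNReal.ofReal (2 * ε)) =ᶠ[𝓝[>] 0] fun _ => ∞ := by
      filter_upwards [self_mem_nhdsWithin] with ε hε
      rw [K.setLIntegral_shell_eq_top hJ hf ha h hV hε]
      exact ENNReal.top_div_of_ne_top (by finiteness)
    rw [liminf_congr this, liminf_const]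
  refine ⟨h0, fun hZ => ?_⟩
  rw [expectation, h0]
  exact ENNReal.top_div_of_ne_top hZ

/-! ### Lower bounds for integrals -/

lemma le_setLIntegral {J : (Link → ℝ) → ℝ} {f : (Link → ℝ) → ℝ≥0∞} {U : Set (Link → ℝ)}
    (hU : MeasurableSet U) (hadm : U ⊆ K.admissible) {F G W : ℝ} (hF : 0 ≤ F) (hG : 0 ≤ G)
    (hf : ∀ l ∈ U, ENNReal.ofReal F ≤ f l) (hJ : ∀ l ∈ U, G ≤ J l)
    (hW : ENNReal.ofReal W ≤ volume U) :
    ENNReal.ofReal (F * G * W) ≤ ∫⁻ l in U, f l ∂K.measureOfDensity J := by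
  have h1 : ENNReal.ofReal G * volume U ≤ K.measureOfDensity J U := by
    rw [measureOfDensity, withDensity_apply _ hU, Measure.restrict_restrict hU,
      Set.inter_eq_left.2 hadm, ← setLIntegral_const]
    exact setLIntegral_mono' hU fun l hl => ENNReal.ofReal_le_ofReal (hJ l hl)
  calc ENNReal.ofReal (F * G * W) = ENNReal.ofReal F * (ENNReal.ofReal G * ENNReal.ofReal W) := by
        rw [ENNReal.ofReal_mul (by positivity), ENNReal.ofReal_mul hF, mul_assoc]
    _ ≤ ENNReal.ofReal F * K.measureOfDensity J U := by
        gcongr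
        exact (mul_le_mul_right hW _).trans h1
    _ = ∫⁻ l in U, ENNReal.ofReal F ∂K.measureOfDensity J := by rw [setLIntegral_const]
    _ ≤ _ := setLIntegral_mono' hU hf

/-! ### Homogeneity of the densities and observables -/

lemma linkPower_smul (e : Link) (n : ℝ) {c : ℝ} (hc : 0 < c) {l : Link → ℝ}
    (hl : l ∈ K.admissible) :
    linkPower e n (c • l) = ENNReal.ofReal (c ^ n) * linkPower e n l := by
  simp only [linkPower, Pi.smul_apply, smul_eq_mul]
  rw [Real.mul_rpow hc.le (hl.1 e).le, ENNReal.ofReal_mul (by positivity)]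

lemma prod_area_rpow_smul (β : ℝ) {c : ℝ} (hc : 0 < c) (l : Link → ℝ) :
    ∏ t, K.area (c • l) t ^ (-β) =
      c ^ (-2 * β * Fintype.card Tri) * ∏ t, K.area l t ^ (-β) := by
  have : ∀ t, K.area (c • l) t ^ (-β) = c ^ (-2 * β) * K.area l t ^ (-β) := fun t => by
    rw [area_smul, Real.mul_rpow (by positivity) (K.area_nonneg _ _), ← Real.rpow_natCast,
      ← Real.rpow_mul hc.le]
    congr 2
    push_cast; ring
  simp only [this, Finset.prod_mul_distrib, Finset.prod_const, Finset.card_univ]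
  rw [← Real.rpow_natCast, ← Real.rpow_mul hc.le]

lemma localDensity_smul (α β : ℝ) (c : ℝ) (hc : 0 < c) (l : Link → ℝ) (hl : l ∈ K.admissible) :
    (∏ t, K.area (c • l) t ^ (-β)) * ∏ e, (c • l) e ^ (-α) =
      c ^ (-2 * β * Fintype.card Tri + -α * Fintype.card Link) *
        ((∏ t, K.area l t ^ (-β)) * ∏ e, l e ^ (-α)) := by
  have : ∏ e, (c • l) e ^ (-α) = c ^ (-α * Fintype.card Link) * ∏ e, l e ^ (-α) := by
    simp only [Pi.smul_apply, smul_eq_mul, fun e => Real.mul_rpow (z := -α) hc.le (hl.1 e).le,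
      Finset.prod_mul_distrib, Finset.prod_const, Finset.card_univ]
    rw [← Real.rpow_natCast, ← Real.rpow_mul hc.le]
  rw [this, prod_area_rpow_smul K β hc, Real.rpow_add hc]
  ring

/-- The matrix is homogeneous of degree -1 and has one row per link; the prefactor has degree 3 per
triangle. -/
lemma deWittPoly_smul [DecidableEq Link] {c : ℝ} (hc : 0 < c) (A : Tri → ℝ) :
    K.deWittPoly (fun t => c * A t) =
      c ^ (3 * Fintype.card Tri - Fintype.card Link : ℝ) * K.deWittPoly A := by
  have h1 : K.deWittMatrix (fun t => c * A t) = c⁻¹ • K.deWittMatrix A := by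
    ext i j
    simp only [deWittMatrix, Matrix.smul_apply, Matrix.of_apply, smul_eq_mul, Finset.mul_sum]
    refine Finset.sum_congr rfl fun t _ => ?_
    split_ifs <;> simp [mul_comm]
  simp only [deWittPoly, h1, Matrix.det_smul, mul_pow, Finset.prod_mul_distrib, Finset.prod_const,
    Finset.card_univ]
  rw [Real.rpow_sub hc, ← Nat.cast_ofNat (R := ℝ), Real.rpow_mul hc.le, Real.rpow_natCast,
    Real.rpow_natCast, Real.rpow_natCast, inv_pow]
  field_simp

lemma deWittDensity_smul [DecidableEq Link] (β : ℝ) : ∃ p : ℝ, ∀ c : ℝ, 0 < c →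
    ∀ l ∈ K.admissible,
    Real.sqrt |K.deWittPoly fun t => K.area (c • l) t ^ (2 * β / 3)|
      * (∏ t, K.area (c • l) t ^ (-β)) * ∏ e, (c • l) e =
    c ^ p * (Real.sqrt |K.deWittPoly fun t => K.area l t ^ (2 * β / 3)|
      * (∏ t, K.area l t ^ (-β)) * ∏ e, l e) := by
  refine ⟨(2 * (2 * β / 3)) * (3 * Fintype.card Tri - Fintype.card Link) * (1 / 2) +
    -2 * β * Fintype.card Tri + Fintype.card Link, fun c hc l hl => ?_⟩
  have h1 : (fun t => K.area (c • l) t ^ (2 * β / 3)) =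
      fun t => c ^ (2 * (2 * β / 3)) * K.area l t ^ (2 * β / 3) := by
    ext t
    rw [area_smul, Real.mul_rpow (by positivity) (K.area_nonneg _ _), ← Real.rpow_natCast,
      ← Real.rpow_mul hc.le]
    norm_num
  have h2 : ∏ e, (c • l) e = c ^ (Fintype.card Link : ℝ) * ∏ e, l e := by
    simp [Finset.prod_mul_distrib]
  rw [h1, h2, deWittPoly_smul K (by positivity), prod_area_rpow_smul K β hc, abs_mul,
    abs_of_pos (by positivity), Real.sqrt_mul (by positivity), Real.rpow_add hc, Real.rpow_add hc,
    Real.sqrt_eq_rpow (_ ^ _), ← Real.rpow_mul hc.le, ← Real.rpow_mul hc.le]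
  ring

end ClosedTriangulation

namespace ClosedTriangulation

variable {Vert Link Tri : Type*} (K : ClosedTriangulation Vert Link Tri)

/-! ### Sides of triangles -/

lemma exists_side (e : Link) : ∃ t k, K.side t k = e := by
  have h : {t | e ∈ Set.range (K.side t)}.Nonempty := by
    rw [Set.nonempty_iff_ne_empty]
    intro h
    have := K.two_triangles e
    rw [h, Set.ncard_empty] at this
    omega
  obtain ⟨t, k, h⟩ := h
  exact ⟨t, k, h⟩

lemma vert_ne (t : Tri) (k : Fin 3) : K.vert t (k + 1) ≠ K.vert t (k + 2) := fun h => by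
  have := K.vert_injective t h
  fin_cases k <;> simp at this

lemma exists_vert (v : Vert) : ∃ t k, K.vert t k = v := by
  obtain ⟨t⟩ := K.nonempty
  have key : ∀ e : Link, v ∈ K.ends e → ∃ t k, K.vert t k = v := by
    intro e he
    obtain ⟨t, k, rfl⟩ := K.exists_side e
    rw [K.ends_side, Sym2.mem_iff] at he
    rcases he with h | h <;> exact ⟨t, _, h.symm⟩
  rcases Relation.ReflTransGen.cases_head (K.connected v (K.vert t 0)) with h | ⟨x, ⟨e, he⟩, -⟩
  · exact ⟨t, 0, h.symm⟩
  · exact key e (by simp [he])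

lemma finite_vert (K : ClosedTriangulation Vert Link Tri) [Finite Tri] : Finite Vert :=
  Finite.of_surjective (fun p : Tri × Fin 3 => K.vert p.1 p.2) fun v => by
    obtain ⟨t, k, h⟩ := K.exists_vert v
    exact ⟨(t, k), h⟩

/-- On a finite triangulation there is a height function which differs by at least one between
any two vertices. -/
lemma exists_height (K : ClosedTriangulation Vert Link Tri) [Finite Tri] : ∃ h : Vert → ℝ, ∀ x y, x ≠ y → 1 ≤ |h x - h y| := by
  have := K.finite_vert
  obtain ⟨f, hf⟩ := exists_injective_nat Vert
  refine ⟨fun x => f x, fun x y hxy => ?_⟩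
  have h1 : (f x : ℤ) - f y ≠ 0 := sub_ne_zero.2 fun h => hxy (hf (by exact_mod_cast h))
  have h2 : ((1 : ℤ) : ℝ) ≤ ((|(f x : ℤ) - f y| : ℤ) : ℝ) := Int.cast_le.2 (Int.one_le_abs h1)
  simpa using h2

/-! ### Quadratic forms -/

/-- The squared Euclidean length of a displacement with barycentric coordinates `d` in the
triangle `t`, when the squared side lengths are `x`. -/
def gram (x : Link → ℝ) (t : Tri) (d : Fin 3 → ℝ) : ℝ :=
  -∑ k, x (K.side t k) * d (k + 1) * d (k + 2)

lemma segmentLength_eq (l : Link → ℝ) (t : Tri) (b b' : Fin 3 → ℝ) :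
    K.segmentLength l t b b' = √(K.gram (fun e => l e ^ 2) t (b - b')) := rfl

lemma gram_eq (x : Link → ℝ) (t : Tri) (d : Fin 3 → ℝ) :
    K.gram x t d = -(x (K.side t 0) * d 1 * d 2 + x (K.side t 1) * d 2 * d 0 +
      x (K.side t 2) * d 0 * d 1) := by
  simp only [gram, Fin.sum_univ_three]
  rfl

/-- Completing the square in `d 1`: up to a factor, the discriminant of the form is the squared
area, which makes the form definite on nondegenerate triangles. -/
lemma four_mul_gram (x : Link → ℝ) (t : Tri) {d : Fin 3 → ℝ} (hd : ∑ k, d k = 0) :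
    4 * x (K.side t 2) * K.gram x t d =
      (2 * x (K.side t 2) * d 1 + (x (K.side t 1) + x (K.side t 2) - x (K.side t 0)) * d 2) ^ 2
        + 16 * K.areaSq x t * d 2 ^ 2 := by
  rw [Fin.sum_univ_three] at hd
  obtain h0 : d 0 = -d 1 - d 2 := by linarith
  rw [gram_eq, h0, areaSq, heron]
  ring

lemma gram_nonneg {x : Link → ℝ} (hx : ∀ e, 0 < x e) {t : Tri} (ht : 0 ≤ K.areaSq x t)
    {d : Fin 3 → ℝ} (hd : ∑ k, d k = 0) : 0 ≤ K.gram x t d := by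
  have h := K.four_mul_gram x t hd
  have h1 : 0 ≤ 4 * x (K.side t 2) * K.gram x t d := by rw [h]; positivity
  exact nonneg_of_mul_nonneg_right h1 (by have := hx (K.side t 2); positivity)

lemma gram_pos {x : Link → ℝ} (hx : ∀ e, 0 < x e) {t : Tri} (ht : 0 < K.areaSq x t)
    {d : Fin 3 → ℝ} (hd : ∑ k, d k = 0) (hd2 : d 2 ≠ 0) : 0 < K.gram x t d := by
  have h := K.four_mul_gram x t hd
  have h1 : 0 < 4 * x (K.side t 2) * K.gram x t d := by rw [h]; positivity
  exact pos_of_mul_pos_right h1 (by have := hx (K.side t 2); positivity)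

/-- The square of the height difference along a link. -/
def heightSq (h : Vert → ℝ) (e : Link) : ℝ :=
  Sym2.lift ⟨fun a b => (h a - h b) ^ 2, fun a b => by ring⟩ (K.ends e)

lemma heightSq_side (h : Vert → ℝ) (t : Tri) (k : Fin 3) :
    K.heightSq h (K.side t k) = (h (K.vert t (k + 1)) - h (K.vert t (k + 2))) ^ 2 := by
  rw [heightSq, K.ends_side, Sym2.lift_mk]

lemma one_le_heightSq {h : Vert → ℝ} (hh : ∀ x y, x ≠ y → 1 ≤ |h x - h y|) (e : Link) :
    1 ≤ K.heightSq h e := by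
  obtain ⟨t, k, rfl⟩ := K.exists_side e
  rw [heightSq_side, one_le_sq_iff_one_le_abs]
  exact hh _ _ (K.vert_ne t k)

/-- The height differences along the sides of a triangle. -/
def heightDiff (h : Vert → ℝ) (t : Tri) (k : Fin 3) : ℝ :=
  h (K.vert t (k + 1)) - h (K.vert t (k + 2))

lemma sum_heightDiff (h : Vert → ℝ) (t : Tri) : ∑ k, K.heightDiff h t k = 0 := by
  simp only [heightDiff, Fin.sum_univ_three]
  simp only [Fin.isValue, zero_add, show (1 : Fin 3) + 1 = 2 from rfl,
    show (1 : Fin 3) + 2 = 0 from rfl, show (2 : Fin 3) + 1 = 0 from rfl,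
    show (2 : Fin 3) + 2 = 1 from rfl]
  ring

/-- Squared height differences are the squared lengths of a triangle collapsed onto a line, so the
form degenerates to the square of a linear functional. -/
lemma gram_heightSq (h : Vert → ℝ) (t : Tri) {d : Fin 3 → ℝ} (hd : ∑ k, d k = 0) :
    K.gram (K.heightSq h) t d = (∑ k, d k * h (K.vert t k)) ^ 2 := by
  rw [Fin.sum_univ_three] at hd
  obtain h0 : d 0 = -d 1 - d 2 := by linarith
  rw [gram_eq, Fin.sum_univ_three, h0, heightSq_side, heightSq_side, heightSq_side]
  simp only [Fin.isValue, zero_add, show (1 : Fin 3) + 1 = 2 from rfl,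
    show (1 : Fin 3) + 2 = 0 from rfl, show (2 : Fin 3) + 1 = 0 from rfl,
    show (2 : Fin 3) + 2 = 1 from rfl]
  ring

/-- The squared link lengths of a surface that is stretched along the heights `h`: heights are
multiplied by `k` while the transverse squared lengths are `s / k ^ 2`. -/
noncomputable def ridgeSq (h : Vert → ℝ) (k : ℝ) (s : Link → ℝ) (e : Link) : ℝ :=
  k ^ 2 * K.heightSq h e + s e / k ^ 2

/-- This is the determinant formula for a rank one perturbation in dimension two. The factors k² and
k⁻² cancel in the mixed term, which is the squared length, in `s`, of a vector along the level lines
of `h`: the displacement `heightDiff` does not change the height. -/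
lemma areaSq_ridgeSq (h : Vert → ℝ) {k : ℝ} (hk : 0 < k) (s : Link → ℝ) (t : Tri) :
    K.areaSq (K.ridgeSq h k s) t =
      K.gram s t (K.heightDiff h t) / 4 + (k⁻¹) ^ 4 * K.areaSq s t := by
  simp only [areaSq, heron, gram_eq, ridgeSq, heightSq_side, heightDiff]
  simp only [Fin.isValue, zero_add, show (1 : Fin 3) + 1 = 2 from rfl,
    show (1 : Fin 3) + 2 = 0 from rfl, show (2 : Fin 3) + 1 = 0 from rfl,
    show (2 : Fin 3) + 2 = 1 from rfl]
  field_simp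
  ring

lemma gram_ridgeSq (h : Vert → ℝ) (k : ℝ) (s : Link → ℝ) (t : Tri) {d : Fin 3 → ℝ}
    (hd : ∑ k, d k = 0) :
    K.gram (K.ridgeSq h k s) t d =
      k ^ 2 * (∑ k, d k * h (K.vert t k)) ^ 2 + K.gram s t d / k ^ 2 := by
  rw [← K.gram_heightSq h t hd]
  simp only [gram_eq, ridgeSq]
  ring

/-! ### Geodesic distance -/

lemma segmentLength_nonneg (l : Link → ℝ) (t : Tri) (b b' : Fin 3 → ℝ) :
    0 ≤ K.segmentLength l t b b' := Real.sqrt_nonneg _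

lemma HasPath.nonneg {l : Link → ℝ} {p q : Tri × (Fin 3 → ℝ)} {r : ℝ} (h : K.HasPath l p q r) :
    0 ≤ r := by
  induction h with
  | refl => exact le_rfl
  | straight hb hb' h ih => exact add_nonneg ih (K.segmentLength_nonneg _ _ _ _)
  | glue hq h ih => exact ih

lemma segmentLength_smul {c : ℝ} (hc : 0 ≤ c) (l : Link → ℝ) (t : Tri) (b b' : Fin 3 → ℝ) :
    K.segmentLength (c • l) t b b' = c * K.segmentLength l t b b' := by
  rw [segmentLength_eq, segmentLength_eq, gram_eq, gram_eq, ← Real.sqrt_sq hc,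
    ← Real.sqrt_mul (sq_nonneg _), Real.sqrt_sq hc]
  congr 1
  simp only [Pi.smul_apply, smul_eq_mul]
  ring

lemma HasPath.smul {c : ℝ} (hc : 0 ≤ c) {l : Link → ℝ} {p q : Tri × (Fin 3 → ℝ)} {r : ℝ}
    (h : K.HasPath l p q r) : K.HasPath (c • l) p q (c * r) := by
  induction h with
  | refl => rw [mul_zero]; exact .refl
  | straight hb hb' h ih =>
    rw [mul_add, ← K.segmentLength_smul hc]
    exact .straight hb hb' ih
  | glue hq h ih => exact .glue hq ih

lemma geodesicDist_nonneg (l : Link → ℝ) (p q : Tri × (Fin 3 → ℝ)) : 0 ≤ K.geodesicDist l p q :=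
  Real.sInf_nonneg fun _ h => HasPath.nonneg K h

lemma geodesicDist_smul {c : ℝ} (hc : 0 < c) (l : Link → ℝ) (p q : Tri × (Fin 3 → ℝ)) :
    K.geodesicDist (c • l) p q = c * K.geodesicDist l p q := by
  unfold geodesicDist
  rw [← smul_eq_mul, ← Real.sInf_smul_of_nonneg hc.le]
  congr 1
  ext r
  rw [Set.mem_smul_set]
  refine ⟨fun h => ⟨c⁻¹ * r, ?_, by simp [hc.ne']⟩, ?_⟩
  · have := HasPath.smul K (inv_nonneg.2 hc.le) h
    rwa [smul_smul, inv_mul_cancel₀ hc.ne', one_smul] at this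
  · rintro ⟨r, h, rfl⟩
    exact HasPath.smul K hc.le h

/-- The two area elements scale like the squared total area in the denominator, so only the factor
from the distance remains. -/
lemma radiusPower_smul [Fintype Tri] (n : ℝ) {c : ℝ} (hc : 0 < c) (l : Link → ℝ) :
    K.radiusPower n (c • l) = ENNReal.ofReal (c ^ n) * K.radiusPower n l := by
  have hC0 : ENNReal.ofReal (c ^ 2) ≠ 0 := by simpa using by positivity
  have hCt : ENNReal.ofReal (c ^ 2) ≠ ∞ := by finiteness
  simp only [radiusPower, geodesicDist_smul K hc, area_smul, totalArea_smul,
    fun p q => Real.mul_rpow (z := n) hc.le (K.geodesicDist_nonneg l p q),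
    ENNReal.ofReal_mul (Real.rpow_nonneg hc.le n)]
  simp only [lintegral_const_mul' _ _ ENNReal.ofReal_ne_top,
    fun t => mul_left_comm (2 : ℝ) (c ^ 2) (K.area l t),
    ENNReal.ofReal_mul (sq_nonneg c)]
  rw [mul_pow]
  have : ∀ t t', ENNReal.ofReal (c ^ 2) * ENNReal.ofReal (2 * K.area l t) *
      (ENNReal.ofReal (c ^ 2) * ENNReal.ofReal (2 * K.area l t')) *
      (ENNReal.ofReal (c ^ n) * ∫⁻ u in unitTriangle, ∫⁻ u' in unitTriangle,
        ENNReal.ofReal (K.geodesicDist l (t, barycentric u) (t', barycentric u') ^ n)) =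
      ENNReal.ofReal (c ^ 2) ^ 2 * (ENNReal.ofReal (c ^ n) *
        (ENNReal.ofReal (2 * K.area l t) * ENNReal.ofReal (2 * K.area l t') *
        ∫⁻ u in unitTriangle, ∫⁻ u' in unitTriangle,
        ENNReal.ofReal (K.geodesicDist l (t, barycentric u) (t', barycentric u') ^ n))) :=
    fun t t' => by ring
  simp only [this, ← Finset.mul_sum]
  rw [ENNReal.mul_div_mul_left _ _ (by positivity) (by finiteness), mul_div_assoc]

/-- The piecewise linear function on the surface with value `h v` at the vertex `v`. -/
def interpolate (h : Vert → ℝ) (p : Tri × (Fin 3 → ℝ)) : ℝ := ∑ k, p.2 k * h (K.vert p.1 k)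

lemma interpolate_eq (h : Vert → ℝ) (p : Tri × (Fin 3 → ℝ)) (k : Fin 3) :
    K.interpolate h p = p.2 k * h (K.vert p.1 k) + p.2 (k + 1) * h (K.vert p.1 (k + 1)) +
      p.2 (k + 2) * h (K.vert p.1 (k + 2)) := by
  simp only [interpolate, Fin.sum_univ_three]
  fin_cases k
  · rfl
  · simp only [Fin.isValue, Fin.mk_one, show (1 : Fin 3) + 1 = 2 from rfl,
      show (1 : Fin 3) + 2 = 0 from rfl]
    ring
  · simp only [Fin.isValue, Fin.reduceFinMk, show (2 : Fin 3) + 1 = 0 from rfl,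
      show (2 : Fin 3) + 2 = 1 from rfl]
    ring

lemma add_one_ne (k : Fin 3) : k + 1 ≠ k := by fin_cases k <;> decide

lemma add_two_ne (k : Fin 3) : k + 2 ≠ k := by fin_cases k <;> decide

/-- The heights define a continuous function on the glued surface; the two cases are the two ways in
which the end points of the common link can be matched. -/
lemma interpolate_glued (h : Vert → ℝ) {p q : Tri × (Fin 3 → ℝ)} (hpq : K.Glued p q) :
    K.interpolate h p = K.interpolate h q := by
  obtain ⟨k, k', hs, hp, hq, hv⟩ := hpq
  have he : s(K.vert p.1 (k + 1), K.vert p.1 (k + 2)) =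
      s(K.vert q.1 (k' + 1), K.vert q.1 (k' + 2)) := by
    rw [← K.ends_side, ← K.ends_side, hs]
  rw [K.interpolate_eq h p k, K.interpolate_eq h q k', hp, hq]
  rcases Sym2.eq_iff.1 he with ⟨h1, h2⟩ | ⟨h1, h2⟩
  · rw [hv _ _ (add_one_ne k) (add_one_ne k') h1, hv _ _ (add_two_ne k) (add_two_ne k') h2, h1, h2]
    ring
  · rw [hv _ _ (add_one_ne k) (add_two_ne k') h1, hv _ _ (add_two_ne k) (add_one_ne k') h2, h1, h2]
    ring

/-- A function that is Lipschitz on every flat triangle and continuous across the links is Lipschitz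
along paths, by induction on the path. -/
lemma le_geodesicDist {l : Link → ℝ} {h : Vert → ℝ} {c : ℝ}
    (hc : ∀ t, ∀ b ∈ stdSimplex ℝ (Fin 3), ∀ b' ∈ stdSimplex ℝ (Fin 3),
      c * |K.interpolate h (t, b) - K.interpolate h (t, b')| ≤ K.segmentLength l t b b')
    (hc0 : 0 ≤ c) {t : Tri} {b b' : Fin 3 → ℝ} (hb : b ∈ stdSimplex ℝ (Fin 3))
    (hb' : b' ∈ stdSimplex ℝ (Fin 3)) :
    c * |K.interpolate h (t, b) - K.interpolate h (t, b')| ≤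
      K.geodesicDist l (t, b) (t, b') := by
  -- An infimum over no paths would be 0. Both points lie in one triangle, so the straight segment
  -- provides a path.
  refine le_csInf ⟨_, .straight hb hb' .refl⟩ fun r hr => ?_
  have key : ∀ q r, K.HasPath l (t, b) q r →
      c * |K.interpolate h (t, b) - K.interpolate h q| ≤ r := by
    intro q r hq
    induction hq with
    | refl => simp
    | @straight t₁ b₁ b₂ r₁ hb hb' _ ih =>
      have h1 := abs_sub_le (K.interpolate h (t, b)) (K.interpolate h (t₁, b₁))
        (K.interpolate h (t₁, b₂))
      have h2 := hc t₁ b₁ hb b₂ hb'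
      nlinarith [mul_le_mul_of_nonneg_left h1 hc0]
    | glue hq _ ih => rwa [← K.interpolate_glued _ hq]
  exact key _ _ hr

/-- On a stretched surface the squared length of a segment is k² times the squared height difference
plus the nonnegative form of `s` divided by k². -/
lemma le_segmentLength_of_sq_eq_ridgeSq {l : Link → ℝ} {h : Vert → ℝ} {k : ℝ} (hk : 0 < k)
    {s : Link → ℝ} (hs : ∀ e, 0 < s e) (hs' : ∀ t, 0 < K.areaSq s t)
    (hl : ∀ e, l e ^ 2 = K.ridgeSq h k s e) (t : Tri) {b b' : Fin 3 → ℝ}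
    (hb : b ∈ stdSimplex ℝ (Fin 3)) (hb' : b' ∈ stdSimplex ℝ (Fin 3)) :
    k * |K.interpolate h (t, b) - K.interpolate h (t, b')| ≤ K.segmentLength l t b b' := by
  have hd : ∑ k, (b - b') k = 0 := by
    simp only [Pi.sub_apply, Finset.sum_sub_distrib, hb.2, hb'.2, sub_self]
  rw [segmentLength_eq, funext hl, K.gram_ridgeSq h k s t hd]
  apply Real.le_sqrt_of_sq_le
  rw [mul_pow, sq_abs]
  have h1 : K.interpolate h (t, b) - K.interpolate h (t, b') =
      ∑ k, (b - b') k * h (K.vert t k) := by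
    simp only [interpolate, Pi.sub_apply, sub_mul, Finset.sum_sub_distrib]
  rw [h1]
  have := K.gram_nonneg hs (hs' t).le hd
  have : 0 ≤ K.gram s t (b - b') / k ^ 2 := by positivity
  linarith

lemma barycentric_mem {u : ℝ × ℝ} (hu : u ∈ unitTriangle) :
    barycentric u ∈ stdSimplex ℝ (Fin 3) := by
  obtain ⟨h1, h2, h3⟩ := hu
  refine ⟨fun k => ?_, ?_⟩
  · fin_cases k
    · exact h1
    · exact h2
    · show 0 ≤ 1 - u.1 - u.2
      linarith
  · simp [barycentric, Fin.sum_univ_three]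

lemma isOpen_unitTriangle_interior : IsOpen {u : ℝ × ℝ | 0 < u.1 ∧ 0 < u.2 ∧ u.1 + u.2 < 1} :=
  (isOpen_lt continuous_const continuous_fst).inter
    ((isOpen_lt continuous_const continuous_snd).inter
      (isOpen_lt (by fun_prop : Continuous fun u : ℝ × ℝ => u.1 + u.2) continuous_const))

/-- A lower bound on the radius for surfaces of comparable areas on which the distance is at
least `k` times the height difference. -/
lemma exists_le_radiusPower [Fintype Tri] {h : Vert → ℝ} (hh : ∀ x y, x ≠ y → 1 ≤ |h x - h y|)
    {a b : ℝ} (ha : 0 < a) {n : ℝ} (hn : 0 ≤ n) :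
    ∃ c > 0, ∀ l : Link → ℝ, ∀ k : ℝ, 0 < k → (∀ t, a ≤ K.area l t) → K.totalArea l ≤ b →
      (∀ t, ∀ b ∈ stdSimplex ℝ (Fin 3), ∀ b' ∈ stdSimplex ℝ (Fin 3),
        k * |K.interpolate h (t, b) - K.interpolate h (t, b')| ≤ K.segmentLength l t b b') →
      ENNReal.ofReal (c * k ^ n) ≤ K.radiusPower n l := by
  obtain ⟨t⟩ := K.nonempty
  -- Two open patches near two corners of one triangle. Heights in them are within 1/4 of the
  -- heights of the corners, hence at least 1/2 apart.
  set O₁ : Set (ℝ × ℝ) := {u | 0 < u.1 ∧ 0 < u.2 ∧ u.1 + u.2 < 1} ∩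
    {u | |K.interpolate h (t, barycentric u) - h (K.vert t 0)| < 1 / 4} with hO₁
  set O₂ : Set (ℝ × ℝ) := {u | 0 < u.1 ∧ 0 < u.2 ∧ u.1 + u.2 < 1} ∩
    {u | |K.interpolate h (t, barycentric u) - h (K.vert t 1)| < 1 / 4} with hO₂
  have hi : ∀ u : ℝ × ℝ, K.interpolate h (t, barycentric u) =
      u.1 * h (K.vert t 0) + u.2 * h (K.vert t 1) + (1 - u.1 - u.2) * h (K.vert t 2) := fun u => by
    simp [interpolate, barycentric, Fin.sum_univ_three]
  have hopen : ∀ y : ℝ, IsOpen {u : ℝ × ℝ | |K.interpolate h (t, barycentric u) - y| < 1 / 4} :=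
    fun y => isOpen_lt (by simp only [hi]; fun_prop : Continuous fun u : ℝ × ℝ =>
      |K.interpolate h (t, barycentric u) - y|) continuous_const
  have ho₁ : IsOpen O₁ := isOpen_unitTriangle_interior.inter (hopen _)
  have ho₂ : IsOpen O₂ := isOpen_unitTriangle_interior.inter (hopen _)
  obtain ⟨H, hH0, hH⟩ : ∃ H : ℝ, 1 ≤ H ∧ ∀ i j : Fin 3, |h (K.vert t i) - h (K.vert t j)| ≤ H := by
    obtain ⟨B, hB⟩ := (Set.finite_range fun p : Fin 3 × Fin 3 =>
      |h (K.vert t p.1) - h (K.vert t p.2)|).bddAbove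
    exact ⟨max 1 B, le_max_left _ _, fun i j => (hB ⟨(i, j), rfl⟩).trans (le_max_right _ _)⟩
  -- Moving this weight from a corner to each of the other two changes the height by at most 1/8.
  have hx : 0 < 1 / (16 * H) := by positivity
  have hxH : 1 / (16 * H) * H = 1 / 16 := by field_simp
  have hx1 : 1 / (16 * H) ≤ 1 / 16 := by
    have := mul_le_mul_of_nonneg_left hH0 hx.le
    linarith
  set x := 1 / (16 * H) with hxdef
  have hn₁ : O₁.Nonempty := by
    refine ⟨(1 - 2 * x, x), ⟨by simp; linarith, by simpa using hx, by simp; linarith⟩, ?_⟩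
    have h1 := hH 1 0
    have h2 := hH 2 0
    rw [Set.mem_ofPred_eq, hi]
    simp only
    rw [show (1 - 2 * x) * h (K.vert t 0) + x * h (K.vert t 1) +
      (1 - (1 - 2 * x) - x) * h (K.vert t 2) - h (K.vert t 0) =
      x * (h (K.vert t 1) - h (K.vert t 0)) + x * (h (K.vert t 2) - h (K.vert t 0)) by ring]
    refine (abs_add_le _ _).trans_lt ?_
    rw [abs_mul, abs_mul, abs_of_pos hx]
    nlinarith
  have hn₂ : O₂.Nonempty := by
    refine ⟨(x, 1 - 2 * x), ⟨by simpa using hx, by simp; linarith, by simp; linarith⟩, ?_⟩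
    have h1 := hH 0 1
    have h2 := hH 2 1
    rw [Set.mem_ofPred_eq, hi]
    simp only
    rw [show x * h (K.vert t 0) + (1 - 2 * x) * h (K.vert t 1) +
      (1 - x - (1 - 2 * x)) * h (K.vert t 2) - h (K.vert t 1) =
      x * (h (K.vert t 0) - h (K.vert t 1)) + x * (h (K.vert t 2) - h (K.vert t 1)) by ring]
    refine (abs_add_le _ _).trans_lt ?_
    rw [abs_mul, abs_mul, abs_of_pos hx]
    nlinarith
  have hsub : ∀ u ∈ {u : ℝ × ℝ | 0 < u.1 ∧ 0 < u.2 ∧ u.1 + u.2 < 1}, u ∈ unitTriangle :=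
    fun u hu => ⟨hu.1.le, hu.2.1.le, hu.2.2.le⟩
  have hbdd : ∀ O : Set (ℝ × ℝ), O ⊆ {u : ℝ × ℝ | 0 < u.1 ∧ 0 < u.2 ∧ u.1 + u.2 < 1} →
      volume O ≠ ∞ := fun O hO => by
    refine ((Metric.isBounded_Icc (0 : ℝ × ℝ) 1).subset fun u hu => ?_).measure_lt_top.ne
    obtain ⟨h1, h2, h3⟩ := hO hu
    exact ⟨⟨h1.le, h2.le⟩, ⟨by show u.1 ≤ 1; linarith, by show u.2 ≤ 1; linarith⟩⟩
  set m := (volume O₁).toReal * (volume O₂).toReal with hm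
  have hf₁ := hbdd O₁ Set.inter_subset_left
  have hf₂ := hbdd O₂ Set.inter_subset_left
  have hmpos : 0 < m := mul_pos (ENNReal.toReal_pos (ho₁.measure_pos _ hn₁).ne' hf₁)
    (ENNReal.toReal_pos (ho₂.measure_pos _ hn₂).ne' hf₂)
  by_cases hb0 : 0 < b
  -- Triangle areas are at least `a`, which is positive, so a total area bounded by a nonpositive
  -- `b` is impossible.
  swap
  · refine ⟨1, one_pos, fun l k _ hal hbl _ => absurd ?_ hb0⟩
    exact ((ha.trans_le (hal t)).trans_le (Finset.single_le_sum
      (fun t _ => K.area_nonneg l t) (Finset.mem_univ t))).trans_le hbl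
  refine ⟨(2 * a) * (2 * a) * (m * (1 / 2) ^ n) / b ^ 2, by positivity,
    fun l k hk hal hbl hlip => ?_⟩
  have hdist : ∀ u ∈ O₁, ∀ u' ∈ O₂, (k * (1 / 2)) ^ n ≤
      K.geodesicDist l (t, barycentric u) (t, barycentric u') ^ n := by
    intro u hu u' hu'
    refine Real.rpow_le_rpow (by positivity) ?_ hn
    refine le_trans ?_ (K.le_geodesicDist hlip hk.le (barycentric_mem (hsub u hu.1))
      (barycentric_mem (hsub u' hu'.1)))
    gcongr
    have h1 := hh _ _ ((K.vert_injective t).ne (show (0 : Fin 3) ≠ 1 by decide))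
    have h2 := hu.2
    have h3 := hu'.2
    simp only [Set.mem_ofPred_eq] at h2 h3
    rw [abs_lt] at h2 h3
    rcases le_abs.1 h1 with h | h
    · exact le_abs.2 (Or.inl (by linarith))
    · exact le_abs.2 (Or.inr (by linarith))
  have hint : ENNReal.ofReal (m * (k * (1 / 2)) ^ n) ≤
      ∫⁻ u in unitTriangle, ∫⁻ u' in unitTriangle,
        ENNReal.ofReal (K.geodesicDist l (t, barycentric u) (t, barycentric u') ^ n) := by
    calc ENNReal.ofReal (m * (k * (1 / 2)) ^ n)
        = ∫⁻ _ in O₁, ∫⁻ _ in O₂, ENNReal.ofReal ((k * (1 / 2)) ^ n) := by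
          rw [setLIntegral_const, setLIntegral_const, hm, ENNReal.ofReal_mul (by positivity),
            ENNReal.ofReal_mul (by positivity), ENNReal.ofReal_toReal hf₁,
            ENNReal.ofReal_toReal hf₂]
          ring
      _ ≤ ∫⁻ u in O₁, ∫⁻ u' in O₂,
          ENNReal.ofReal (K.geodesicDist l (t, barycentric u) (t, barycentric u') ^ n) :=
        setLIntegral_mono' ho₁.measurableSet fun u hu =>
          setLIntegral_mono' ho₂.measurableSet fun u' hu' =>
            ENNReal.ofReal_le_ofReal (hdist u hu u' hu')
      _ ≤ ∫⁻ u in unitTriangle, ∫⁻ u' in O₂,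
          ENNReal.ofReal (K.geodesicDist l (t, barycentric u) (t, barycentric u') ^ n) :=
        lintegral_mono_set fun u hu => hsub u hu.1
      _ ≤ _ := lintegral_mono fun u => lintegral_mono_set fun u hu => hsub u hu.1
  have hA : 0 < K.totalArea l := (ha.trans_le (hal t)).trans_le (Finset.single_le_sum
    (fun t _ => K.area_nonneg l t) (Finset.mem_univ t))
  have h4 : ENNReal.ofReal (2 * a) * ENNReal.ofReal (2 * a) *
      ENNReal.ofReal (m * (k * (1 / 2)) ^ n) ≤
      ∑ t, ∑ t', ENNReal.ofReal (2 * K.area l t) * ENNReal.ofReal (2 * K.area l t') *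
    ∫⁻ u in unitTriangle, ∫⁻ u' in unitTriangle,
      ENNReal.ofReal (K.geodesicDist l (t, barycentric u) (t', barycentric u') ^ n) := by
    refine le_trans ?_ (Finset.single_le_sum (fun _ _ => zero_le) (Finset.mem_univ t))
    refine le_trans ?_ (Finset.single_le_sum (fun _ _ => zero_le) (Finset.mem_univ t))
    have := hal t
    gcongr
  rw [radiusPower]
  refine le_trans ?_ (ENNReal.div_le_div h4 (pow_le_pow_left₀ zero_le
    (ENNReal.ofReal_le_ofReal hbl) 2))
  rw [← ENNReal.ofReal_mul (by positivity), ← ENNReal.ofReal_mul (by positivity),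
    ← ENNReal.ofReal_pow hb0.le, ← ENNReal.ofReal_div_of_pos (by positivity)]
  refine ENNReal.ofReal_le_ofReal (le_of_eq ?_)
  rw [Real.mul_rpow hk.le (by norm_num)]
  ring

end ClosedTriangulation

namespace ClosedTriangulation

variable {Vert Link Tri : Type*} (K : ClosedTriangulation Vert Link Tri)

/-! ### The region of stretched surfaces -/

/-- The exponents -α and -β may have either sign, so powers are compared with both end values. -/
lemma min_rpow_le {a b x : ℝ} (ha : 0 < a) (hax : a ≤ x) (hxb : x ≤ b) (p : ℝ) :
    min (a ^ p) (b ^ p) ≤ x ^ p := by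
  rcases le_total 0 p with hp | hp
  · exact (min_le_left _ _).trans (Real.rpow_le_rpow ha.le hax hp)
  · exact (min_le_right _ _).trans (Real.rpow_le_rpow_of_nonpos (ha.trans_le hax) hxb hp)

lemma continuous_areaSq (t : Tri) : Continuous fun s : Link → ℝ => K.areaSq s t := by
  unfold areaSq heron
  fun_prop

lemma continuous_gram (t : Tri) (d : Fin 3 → ℝ) :
    Continuous fun s : Link → ℝ => K.gram s t d := by
  unfold gram
  fun_prop

/-- The squared area of a triangle of a stretched surface. -/
noncomputable def ridgeAreaSq (h : Vert → ℝ) (s : Link → ℝ) (κ : ℝ) (t : Tri) : ℝ :=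
  K.gram s t (K.heightDiff h t) / 4 + κ * K.areaSq s t

lemma continuous_ridgeAreaSq (h : Vert → ℝ) (t : Tri) :
    Continuous fun p : (Link → ℝ) × ℝ => K.ridgeAreaSq h p.1 p.2 t := by
  have h1 := (K.continuous_areaSq t).comp (continuous_fst (X := Link → ℝ) (Y := ℝ))
  have h2 := (K.continuous_gram t (K.heightDiff h t)).comp (continuous_fst (X := Link → ℝ) (Y := ℝ))
  exact (h2.div_const 4).add (continuous_snd.mul h1)

lemma ridgeAreaSq_pos {h : Vert → ℝ} (hh : ∀ x y, x ≠ y → 1 ≤ |h x - h y|) {s : Link → ℝ}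
    (hs : ∀ e, 0 < s e) {t : Tri} (ht : 0 < K.areaSq s t) {κ : ℝ} (hκ : 0 ≤ κ) :
    0 < K.ridgeAreaSq h s κ t := by
  have h2 : K.heightDiff h t 2 ≠ 0 := by
    have := hh _ _ (K.vert_ne t 2)
    intro h0
    rw [heightDiff] at h0
    rw [h0, abs_zero] at this
    linarith
  have := K.gram_pos hs ht (K.sum_heightDiff h t) h2
  unfold ridgeAreaSq
  positivity

/-- The link lengths of a stretched surface. -/
noncomputable def ridge (h : Vert → ℝ) (k : ℝ) (s : Link → ℝ) (e : Link) : ℝ :=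
  √(K.ridgeSq h k s e)

section

variable {h : Vert → ℝ} (hh : ∀ x y, x ≠ y → 1 ≤ |h x - h y|) {k : ℝ} (hk : 1 ≤ k)
  {s : Link → ℝ} (hs : ∀ e, 0 < s e)

include hh hk hs

lemma le_ridgeSq (e : Link) : k ^ 2 ≤ K.ridgeSq h k s e := by
  have h1 := K.one_le_heightSq hh e
  have h2 := hs e
  have h3 : 0 ≤ s e / k ^ 2 := by positivity
  unfold ridgeSq
  nlinarith [sq_nonneg k]

lemma le_ridge (e : Link) : k ≤ K.ridge h k s e :=
  Real.le_sqrt_of_sq_le (K.le_ridgeSq hh hk hs e)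

lemma ridge_sq (e : Link) : K.ridge h k s e ^ 2 = K.ridgeSq h k s e :=
  Real.sq_sqrt ((sq_nonneg k).trans (K.le_ridgeSq hh hk hs e))

lemma ridge_le (e : Link) : K.ridge h k s e ≤ k * (K.heightSq h e + s e) := by
  have h1 := K.one_le_heightSq hh e
  have h2 := hs e
  apply Real.sqrt_le_iff.2 ⟨by positivity, ?_⟩
  have h3 : s e / k ^ 2 ≤ k ^ 2 * s e := by
    rw [div_le_iff₀ (by positivity)]
    have : 1 ≤ k ^ 2 * k ^ 2 := by nlinarith [one_le_pow₀ hk (n := 2)]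
    nlinarith
  unfold ridgeSq
  rw [mul_pow]
  have h4 : K.heightSq h e + s e ≤ (K.heightSq h e + s e) ^ 2 := by nlinarith
  nlinarith [sq_nonneg k, mul_le_mul_of_nonneg_left h4 (sq_nonneg k)]

lemma area_ridge (t : Tri) : K.area (K.ridge h k s) t = √(K.ridgeAreaSq h s ((k⁻¹) ^ 4) t) := by
  rw [area_eq, funext (K.ridge_sq hh hk hs), K.areaSq_ridgeSq h (by linarith) s t, ridgeAreaSq]

lemma ridge_mem_admissible (hs' : ∀ t, 0 < K.areaSq s t) : K.ridge h k s ∈ K.admissible := by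
  refine (K.mem_admissible_iff _).2 ⟨fun e => ?_, fun t => ?_⟩
  · linarith [K.le_ridge hh hk hs e]
  · rw [funext (K.ridge_sq hh hk hs), K.areaSq_ridgeSq h (by linarith) s t]
    exact K.ridgeAreaSq_pos hh hs (hs' t) (by positivity)

end

variable [Fintype Link]

/-- In each coordinate the end points have squares that differ by 2r/k² and a sum of order k, so the
interval has length of order r/k³. -/
lemma le_volume_ridge {h : Vert → ℝ} (hh : ∀ x y, x ≠ y → 1 ≤ |h x - h y|) {X : Link → ℝ}
    {r k : ℝ} (hk : 1 ≤ k) (hr : 0 < r) (hrX : ∀ e, r < X e) :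
    ENNReal.ofReal ((∏ e, (K.heightSq h e + 2 * X e)⁻¹) * (r * (k ^ 3)⁻¹) ^ Fintype.card Link) ≤
      volume (Set.Icc (K.ridge h k fun e => X e - r) (K.ridge h k fun e => X e + r)) := by
  rw [Real.volume_Icc_pi, ← ENNReal.ofReal_prod_of_nonneg]
  swap
  · intro e _
    refine sub_nonneg.2 (Real.sqrt_le_sqrt ?_)
    unfold ridgeSq
    gcongr
    linarith
  refine ENNReal.ofReal_le_ofReal ?_
  rw [← Finset.card_univ, ← Finset.prod_const, ← Finset.prod_mul_distrib]
  refine Finset.prod_le_prod (fun e _ => ?_) fun e _ => ?_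
  · have := K.one_le_heightSq hh e
    have := hr.trans (hrX e)
    positivity
  have hD := K.one_le_heightSq hh e
  have hm : ∀ e, 0 < X e - r := fun e => sub_pos.2 (hrX e)
  have hp : ∀ e, 0 < X e + r := fun e => by linarith [hrX e]
  have h1 := K.ridge_sq hh hk hm e
  have h2 := K.ridge_sq hh hk hp e
  have h3 := K.ridge_le hh hk hm e
  have h4 := K.ridge_le hh hk hp e
  have h5 := K.le_ridge hh hk hm e
  have h6 := K.le_ridge hh hk hp e
  set a := K.ridge h k (fun e => X e - r) e
  set b := K.ridge h k (fun e => X e + r) e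
  have hX := hrX e
  have hab : (b - a) * (b + a) = 2 * r / k ^ 2 := by
    have : (b - a) * (b + a) = b ^ 2 - a ^ 2 := by ring
    rw [this, h1, h2, ridgeSq, ridgeSq]
    ring
  have h7 : b + a ≤ 2 * (k * (K.heightSq h e + 2 * X e)) := by nlinarith
  have h8 : 0 < b + a := by linarith
  have h9 : b - a = 2 * r / k ^ 2 / (b + a) := by rw [← hab]; field_simp
  rw [h9, le_div_iff₀ h8]
  have h10 : 0 < K.heightSq h e + 2 * X e := by linarith
  calc (K.heightSq h e + 2 * X e)⁻¹ * (r * (k ^ 3)⁻¹) * (b + a)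
      ≤ (K.heightSq h e + 2 * X e)⁻¹ * (r * (k ^ 3)⁻¹) *
        (2 * (k * (K.heightSq h e + 2 * X e))) := by gcongr
    _ = 2 * r / k ^ 2 := by field_simp

variable [Fintype Tri]

/-- The squared areas depend continuously on (s, κ), also at κ = 0, where they are still positive.
This gives bounds uniform in k for small κ = k⁻⁴. -/
lemma exists_ridge_bounds {h : Vert → ℝ} (hh : ∀ x y, x ≠ y → 1 ≤ |h x - h y|) {X : Link → ℝ}
    (hX : ∀ e, 0 < X e) (hX' : ∀ t, 0 < K.areaSq X t) :
    ∃ r > 0, ∃ a > 0, ∃ b > 0, ∃ κ₀ > 0, ∀ s : Link → ℝ, (∀ e, |s e - X e| ≤ r) →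
      (∀ e, 0 < s e) ∧ (∀ t, 0 < K.areaSq s t) ∧
      ∀ κ, |κ| ≤ κ₀ → ∀ t, a ≤ K.ridgeAreaSq h s κ t ∧ K.ridgeAreaSq h s κ t ≤ b := by
  have hpos := fun t => K.ridgeAreaSq_pos hh hX (hX' t) le_rfl
  obtain ⟨t₀⟩ := K.nonempty
  obtain ⟨a, ha, ha'⟩ : ∃ a > 0, ∀ t, a < K.ridgeAreaSq h X 0 t := by
    obtain ⟨t, -, ht⟩ := Finset.exists_min_image Finset.univ (K.ridgeAreaSq h X 0)
      ⟨t₀, Finset.mem_univ _⟩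
    exact ⟨K.ridgeAreaSq h X 0 t / 2, half_pos (hpos t), fun t' =>
      (half_lt_self (hpos t)).trans_le (ht t' (Finset.mem_univ _))⟩
  obtain ⟨b, hb, hb'⟩ : ∃ b > 0, ∀ t, K.ridgeAreaSq h X 0 t < b := by
    refine ⟨∑ t, K.ridgeAreaSq h X 0 t + 1, ?_, fun t => ?_⟩
    · have := Finset.sum_nonneg fun t (_ : t ∈ Finset.univ) => (hpos t).le
      linarith
    · have := Finset.single_le_sum (fun t _ => (hpos t).le) (Finset.mem_univ t)
      linarith
  have hev : ∀ᶠ p : (Link → ℝ) × ℝ in 𝓝 (X, 0), (∀ e, 0 < p.1 e) ∧ (∀ t, 0 < K.areaSq p.1 t) ∧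
      ∀ t, a < K.ridgeAreaSq h p.1 p.2 t ∧ K.ridgeAreaSq h p.1 p.2 t < b := by
    refine Filter.Eventually.and ?_ (Filter.Eventually.and ?_ ?_)
    · refine eventually_all.2 fun e => ?_
      have hc : Continuous fun p : (Link → ℝ) × ℝ => p.1 e := by fun_prop
      exact hc.continuousAt.eventually_const_lt (hX e)
    · refine eventually_all.2 fun t => ?_
      have hc : Continuous fun p : (Link → ℝ) × ℝ => K.areaSq p.1 t :=
        (K.continuous_areaSq t).comp continuous_fst
      exact hc.continuousAt.eventually_const_lt (hX' t)
    · refine eventually_all.2 fun t => ?_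
      have hc := (K.continuous_ridgeAreaSq h t).continuousAt (x := (X, 0))
      exact (hc.eventually_const_lt (ha' t)).and (hc.eventually_lt_const (hb' t))
  obtain ⟨δ, hδ, hball⟩ := Metric.eventually_nhds_iff_ball.1 hev
  have hmem : ∀ s : Link → ℝ, (∀ e, |s e - X e| ≤ δ / 2) → ∀ κ, |κ| ≤ δ / 2 →
      (s, κ) ∈ Metric.ball (X, (0 : ℝ)) δ := by
    intro s hs κ hκ
    rw [Metric.mem_ball, Prod.dist_eq]
    refine lt_of_le_of_lt (max_le ?_ ?_) (half_lt_self hδ)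
    · exact (dist_pi_le_iff (by positivity)).2 fun e => hs e
    · simpa using hκ
  refine ⟨δ / 2, by positivity, a, ha, b, hb, δ / 2, by positivity, fun s hs => ?_⟩
  have h0 := hball _ (hmem s hs 0 (by simpa using (half_pos hδ).le))
  refine ⟨h0.1, h0.2.1, fun κ hκ t => ?_⟩
  have h1 := (hball _ (hmem s hs κ hκ)).2.2 t
  exact ⟨h1.1.le, h1.2.le⟩

/-- If a homogeneous density decays at most polynomially around some family of stretched surfaces,
then high powers of the link lengths and of the radius have infinite expectation values. -/
lemma diverges_of_ridge {J : (Link → ℝ) → ℝ} {p : ℝ}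
    (hJ : ∀ c : ℝ, 0 < c → ∀ l ∈ K.admissible, J (c • l) = c ^ p * J l)
    {h : Vert → ℝ} (hh : ∀ x y, x ≠ y → 1 ≤ |h x - h y|) {X : Link → ℝ}
    (hX : ∀ e, 0 < X e) (hX' : ∀ t, 0 < K.areaSq X t) {c m k₀ : ℝ} (hc : 0 < c) (hm : 0 ≤ m)
    (hlow : ∀ k, k₀ ≤ k → ∀ s : Link → ℝ, (∀ e, |s e - X e| ≤ c * k ^ (-m)) →
      c * k ^ (-m) ≤ J (K.ridge h k s)) :
    ∃ n₀ : ℝ, ∀ n : ℝ, n₀ ≤ n → ∀ V : ℝ, 0 < V →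
      (∀ e : Link, K.Diverges (K.measureOfDensity J) V (linkPower e n)) ∧
      K.Diverges (K.measureOfDensity J) V (K.radiusPower n) := by
  obtain ⟨r₀, hr₀, a, ha, b, hb, κ₀, hκ₀, hbd⟩ := K.exists_ridge_bounds hh hX hX'
  obtain ⟨c', hc', hc'c, hc'r⟩ : ∃ c' > 0, c' ≤ c ∧ c' ≤ r₀ :=
    ⟨min c r₀, lt_min hc hr₀, min_le_left _ _, min_le_right _ _⟩
  obtain ⟨k₁, hk₁, hk₁0, hk₁κ⟩ : ∃ k₁ : ℝ, 1 ≤ k₁ ∧ k₀ ≤ k₁ ∧ ∀ k, k₁ ≤ k → (k⁻¹) ^ 4 ≤ κ₀ := by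
    refine ⟨max (max 1 k₀) κ₀⁻¹, (le_max_left _ _).trans (le_max_left _ _),
      (le_max_right _ _).trans (le_max_left _ _), fun k hk => ?_⟩
    have hk1 : 1 ≤ k := ((le_max_left _ _).trans (le_max_left _ _)).trans hk
    have hk2 : k⁻¹ ≤ κ₀ := by
      rw [inv_le_comm₀ (by linarith) hκ₀]
      exact (le_max_right _ _).trans hk
    have hk3 : k⁻¹ ≤ 1 := inv_le_one_of_one_le₀ hk1
    refine le_trans ?_ hk2
    exact pow_le_of_le_one (by positivity) hk3 (by norm_num)
  set Λ := Fintype.card Link with hΛ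
  set T := Fintype.card Tri with hT
  set W := ∏ e, (K.heightSq h e + 2 * X e)⁻¹ with hWdef
  have hW : 0 < W := Finset.prod_pos fun e _ => by
    have := K.one_le_heightSq hh e
    have := hX e
    positivity
  -- The density costs the power m of k, and each of the Λ coordinates costs m from the tolerance
  -- and 3 from the width of the window. The final 1 makes the bound grow at least linearly in k.
  set n₀ := m + (m + 3) * Λ + 1 with hn₀
  have hn₀1 : 1 ≤ n₀ := by
    have : 0 ≤ (m + 3) * (Λ : ℝ) := by positivity
    linarith
  refine ⟨n₀, fun n hn V hV => ?_⟩
  have hT0 : (0 : ℝ) < T := by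
    have := K.nonempty
    exact_mod_cast Fintype.card_pos
  have main : ∀ f : (Link → ℝ) → ℝ≥0∞, (∃ C > 0, ∀ k, k₁ ≤ k → ∀ s : Link → ℝ,
      (∀ e, |s e - X e| ≤ r₀) → ENNReal.ofReal (C * k ^ n) ≤ f (K.ridge h k s)) →
      ∫⁻ l in {l | K.totalArea l ∈ Set.Icc (√a) (T * √b)}, f l ∂K.measureOfDensity J = ∞ := by
    rintro f ⟨C, hC, hf⟩
    have hbound : ∀ k, k₁ ≤ k → ENNReal.ofReal (C * c * W * c' ^ Λ * k) ≤
        ∫⁻ l in {l | K.totalArea l ∈ Set.Icc (√a) (T * √b)}, f l ∂K.measureOfDensity J := by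
      intro k hk
      have hk1 : 1 ≤ k := hk₁.trans hk
      have hk0 : 0 < k := by linarith
      have hkm : k ^ (-m) ≤ 1 := Real.rpow_le_one_of_one_le_of_nonpos hk1 (by linarith)
      have hkm0 : 0 < k ^ (-m) := Real.rpow_pos_of_pos hk0 _
      set r := c' * k ^ (-m) with hr
      have hr0 : 0 < r := by positivity
      have hrc : r ≤ c * k ^ (-m) := by
        rw [hr]
        gcongr
      have hrr : r ≤ r₀ := by
        rw [hr]
        nlinarith
      have hXr : ∀ e, r < X e := fun e => by
        have h1 := (hbd (fun e => X e - r) fun e => by simp [abs_of_pos hr0, hrr]).1 e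
        linarith
      set U := Set.Icc (K.ridge h k fun e => X e - r) (K.ridge h k fun e => X e + r) with hU
      have hUs : ∀ l ∈ U, ∃ s : Link → ℝ, (∀ e, |s e - X e| ≤ r) ∧ l = K.ridge h k s := by
        intro l hl
        have hpos : ∀ e, 0 < l e := fun e => by
          have h1 := K.le_ridge hh hk1 (s := fun e => X e - r) (fun e => sub_pos.2 (hXr e)) e
          linarith [hl.1 e]
        -- Solving `ridgeSq` for the transverse squared length shows that the box of lengths is
        -- parametrized by the box of `s`.
        refine ⟨fun e => k ^ 2 * (l e ^ 2 - k ^ 2 * K.heightSq h e), fun e => ?_, ?_⟩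
        · have h1 : K.ridgeSq h k (fun e => X e - r) e ≤ l e ^ 2 := by
            rw [← K.ridge_sq hh hk1 (fun e => sub_pos.2 (hXr e))]
            have := hl.1 e
            have := (hk0.trans_le (K.le_ridge hh hk1 (s := fun e => X e - r)
              (fun e => sub_pos.2 (hXr e)) e)).le
            gcongr
          have h2 : l e ^ 2 ≤ K.ridgeSq h k (fun e => X e + r) e := by
            rw [← K.ridge_sq hh hk1 (fun e => by linarith [hXr e])]
            have := hl.2 e
            have := (hpos e).le
            gcongr
          have h3 : ∀ y : ℝ, k ^ 2 * (y / k ^ 2) = y := fun y => by field_simp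
          simp only [ridgeSq] at h1 h2
          rw [abs_le]
          constructor
          · have := mul_le_mul_of_nonneg_left h1 (sq_nonneg k)
            rw [mul_add, h3] at this
            linarith
          · have := mul_le_mul_of_nonneg_left h2 (sq_nonneg k)
            rw [mul_add, h3] at this
            linarith
        · ext e
          rw [ridge, ridgeSq, mul_div_cancel_left₀ _ (by positivity), add_sub_cancel,
            Real.sqrt_sq (hpos e).le]
      have hκ : |(k⁻¹) ^ 4| ≤ κ₀ := by
        rw [abs_of_pos (by positivity)]
        exact hk₁κ k hk
      have hUadm : U ⊆ K.admissible := by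
        intro l hl
        obtain ⟨s, hs, rfl⟩ := hUs l hl
        have := hbd s fun e => (hs e).trans hrr
        exact K.ridge_mem_admissible hh hk1 this.1 this.2.1
      have hUarea : U ⊆ {l | K.totalArea l ∈ Set.Icc (√a) (T * √b)} := by
        intro l hl
        obtain ⟨s, hs, rfl⟩ := hUs l hl
        have hb1 := hbd s fun e => (hs e).trans hrr
        have hA : ∀ t, √a ≤ K.area (K.ridge h k s) t ∧ K.area (K.ridge h k s) t ≤ √b := by
          intro t
          rw [K.area_ridge hh hk1 hb1.1]
          exact ⟨Real.sqrt_le_sqrt (hb1.2.2 _ hκ t).1, Real.sqrt_le_sqrt (hb1.2.2 _ hκ t).2⟩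
        obtain ⟨t₀⟩ := K.nonempty
        constructor
        · exact (hA t₀).1.trans (Finset.single_le_sum (fun t _ => K.area_nonneg _ t)
            (Finset.mem_univ t₀))
        · refine (Finset.sum_le_card_nsmul _ _ _ fun t _ => (hA t).2).trans ?_
          rw [nsmul_eq_mul, Finset.card_univ]
      refine le_trans ?_ ((K.le_setLIntegral (measurableSet_Icc) hUadm (f := f)
        (F := C * k ^ n) (G := c * k ^ (-m))
        (W := W * (r * (k ^ 3)⁻¹) ^ Λ) (by positivity) (by positivity) ?_ ?_ ?_).trans
        (lintegral_mono_set hUarea))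
      · refine ENNReal.ofReal_le_ofReal ?_
        have e1 : C * k ^ n * (c * k ^ (-m)) * (W * (r * (k ^ 3)⁻¹) ^ Λ) =
            C * c * W * c' ^ Λ * (k ^ n * k ^ (-m) * (k ^ (-m) * (k ^ 3)⁻¹) ^ Λ) := by
          rw [hr, mul_assoc c', mul_pow c']
          ring
        have e2 : k ^ n * k ^ (-m) * (k ^ (-m) * (k ^ 3)⁻¹) ^ Λ =
            k ^ (n - m - (m + 3) * Λ) := by
          rw [← Real.rpow_natCast k 3, ← Real.rpow_neg hk0.le, ← Real.rpow_add hk0,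
            ← Real.rpow_add hk0, ← Real.rpow_natCast (_ ^ _), ← Real.rpow_mul hk0.le,
            ← Real.rpow_add hk0]
          congr 1
          push_cast
          ring
        rw [e1, e2]
        gcongr
        conv_lhs => rw [← Real.rpow_one k]
        exact Real.rpow_le_rpow_of_exponent_le hk1 (by linarith)
      · intro l hl
        obtain ⟨s, hs, rfl⟩ := hUs l hl
        exact hf k hk s fun e => (hs e).trans hrr
      · intro l hl
        obtain ⟨s, hs, rfl⟩ := hUs l hl
        exact hlow k (hk₁0.trans hk) s fun e => (hs e).trans hrc
      · exact K.le_volume_ridge hh hk1 hr0 hXr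
    -- One fixed integral is bounded below by a multiple of k for all large k.
    refine ENNReal.eq_top_of_forall_nnreal_le fun y => ?_
    have hD : 0 < C * c * W * c' ^ Λ := by positivity
    refine le_trans ?_ (hbound (max k₁ (y / (C * c * W * c' ^ Λ))) (le_max_left _ _))
    rw [← ENNReal.ofReal_coe_nnreal]
    refine ENNReal.ofReal_le_ofReal ?_
    rw [mul_comm, ← div_le_iff₀ hD]
    exact le_max_right _ _
  have hsqa : 0 < √a := Real.sqrt_pos.2 ha
  refine ⟨fun e => K.diverges_of_homogeneous hJ (fun c hc l hl => K.linkPower_smul e n hc hl)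
    hsqa (main _ ?_) hV, K.diverges_of_homogeneous hJ
    (fun c hc l hl => K.radiusPower_smul n hc l) hsqa (main _ ?_) hV⟩
  · refine ⟨1, one_pos, fun k hk s hs => ENNReal.ofReal_le_ofReal ?_⟩
    rw [one_mul]
    exact Real.rpow_le_rpow (by linarith) (K.le_ridge hh (hk₁.trans hk) (hbd s hs).1 e)
      (by linarith)
  · obtain ⟨C, hC, hrad⟩ := K.exists_le_radiusPower hh (b := T * √b) hsqa
      (show 0 ≤ n by linarith)
    refine ⟨C, hC, fun k hk s hs => ?_⟩
    have hk1 : 1 ≤ k := hk₁.trans hk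
    have hb1 := hbd s hs
    have hκ : |(k⁻¹) ^ 4| ≤ κ₀ := by
      rw [abs_of_pos (by positivity)]
      exact hk₁κ k hk
    have hA : ∀ t, √a ≤ K.area (K.ridge h k s) t ∧ K.area (K.ridge h k s) t ≤ √b := by
      intro t
      rw [K.area_ridge hh hk1 hb1.1]
      exact ⟨Real.sqrt_le_sqrt (hb1.2.2 _ hκ t).1, Real.sqrt_le_sqrt (hb1.2.2 _ hκ t).2⟩
    refine hrad _ k (by linarith) (fun t => (hA t).1) ?_ ?_
    · refine (Finset.sum_le_card_nsmul _ _ _ fun t _ => (hA t).2).trans ?_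
      rw [nsmul_eq_mul, Finset.card_univ]
    · intro t b hb b' hb'
      exact K.le_segmentLength_of_sq_eq_ridgeSq (by linarith) hb1.1 hb1.2.1
        (K.ridge_sq hh hk1 hb1.1) t hb hb'

end ClosedTriangulation

namespace ClosedTriangulation

variable {Vert Link Tri : Type*} (K : ClosedTriangulation Vert Link Tri)
variable [Fintype Link] [Fintype Tri]

/-! ### Local measures on stretched surfaces -/

lemma exists_le_prod_area_ridge {h : Vert → ℝ} (hh : ∀ x y, x ≠ y → 1 ≤ |h x - h y|)
    {X : Link → ℝ} (hX : ∀ e, 0 < X e) (hX' : ∀ t, 0 < K.areaSq X t) (β : ℝ) :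
    ∃ r > 0, ∃ c > 0, ∃ k₀ ≥ (1 : ℝ), ∀ k, k₀ ≤ k → ∀ s : Link → ℝ, (∀ e, |s e - X e| ≤ r) →
      (∀ e, 0 < s e) ∧ (∀ t, 0 < K.areaSq s t) ∧ c ≤ ∏ t, K.area (K.ridge h k s) t ^ (-β) := by
  obtain ⟨r, hr, a, ha, b, hb, κ₀, hκ₀, hbd⟩ := K.exists_ridge_bounds hh hX hX'
  refine ⟨r, hr, ∏ _t : Tri, min (√a ^ (-β)) (√b ^ (-β)), by positivity, max 1 κ₀⁻¹,
    le_max_left _ _, fun k hk s hs => ⟨(hbd s hs).1, (hbd s hs).2.1, ?_⟩⟩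
  have hk1 : 1 ≤ k := (le_max_left _ _).trans hk
  have hκ : |(k⁻¹) ^ 4| ≤ κ₀ := by
    rw [abs_of_pos (by positivity)]
    refine (pow_le_of_le_one (by positivity) (inv_le_one_of_one_le₀ hk1) (by norm_num)).trans ?_
    rw [inv_le_comm₀ (by linarith) hκ₀]
    exact (le_max_right _ _).trans hk
  refine Finset.prod_le_prod (fun t _ => by positivity) fun t _ => ?_
  rw [K.area_ridge hh hk1 (hbd s hs).1]
  have := (hbd s hs).2.2 _ hκ t
  exact min_rpow_le (Real.sqrt_pos.2 ha) (Real.sqrt_le_sqrt this.1) (Real.sqrt_le_sqrt this.2) _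

theorem localMeasure_diverges (α β : ℝ) : ∃ n₀ : ℝ, ∀ n : ℝ, n₀ ≤ n → ∀ V : ℝ, 0 < V →
    (∀ e : Link, K.Diverges (K.localMeasure α β) V (linkPower e n)) ∧
    K.Diverges (K.localMeasure α β) V (K.radiusPower n) := by
  obtain ⟨h, hh⟩ := K.exists_height
  have hX : ∀ e : Link, (0 : ℝ) < (fun _ => 1 : Link → ℝ) e := fun _ => one_pos
  have hX' : ∀ t, 0 < K.areaSq (fun _ => 1) t := fun t => by
    unfold areaSq heron; norm_num
  obtain ⟨r, hr, c, hc, k₀, hk₀, hbd⟩ := K.exists_le_prod_area_ridge hh hX hX' β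
  set Λ := Fintype.card Link
  set w : Link → ℝ := fun e => min (1 ^ (-α)) ((K.heightSq h e + (1 + r)) ^ (-α)) with hw
  have hw0 : ∀ e, 0 < w e := fun e => by
    have := K.one_le_heightSq hh e
    have : 0 < K.heightSq h e + (1 + r) := by linarith
    exact lt_min (by positivity) (by positivity)
  have hC : 0 < c * ∏ e, w e := mul_pos hc (Finset.prod_pos fun e _ => hw0 e)
  -- The lengths are of order k, so the density is of order k to the power -αΛ. The maximum with 0
  -- and the minimum with `r` let one pair of constants serve for both the density and the
  -- tolerance.
  refine K.diverges_of_ridge (K.localDensity_smul α β) hh hX hX' (m := max (α * Λ) 0)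
    (lt_min hC hr) (le_max_right _ _) (k₀ := k₀) fun k hk s hs => ?_
  have hk1 : 1 ≤ k := hk₀.trans hk
  have hk0 : 0 < k := by linarith
  have hkm : k ^ (-max (α * Λ) 0) ≤ 1 :=
    Real.rpow_le_one_of_one_le_of_nonpos hk1 (by linarith [le_max_right (α * Λ) 0])
  have hkm0 : 0 < k ^ (-max (α * Λ) 0) := Real.rpow_pos_of_pos hk0 _
  have hs' : ∀ e, |s e - 1| ≤ r := fun e => by
    refine (hs e).trans ?_
    have := min_le_right (c * ∏ e, w e) r
    nlinarith
  obtain ⟨hs0, hs0', hA⟩ := hbd k hk s hs'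
  have hl : ∀ e, k ^ (-α) * w e ≤ K.ridge h k s e ^ (-α) := fun e => by
    have h1 := K.le_ridge hh hk1 hs0 e
    have h2 := K.ridge_le hh hk1 hs0 e
    have h3 : K.ridge h k s e = k * (K.ridge h k s e / k) := by field_simp
    rw [h3, Real.mul_rpow hk0.le (div_nonneg (hk0.le.trans h1) hk0.le)]
    refine mul_le_mul_of_nonneg_left (min_rpow_le one_pos ?_ ?_ _) (by positivity)
    · rwa [le_div_iff₀ hk0, one_mul]
    · rw [div_le_iff₀ hk0]
      have := (abs_le.1 (hs' e)).2
      nlinarith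
  calc min (c * ∏ e, w e) r * k ^ (-max (α * Λ) 0)
      ≤ (c * ∏ e, w e) * k ^ (-α * Λ) := by
        gcongr
        · exact min_le_left _ _
        · linarith [le_max_left (α * Λ) 0]
    _ = c * ∏ e, (k ^ (-α) * w e) := by
        rw [Finset.prod_mul_distrib, Finset.prod_const, Finset.card_univ, Real.rpow_mul hk0.le,
          Real.rpow_natCast]
        ring
    _ ≤ _ := mul_le_mul hA (Finset.prod_le_prod (fun e _ => by have := hw0 e; positivity)
        fun e _ => hl e) (Finset.prod_nonneg fun e _ => by have := hw0 e; positivity)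
        (hc.le.trans hA)

/-! ### Analyticity of the DeWitt-like density -/

lemma analyticAt_rpow_const {E : Type*} [NormedAddCommGroup E] [NormedSpace ℝ E] {f : E → ℝ}
    {x : E} (hf : AnalyticAt ℝ f x) (h : 0 < f x) (p : ℝ) : AnalyticAt ℝ (fun y => f y ^ p) x := by
  have hlog : AnalyticAt ℝ (fun y => Real.log (f y)) x :=
    (analyticAt_log h).comp hf
  refine ((hlog.mul (analyticAt_const (v := p))).rexp).congr ?_
  filter_upwards [hf.continuousAt.eventually_const_lt h] with y hy
  rw [Real.rpow_def_of_pos hy]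
  rfl

lemma analyticAt_deWittPoly [DecidableEq Link] {E : Type*} [NormedAddCommGroup E]
    [NormedSpace ℝ E] {B : Tri → E → ℝ} {x : E} (hB : ∀ t, AnalyticAt ℝ (B t) x)
    (h : ∀ t, B t x ≠ 0) : AnalyticAt ℝ (fun y => K.deWittPoly fun t => B t y) x := by
  classical
  simp only [deWittPoly, Matrix.det_apply', deWittMatrix, Matrix.of_apply]
  refine (Finset.analyticAt_fun_prod _ fun t _ => (hB t).pow 3).mul
    (Finset.analyticAt_fun_sum _ fun σ _ => analyticAt_const.mul
      (Finset.analyticAt_fun_prod _ fun i _ => Finset.analyticAt_fun_sum _ fun t _ => ?_))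
  split_ifs
  · exact analyticAt_const.div (hB t) (h t)
  · exact (analyticAt_const.div (hB t) (h t)).neg

lemma analyticAt_ridgeAreaSq (h : Vert → ℝ) (t : Tri) (p : (Link → ℝ) × ℝ) :
    AnalyticAt ℝ (fun p : (Link → ℝ) × ℝ => K.ridgeAreaSq h p.1 p.2 t) p := by
  have h1 : ∀ e, AnalyticAt ℝ (fun p : (Link → ℝ) × ℝ => p.1 e) p := fun e =>
    ((ContinuousLinearMap.proj (R := ℝ) (φ := fun _ : Link => ℝ) e).comp
      (ContinuousLinearMap.fst ℝ (Link → ℝ) ℝ)).analyticAt p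
  have h2 : AnalyticAt ℝ (fun p : (Link → ℝ) × ℝ => p.2) p := analyticAt_snd
  simp only [ridgeAreaSq, gram_eq, areaSq, heron]
  have a0 := h1 (K.side t 0)
  have a1 := h1 (K.side t 1)
  have a2 := h1 (K.side t 2)
  fun_prop

variable [DecidableEq Link]

/-- The polynomial of the DeWitt-like measure on a stretched surface. -/
noncomputable def ridgePoly (h : Vert → ℝ) (β : ℝ) (p : (Link → ℝ) × ℝ) : ℝ :=
  K.deWittPoly fun t => K.ridgeAreaSq h p.1 p.2 t ^ (β / 3)

lemma analyticAt_ridgePoly (h : Vert → ℝ) (β : ℝ) {p : (Link → ℝ) × ℝ}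
    (hp : ∀ t, 0 < K.ridgeAreaSq h p.1 p.2 t) : AnalyticAt ℝ (K.ridgePoly h β) p :=
  K.analyticAt_deWittPoly (fun t => analyticAt_rpow_const (K.analyticAt_ridgeAreaSq h t p) (hp t) _)
    fun t => (Real.rpow_pos_of_pos (hp t) _).ne'

lemma sqrt_rpow {x : ℝ} (hx : 0 ≤ x) (β : ℝ) : √x ^ (2 * β / 3) = x ^ (β / 3) := by
  rw [Real.sqrt_eq_rpow, ← Real.rpow_mul hx]
  congr 1
  ring

/-- For large κ = 1/τ the squared areas are κ times a small perturbation of those of `X`. By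
homogeneity the polynomial is then a nonzero multiple of a value close to the one at `X`. -/
lemma exists_ridgePoly_ne_zero {h : Vert → ℝ} {β : ℝ} {X : Link → ℝ}
    (hX' : ∀ t, 0 < K.areaSq X t)
    (hP : K.deWittPoly (fun t => K.areaSq X t ^ (β / 3)) ≠ 0) :
    ∃ κ : ℝ, 0 ≤ κ ∧ K.ridgePoly h β (X, κ) ≠ 0 := by
  set Q : ℝ → ℝ := fun τ => K.deWittPoly fun t =>
    (K.areaSq X t + τ * (K.gram X t (K.heightDiff h t) / 4)) ^ (β / 3) with hQ
  have hc : ContinuousAt Q 0 := by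
    refine (K.analyticAt_deWittPoly (fun t => analyticAt_rpow_const ?_ ?_ _) fun t => ?_).continuousAt
    · fun_prop
    · simpa using hX' t
    · simpa using (Real.rpow_pos_of_pos (hX' t) _).ne'
  have h0 : Q 0 ≠ 0 := by simpa [hQ] using hP
  have hpos : ∀ᶠ τ : ℝ in 𝓝 0, ∀ t,
      0 < K.areaSq X t + τ * (K.gram X t (K.heightDiff h t) / 4) := by
    refine eventually_all.2 fun t => ?_
    have : Continuous fun τ : ℝ => K.areaSq X t + τ * (K.gram X t (K.heightDiff h t) / 4) := by
      fun_prop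
    exact this.continuousAt.eventually_const_lt (by simpa using hX' t)
  have hev := (hc.eventually_ne h0).and hpos
  obtain ⟨τ, ⟨hτ1, hτ2⟩, hτ⟩ := ((hev.filter_mono nhdsWithin_le_nhds).and
    (self_mem_nhdsWithin (s := Set.Ioi (0 : ℝ)))).exists
  have hτ0 : 0 < τ := hτ
  refine ⟨τ⁻¹, by positivity, ?_⟩
  have he : ∀ t, K.ridgeAreaSq h X τ⁻¹ t ^ (β / 3) =
      τ⁻¹ ^ (β / 3) * (K.areaSq X t + τ * (K.gram X t (K.heightDiff h t) / 4)) ^ (β / 3) :=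
    fun t => by
      rw [← Real.mul_rpow (by positivity) (hτ2 t).le]
      congr 1
      unfold ridgeAreaSq
      field_simp
      ring
  simp only [ridgePoly, he]
  rw [K.deWittPoly_smul (by positivity)]
  exact mul_ne_zero (by positivity) hτ1

/-- An analytic function that is not identically zero vanishes to finite order m at κ = 0, which
gives the bound at s = X. Local Lipschitz continuity carries it to those s whose distance from X is
a small multiple of κᵐ. -/
lemma exists_le_ridgePoly {h : Vert → ℝ} (hh : ∀ x y, x ≠ y → 1 ≤ |h x - h y|) {β : ℝ}
    {X : Link → ℝ} (hX : ∀ e, 0 < X e) (hX' : ∀ t, 0 < K.areaSq X t)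
    (hP : K.deWittPoly (fun t => K.areaSq X t ^ (β / 3)) ≠ 0) :
    ∃ m : ℕ, ∃ c > 0, ∃ κ₀ > 0, ∀ κ, 0 < κ → κ ≤ κ₀ → ∀ s : Link → ℝ,
      (∀ e, |s e - X e| ≤ c * κ ^ m) → c * κ ^ m ≤ |K.ridgePoly h β (s, κ)| := by
  have hpos := fun t (κ : ℝ) (hκ : 0 ≤ κ) => K.ridgeAreaSq_pos hh hX (hX' t) hκ
  have hga : AnalyticOnNhd ℝ (fun κ => K.ridgePoly h β (X, κ)) (Set.Ici 0) := fun κ hκ =>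
    (K.analyticAt_ridgePoly h β (p := (X, κ)) fun t => hpos t κ hκ).comp_of_eq
      (analyticAt_const.prod analyticAt_id) rfl
  -- Identity theorem on the connected half line [0, ∞): a zero germ at 0 would propagate to the κ
  -- where the polynomial is known not to vanish.
  have hne : ¬ ∀ᶠ κ in 𝓝 (0 : ℝ), K.ridgePoly h β (X, κ) = 0 := fun h0 => by
    obtain ⟨κ, hκ, hκ'⟩ := K.exists_ridgePoly_ne_zero (h := h) hX' hP
    exact hκ' (hga.eqOn_zero_of_preconnected_of_eventuallyEq_zero isPreconnected_Ici
      (Set.mem_Ici.2 le_rfl) h0 hκ)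
  obtain ⟨m, g, hg, hg0, hfg⟩ := ((hga 0 (Set.mem_Ici.2 le_rfl)).exists_eventuallyEq_pow_smul_nonzero_iff).2 hne
  have hg1 : ∀ᶠ κ in 𝓝 (0 : ℝ), |g 0| / 2 < |g κ| :=
    hg.continuousAt.abs.eventually_const_lt (half_lt_self (abs_pos.2 hg0))
  obtain ⟨C, S, hS, hLip⟩ := ((K.analyticAt_ridgePoly h β (p := (X, 0)) fun t =>
    hpos t 0 le_rfl).contDiffAt (n := 1)).exists_lipschitzOnWith
  obtain ⟨δ, hδ, hball⟩ := Metric.mem_nhds_iff.1 hS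
  obtain ⟨δ', hδ', hball'⟩ := Metric.eventually_nhds_iff_ball.1 (hfg.and hg1)
  have hc0 : 0 < |g 0| / 2 := half_pos (abs_pos.2 hg0)
  -- Of the lower bound |g 0|/2 at X, the Lipschitz error may consume one half; the other half must
  -- still exceed `c`.
  obtain ⟨c, hc, hcδ, hcg, hcC⟩ : ∃ c > 0, c ≤ δ / 2 ∧ c ≤ |g 0| / 4 ∧ C * c ≤ |g 0| / 4 := by
    refine ⟨min (δ / 2) (|g 0| / 4 / (C + 1)), by positivity, min_le_left _ _,
      (min_le_right _ _).trans (div_le_self (by positivity) (by simp)), ?_⟩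
    calc (C : ℝ) * min (δ / 2) (|g 0| / 4 / (C + 1)) ≤ (C + 1) * (|g 0| / 4 / (C + 1)) := by
          gcongr
          · linarith
          · exact min_le_right _ _
      _ = |g 0| / 4 := by field_simp
  refine ⟨m, c, hc, min (min (δ / 2) (δ' / 2)) 1, by positivity, fun κ hκ hκle s hs => ?_⟩
  have hκδ : κ ≤ δ / 2 := hκle.trans ((min_le_left _ _).trans (min_le_left _ _))
  have hκδ' : κ ≤ δ' / 2 := hκle.trans ((min_le_left _ _).trans (min_le_right _ _))
  have hκ1 : κ ≤ 1 := hκle.trans (min_le_right _ _)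
  have hκm : κ ^ m ≤ 1 := pow_le_one₀ hκ.le hκ1
  obtain ⟨h1, h2⟩ := hball' κ (by
    rw [Metric.mem_ball, Real.dist_eq, sub_zero, abs_of_pos hκ]; linarith)
  rw [sub_zero, smul_eq_mul] at h1
  have h3 : |g 0| / 2 * κ ^ m ≤ |K.ridgePoly h β (X, κ)| := by
    rw [h1, abs_mul, abs_of_pos (by positivity : 0 < κ ^ m), mul_comm]
    gcongr
  have hsX : dist s X ≤ c * κ ^ m := (dist_pi_le_iff (by positivity)).2 fun e => hs e
  have hmem : ∀ s' : Link → ℝ, dist s' X ≤ δ / 2 → (s', κ) ∈ S := fun s' hs' => by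
    apply hball
    rw [Metric.mem_ball, Prod.dist_eq]
    refine lt_of_le_of_lt (max_le hs' ?_) (half_lt_self hδ)
    rw [Real.dist_eq, sub_zero, abs_of_pos hκ]
    exact hκδ
  have h4 := hLip.dist_le_mul (s, κ) (hmem s (hsX.trans (by nlinarith))) (X, κ)
    (hmem X (by rw [dist_self]; positivity))
  rw [Prod.dist_eq, dist_self, max_eq_left dist_nonneg, Real.dist_eq] at h4
  have h5 := abs_sub_abs_le_abs_sub (K.ridgePoly h β (X, κ)) (K.ridgePoly h β (s, κ))
  rw [abs_sub_comm] at h5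
  have h6 : (C : ℝ) * dist s X ≤ |g 0| / 4 * κ ^ m := by
    calc (C : ℝ) * dist s X ≤ C * (c * κ ^ m) := by gcongr
      _ = C * c * κ ^ m := by ring
      _ ≤ _ := by gcongr
  have h7 : c * κ ^ m ≤ |g 0| / 4 * κ ^ m := by gcongr
  linarith

/-! ### The DeWitt-like measures on stretched surfaces -/

lemma exists_deWittPoly_ne_zero {β : ℝ} (h : K.deWittMeasure β ≠ 0) :
    ∃ l ∈ K.admissible, K.deWittPoly (fun t => K.area l t ^ (2 * β / 3)) ≠ 0 := by
  by_contra! h0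
  refine h ?_
  rw [deWittMeasure, measureOfDensity, withDensity_congr_ae (g := 0), withDensity_zero]
  filter_upwards [ae_restrict_mem K.measurableSet_admissible] with l hl
  simp [h0 l hl]

theorem deWittMeasure_diverges {β : ℝ} (hβ : K.deWittMeasure β ≠ 0) :
    ∃ n₀ : ℝ, ∀ n : ℝ, n₀ ≤ n → ∀ V : ℝ, 0 < V →
    (∀ e : Link, K.Diverges (K.deWittMeasure β) V (linkPower e n)) ∧
    K.Diverges (K.deWittMeasure β) V (K.radiusPower n) := by
  obtain ⟨h, hh⟩ := K.exists_height
  obtain ⟨l₀, hl₀, hP⟩ := K.exists_deWittPoly_ne_zero hβ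
  set X : Link → ℝ := fun e => l₀ e ^ 2 with hXdef
  have hX : ∀ e, 0 < X e := fun e => pow_pos (hl₀.1 e) 2
  have hX' : ∀ t, 0 < K.areaSq X t := ((K.mem_admissible_iff l₀).1 hl₀).2
  have hP' : K.deWittPoly (fun t => K.areaSq X t ^ (β / 3)) ≠ 0 := by
    have e : ∀ t, K.area l₀ t ^ (2 * β / 3) = K.areaSq X t ^ (β / 3) := fun t => by
      rw [area_eq, ← sqrt_rpow (hX' t).le β]
    simpa only [e] using hP
  obtain ⟨r, hr, c, hc, k₀, hk₀, hbd⟩ := K.exists_le_prod_area_ridge hh hX hX' β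
  obtain ⟨m, c', hc', κ₀, hκ₀, hpoly⟩ := K.exists_le_ridgePoly hh hX hX' hP'
  obtain ⟨p, hJ⟩ := K.deWittDensity_smul β
  have hC : 0 < min (min r c') (√c' * c) := by positivity
  -- The order of vanishing is counted in κ = k⁻⁴.
  refine K.diverges_of_ridge hJ hh hX hX' (m := 4 * m) hC (by positivity)
    (k₀ := max k₀ κ₀⁻¹) fun k hk s hs => ?_
  have hk' := (le_max_left _ _).trans hk
  have hk1 : 1 ≤ k := hk₀.trans hk'
  have hk0 : 0 < k := by linarith
  have hκ : k ^ (-(4 * m : ℝ)) = (k⁻¹ ^ 4) ^ m := by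
    rw [Real.rpow_neg hk0.le, ← pow_mul, inv_pow]
    exact_mod_cast rfl
  rw [hκ] at hs ⊢
  have hκ1 : k⁻¹ ^ 4 ≤ 1 := pow_le_one₀ (by positivity) (inv_le_one_of_one_le₀ hk1)
  have hκle : k⁻¹ ^ 4 ≤ κ₀ := by
    refine (pow_le_of_le_one (by positivity) (inv_le_one_of_one_le₀ hk1) (by norm_num)).trans ?_
    rw [inv_le_comm₀ hk0 hκ₀]
    exact (le_max_right _ _).trans hk
  have hκpos : 0 < k⁻¹ ^ 4 := by positivity
  set κ := k⁻¹ ^ 4 with hκdef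
  have hκm1 : κ ^ m ≤ 1 := pow_le_one₀ hκpos.le hκ1
  have hκm : 0 < κ ^ m := pow_pos hκpos m
  have hmin1 : min (min r c') (√c' * c) ≤ r := (min_le_left _ _).trans (min_le_left _ _)
  have hmin2 : min (min r c') (√c' * c) ≤ c' := (min_le_left _ _).trans (min_le_right _ _)
  have hmin3 : min (min r c') (√c' * c) ≤ √c' * c := min_le_right _ _
  obtain ⟨hs0, hs0', hA⟩ := hbd k hk' s fun e => (hs e).trans (by nlinarith)
  have hpol := hpoly κ hκpos hκle s fun e => (hs e).trans (by gcongr)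
  have hq : ∀ t, 0 ≤ K.ridgeAreaSq h s κ t := fun t =>
    (K.ridgeAreaSq_pos hh hs0 (hs0' t) hκpos.le).le
  have harea : (K.deWittPoly fun t => K.area (K.ridge h k s) t ^ (2 * β / 3)) =
      K.ridgePoly h β (s, κ) := by
    simp only [K.area_ridge hh hk1 hs0, ridgePoly, ← hκdef, fun t => sqrt_rpow (hq t) β]
  have hlen : 1 ≤ ∏ e, K.ridge h k s e :=
    Finset.one_le_prod fun e _ => hk1.trans (K.le_ridge hh hk1 hs0 e)
  rw [harea]
  calc min (min r c') (√c' * c) * κ ^ m ≤ √c' * c * κ ^ m := by gcongr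
    _ ≤ √c' * c * √(κ ^ m) := by
        gcongr
        exact Real.le_sqrt_of_sq_le (by nlinarith)
    _ = √(c' * κ ^ m) * c * 1 := by rw [Real.sqrt_mul hc'.le]; ring
    _ ≤ _ := mul_le_mul (mul_le_mul (Real.sqrt_le_sqrt hpol) hA hc.le (Real.sqrt_nonneg _)) hlen
        zero_le_one (mul_nonneg (Real.sqrt_nonneg _) (hc.le.trans hA))

end ClosedTriangulation

namespace ClosedTriangulation

/-! ### Volumes of slabs -/

section Slab

open scoped Pointwise

variable {ι : Type*} [Fintype ι]

/-- Cut B into layers of thickness δ with respect to φ. Half differences from a fixed point of a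
layer stay in B and in the slab, so each layer lies in a translate of the doubled slab set; there
are at most 3R/δ layers. Nothing is asked about independence of φ from earlier cuts, so the bound
can be iterated. -/
lemma volume_le_mul_volume_slab {B : Set (ι → ℝ)}
    (hB : ∀ x ∈ B, ∀ y ∈ B, (1 / 2 : ℝ) • (x - y) ∈ B) (φ : (ι → ℝ) →ₗ[ℝ] ℝ) {R δ : ℝ}
    (hδ : 0 < δ) (hδR : δ ≤ R) (hR : ∀ x ∈ B, |φ x| ≤ R) :
    volume B ≤ ENNReal.ofReal (2 ^ Fintype.card ι * (3 * R / δ)) *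
      volume (B ∩ {x | |φ x| ≤ δ}) := by
  set C := B ∩ {x | |φ x| ≤ δ} with hC
  set M := ⌊2 * R / δ⌋₊ + 1 with hM
  have hpiece : ∀ j : ℕ, volume (B ∩ {x | ⌊(φ x + R) / δ⌋₊ = j}) ≤
      ENNReal.ofReal (2 ^ Fintype.card ι) * volume C := by
    intro j
    rcases Set.eq_empty_or_nonempty (B ∩ {x | ⌊(φ x + R) / δ⌋₊ = j}) with h | ⟨z, hz, hzj⟩
    · rw [h, measure_empty]
      exact zero_le
    · have hfl : ∀ x ∈ B, ⌊(φ x + R) / δ⌋₊ = j →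
          j * δ ≤ φ x + R ∧ φ x + R < (j + 1) * δ := by
        intro x hx hxj
        have h0 : 0 ≤ (φ x + R) / δ := div_nonneg (by linarith [(abs_le.1 (hR x hx)).1]) hδ.le
        rw [Nat.floor_eq_iff h0] at hxj
        exact ⟨(le_div_iff₀ hδ).1 hxj.1, (div_lt_iff₀ hδ).1 hxj.2⟩
      have hsub : B ∩ {x | ⌊(φ x + R) / δ⌋₊ = j} ⊆ (fun y => -z + y) ⁻¹' ((2 : ℝ) • C) := by
        rintro x ⟨hx, hxj⟩
        refine Set.mem_smul_set.2 ⟨(1 / 2 : ℝ) • (x - z), ⟨hB x hx z hz, ?_⟩, ?_⟩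
        · show |φ _| ≤ δ
          rw [map_smul, map_sub, smul_eq_mul, abs_le]
          have h1 := hfl x hx hxj
          have h2 := hfl z hz hzj
          constructor <;> nlinarith
        · rw [smul_smul]
          norm_num
          abel
      refine (measure_mono hsub).trans ?_
      rw [measure_preimage_add, Measure.addHaar_smul, Module.finrank_fintype_fun_eq_card,
        abs_of_pos (by positivity)]
  have hcover : B ⊆ ⋃ j ∈ Finset.range M, B ∩ {x | ⌊(φ x + R) / δ⌋₊ = j} := by
    intro x hx
    simp only [Set.mem_iUnion, Finset.mem_range]
    refine ⟨⌊(φ x + R) / δ⌋₊, Nat.lt_succ_of_le (Nat.floor_le_floor ?_), hx, rfl⟩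
    gcongr
    linarith [(abs_le.1 (hR x hx)).2]
  have hMle : (M : ℝ) ≤ 3 * R / δ := by
    rw [hM]
    push_cast
    have h1 : (⌊2 * R / δ⌋₊ : ℝ) ≤ 2 * R / δ :=
      Nat.floor_le (div_nonneg (by linarith) hδ.le)
    have h2 : 1 ≤ R / δ := (one_le_div hδ).2 hδR
    calc (⌊2 * R / δ⌋₊ : ℝ) + 1 ≤ 2 * R / δ + R / δ := add_le_add h1 h2
      _ = 3 * R / δ := by ring
  calc volume B ≤ ∑ j ∈ Finset.range M, volume (B ∩ {x | ⌊(φ x + R) / δ⌋₊ = j}) :=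
        (measure_mono hcover).trans (measure_biUnion_finset_le _ _)
    _ ≤ ∑ j ∈ Finset.range M, ENNReal.ofReal (2 ^ Fintype.card ι) * volume C :=
        Finset.sum_le_sum fun j _ => hpiece j
    _ = ENNReal.ofReal (2 ^ Fintype.card ι * M) * volume C := by
        rw [Finset.sum_const, Finset.card_range, nsmul_eq_mul,
          ENNReal.ofReal_mul (by positivity), ENNReal.ofReal_natCast]
        ring
    _ ≤ _ := by gcongr

lemma half_sub_mem_slabs {κ : Type*} {B : Set (ι → ℝ)}
    (hB : ∀ x ∈ B, ∀ y ∈ B, (1 / 2 : ℝ) • (x - y) ∈ B) (φ : κ → (ι → ℝ) →ₗ[ℝ] ℝ) (δ : κ → ℝ)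
    (s : Set κ) : ∀ x ∈ B ∩ {x | ∀ j ∈ s, |φ j x| ≤ δ j}, ∀ y ∈ B ∩ {x | ∀ j ∈ s, |φ j x| ≤ δ j},
      (1 / 2 : ℝ) • (x - y) ∈ B ∩ {x | ∀ j ∈ s, |φ j x| ≤ δ j} := by
  rintro x ⟨hx, hx'⟩ y ⟨hy, hy'⟩
  refine ⟨hB x hx y hy, fun j hj => ?_⟩
  have h1 := abs_le.1 (hx' j hj)
  have h2 := abs_le.1 (hy' j hj)
  rw [map_smul, map_sub, smul_eq_mul, abs_le]
  constructor <;> linarith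

/-- Cutting a convex symmetric set down by slabs reduces its volume at most in proportion to the
widths of the slabs. -/
lemma volume_le_mul_volume_slabs {κ : Type*} {B : Set (ι → ℝ)}
    (hB : ∀ x ∈ B, ∀ y ∈ B, (1 / 2 : ℝ) • (x - y) ∈ B) (φ : κ → (ι → ℝ) →ₗ[ℝ] ℝ) {R δ : κ → ℝ}
    (s : Finset κ) (hδ : ∀ j ∈ s, 0 < δ j) (hδR : ∀ j ∈ s, δ j ≤ R j)
    (hR : ∀ j ∈ s, ∀ x ∈ B, |φ j x| ≤ R j) :
    volume B ≤ ENNReal.ofReal (∏ j ∈ s, 2 ^ Fintype.card ι * (3 * R j / δ j)) *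
      volume (B ∩ {x | ∀ j ∈ s, |φ j x| ≤ δ j}) := by
  classical
  induction s using Finset.induction_on with
  | empty => simp
  | insert a s ha ih =>
    have h1 := ih (fun j hj => hδ j (Finset.mem_insert_of_mem hj))
      (fun j hj => hδR j (Finset.mem_insert_of_mem hj))
      (fun j hj => hR j (Finset.mem_insert_of_mem hj))
    have h2 := volume_le_mul_volume_slab (half_sub_mem_slabs hB φ δ (s : Set κ)) (φ a)
      (hδ a (Finset.mem_insert_self _ _)) (hδR a (Finset.mem_insert_self _ _))
      fun x hx => hR a (Finset.mem_insert_self _ _) x hx.1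
    have hset : B ∩ {x | ∀ j ∈ (s : Set κ), |φ j x| ≤ δ j} ∩ {x | |φ a x| ≤ δ a} =
        B ∩ {x | ∀ j ∈ insert a s, |φ j x| ≤ δ j} := by
      ext x
      simp only [Set.mem_inter_iff, Set.mem_ofPred_eq, Finset.mem_coe, Finset.forall_mem_insert]
      tauto
    rw [hset] at h2
    have hpos : 0 ≤ 2 ^ Fintype.card ι * (3 * R a / δ a) := by
      have := hδ a (Finset.mem_insert_self _ _)
      have := this.le.trans (hδR a (Finset.mem_insert_self _ _))
      positivity
    rw [Finset.prod_insert ha, mul_comm (2 ^ Fintype.card ι * (3 * R a / δ a)),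
      ENNReal.ofReal_mul' hpos, mul_assoc]
    exact h1.trans (mul_le_mul_right h2 _)

end Slab

end ClosedTriangulation

namespace ClosedTriangulation

variable {Vert Link Tri : Type*} (K : ClosedTriangulation Vert Link Tri)

/-! ### Counting links and triangles -/

/-- Different links may share both end points, but two sides of one triangle cannot, because its
corners are distinct. -/
lemma side_injective (t : Tri) : Function.Injective (K.side t) := by
  have key : ∀ k, K.side t k ≠ K.side t (k + 1) := by
    intro k h
    have h1 := congrArg K.ends h
    rw [K.ends_side, K.ends_side] at h1
    have h2 : K.vert t (k + 2) ∈ s(K.vert t (k + 1), K.vert t (k + 2)) := by simp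
    have h3 : K.vert t (k + 1) ∈ s(K.vert t (k + 1), K.vert t (k + 2)) := by simp
    rw [h1, Sym2.mem_iff] at h3
    rcases h3 with h3 | h3 <;> have := K.vert_injective t h3 <;> fin_cases k <;> simp at this
  intro i j h
  by_contra hij
  have h3 : ∀ i j : Fin 3, i ≠ j → j = i + 1 ∨ i = j + 1 := by decide
  rcases h3 i j hij with rfl | rfl
  · exact key _ h
  · exact key _ h.symm

lemma mem_ends_side (v : Vert) (t : Tri) (k : Fin 3) :
    v ∈ K.ends (K.side t k) ↔ K.vert t (k + 1) = v ∨ K.vert t (k + 2) = v := by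
  rw [K.ends_side, Sym2.mem_iff, eq_comm, @eq_comm _ v]

lemma fin_three_cases (k j : Fin 3) : j = k ∨ j = k + 1 ∨ j = k + 2 := by
  revert k j; decide

lemma mem_ends_of_ne {v : Vert} {t : Tri} {j k : Fin 3} (h : K.vert t j = v) (hjk : j ≠ k) :
    v ∈ K.ends (K.side t k) := by
  rw [mem_ends_side]
  rcases fin_three_cases k j with rfl | rfl | rfl
  · exact absurd rfl hjk
  · exact Or.inl h
  · exact Or.inr h

lemma notMem_ends_opposite {v : Vert} {t : Tri} {j : Fin 3} (h : K.vert t j = v) :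
    v ∉ K.ends (K.side t j) := by
  rw [mem_ends_side, ← h]
  rintro (h | h)
  · exact add_one_ne j (K.vert_injective t h)
  · exact add_two_ne j (K.vert_injective t h)

lemma notMem_ends_of_outer {v : Vert} {t : Tri} (h : v ∉ Set.range (K.vert t)) (k : Fin 3) :
    v ∉ K.ends (K.side t k) := by
  rw [mem_ends_side]
  rintro (h' | h') <;> exact h ⟨_, h'⟩

variable [Fintype Link] [Fintype Tri]

open Classical in
lemma card_triangles (e : Link) :
    (Finset.univ.filter fun t => ∃ k, K.side t k = e).card = 2 := by
  rw [← K.two_triangles e, Set.ncard_eq_toFinset_card']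
  congr 1
  ext t
  simp

open Classical in
lemma sum_sides (f : Link → ℝ) : ∑ t, ∑ k, f (K.side t k) = 2 * ∑ e, f e := by
  have h1 : ∀ t, ∑ k, f (K.side t k) = ∑ e, if ∃ k, K.side t k = e then f e else 0 := by
    intro t
    rw [← Finset.sum_filter, ← Finset.sum_image (f := f) (s := Finset.univ) (g := K.side t)
      fun i _ j _ h => K.side_injective t h]
    refine Finset.sum_congr ?_ fun _ _ => rfl
    ext e
    simp
  simp only [h1]
  rw [Finset.sum_comm, Finset.mul_sum]
  refine Finset.sum_congr rfl fun e _ => ?_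
  rw [← Finset.sum_filter, Finset.sum_const, K.card_triangles, nsmul_eq_mul]
  norm_num

-- Double counting of incidences between triangles and links at `v`: every link lies in two
-- triangles, and every corner at `v` has two sides ending there.
open Classical in
lemma sum_corners_eq_order (v : Vert) :
    ∑ t, ∑ k, (if K.vert t k = v then (1 : ℝ) else 0) = K.order v := by
  have h1 := K.sum_sides fun e => if v ∈ K.ends e then (1 : ℝ) else 0
  have h2 : ∀ t, ∑ k, (if v ∈ K.ends (K.side t k) then (1 : ℝ) else 0) =
      2 * ∑ k, (if K.vert t k = v then (1 : ℝ) else 0) := by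
    intro t
    have h3 : ∀ k, (if v ∈ K.ends (K.side t k) then (1 : ℝ) else 0) =
        (if K.vert t (k + 1) = v then (1 : ℝ) else 0) +
          (if K.vert t (k + 2) = v then (1 : ℝ) else 0) := by
      intro k
      by_cases ha : K.vert t (k + 1) = v
      · have hb : K.vert t (k + 2) ≠ v := fun hb => K.vert_ne t k (ha.trans hb.symm)
        simp [mem_ends_side, ha, hb]
      · simp [mem_ends_side, ha]
    simp only [h3, Finset.sum_add_distrib]
    rw [two_mul]
    congr 1
    · exact Equiv.sum_comp (Equiv.addRight (1 : Fin 3)) fun k => if K.vert t k = v then (1 : ℝ) else 0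
    · exact Equiv.sum_comp (Equiv.addRight (2 : Fin 3)) fun k => if K.vert t k = v then (1 : ℝ) else 0
  simp only [h2, ← Finset.mul_sum] at h1
  rw [mul_right_inj' two_ne_zero] at h1
  rw [h1, order, Set.ncard_eq_toFinset_card', Finset.sum_boole]
  congr 2
  ext e
  simp

open Classical in
/-- The number of sides of a triangle which belong to `S`. -/
noncomputable def sideCount (S : Finset Link) (t : Tri) : ℕ :=
  (Finset.univ.filter fun k => K.side t k ∈ S).card

lemma sideCount_le (S : Finset Link) (t : Tri) : K.sideCount S t ≤ 3 :=
  (Finset.card_le_univ _).trans (by simp)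

open Classical in
lemma sideCount_eq_sum (S : Finset Link) (t : Tri) :
    (K.sideCount S t : ℝ) = ∑ k, if K.side t k ∈ S then (1 : ℝ) else 0 := by
  rw [Finset.sum_boole]
  rfl

open Classical in
lemma sum_sideCount (S : Finset Link) : ∑ t, (K.sideCount S t : ℝ) = 2 * S.card := by
  simp only [sideCount_eq_sum]
  rw [K.sum_sides fun e => if e ∈ S then (1 : ℝ) else 0]
  simp

open Classical in
lemma sideCount_insert {S : Finset Link} {z : Link} (hz : z ∉ S) (t : Tri) :
    K.sideCount (insert z S) t = K.sideCount S t + if ∃ k, K.side t k = z then 1 else 0 := by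
  unfold sideCount
  have h1 : (Finset.univ.filter fun k => K.side t k ∈ insert z S) =
      (Finset.univ.filter fun k => K.side t k = z) ∪ Finset.univ.filter fun k => K.side t k ∈ S := by
    ext k; simp
  have hd : Disjoint (Finset.univ.filter fun k => K.side t k = z)
      (Finset.univ.filter fun k => K.side t k ∈ S) := by
    rw [Finset.disjoint_filter]
    rintro k - rfl
    exact hz
  rw [h1, Finset.card_union_of_disjoint hd, add_comm]
  congr 1
  split_ifs with h
  · obtain ⟨k, rfl⟩ := h
    rw [Finset.card_eq_one]
    refine ⟨k, ?_⟩
    ext j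
    simp [(K.side_injective t).eq_iff]
  · push Not at h
    simp [h]

/-! ### Suppression exponents and closing up the short links -/

/-- The weight of a triangle with `j` short sides. -/
noncomputable def closureWeight (β g : ℝ) (j : ℕ) : ℝ := if j = 3 then -2 * β else g * j

open Classical in
/-- The exponent with which a configuration is suppressed when the links `S` are short. -/
noncomputable def suppression (v : Vert) (α β g : ℝ) (S : Finset Link) : ℝ :=
  (1 - α) * S.card + ∑ t with v ∉ Set.range (K.vert t), closureWeight β g (K.sideCount S t)

/-- The links opposite to `v` in a triangle. -/
def IsOpposite (v : Vert) (e : Link) : Prop := ∃ t k, K.vert t k = v ∧ K.side t k = e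

-- Two short sides force the third to be short. Among the sets of short links that contain S₀,
-- respect the constraints and are no more suppressed than S₀, one of largest cardinality has no
-- outer triangle with exactly two short sides: adding the third side would not raise the
-- suppression.
open Classical in
lemma exists_closed {v : Vert} {mono : Link → Prop}
    (hmono : ∀ t i j k, i ≠ j → mono (K.side t i) → mono (K.side t j) → mono (K.side t k))
    {S₀ : Finset Link} (hS₀ : ∀ e, e ∈ S₀ ↔ K.IsOpposite v e ∧ mono e) {α β g : ℝ}
    (h₁ : 1 - α - 2 * β - g ≤ 0) (h₂ : 1 - α - 4 * β - 4 * g ≤ 0) :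
    ∃ S, S₀ ⊆ S ∧ (∀ e ∈ S, v ∉ K.ends e ∧ mono e) ∧
      (∀ t, v ∉ Set.range (K.vert t) → K.sideCount S t ≠ 2) ∧
      K.suppression v α β g S ≤ K.suppression v α β g S₀ := by
  set C : Finset (Finset Link) := Finset.univ.filter fun S => S₀ ⊆ S ∧
    (∀ e ∈ S, v ∉ K.ends e ∧ mono e) ∧ K.suppression v α β g S ≤ K.suppression v α β g S₀ with hC
  have hne : C.Nonempty := by
    refine ⟨S₀, Finset.mem_filter.2 ⟨Finset.mem_univ _, subset_rfl, fun e he => ?_, le_rfl⟩⟩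
    obtain ⟨⟨t, k, hv, rfl⟩, hm⟩ := (hS₀ e).1 he
    exact ⟨K.notMem_ends_opposite hv, hm⟩
  obtain ⟨S, hSC, hmax⟩ := Finset.exists_max_image C Finset.card hne
  obtain ⟨-, hS1, hS2, hS3⟩ := Finset.mem_filter.1 hSC
  refine ⟨S, hS1, hS2, fun t ht hcount => ?_, hS3⟩
  obtain ⟨i, j, hij, hcountS⟩ := Finset.card_eq_two.1 hcount
  have hi : K.side t i ∈ S := by
    have : i ∈ Finset.univ.filter fun k => K.side t k ∈ S := by rw [hcountS]; simp
    exact (Finset.mem_filter.1 this).2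
  have hj : K.side t j ∈ S := by
    have : j ∈ Finset.univ.filter fun k => K.side t k ∈ S := by rw [hcountS]; simp
    exact (Finset.mem_filter.1 this).2
  obtain ⟨k, hki, hkj⟩ : ∃ k, k ≠ i ∧ k ≠ j := by
    clear hcountS hi hj; revert i j; decide
  have hz : K.side t k ∉ S := fun h => by
    have : k ∈ Finset.univ.filter fun k => K.side t k ∈ S :=
      Finset.mem_filter.2 ⟨Finset.mem_univ _, h⟩
    rw [hcountS] at this
    simp [hki, hkj] at this
  set z := K.side t k with hzdef
  have hzmono : mono z := hmono t i j k hij (hS2 _ hi).2 (hS2 _ hj).2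
  have hzv : v ∉ K.ends z := K.notMem_ends_of_outer ht k
  obtain ⟨a, b, hab, hT⟩ := Finset.card_eq_two.1 (K.card_triangles z)
  obtain ⟨t', htt', hpair⟩ : ∃ t', t' ≠ t ∧
      (Finset.univ.filter fun t => ∃ k, K.side t k = z) = {t, t'} := by
    have : t ∈ Finset.univ.filter fun t => ∃ k, K.side t k = z := by
      simp only [Finset.mem_filter, Finset.mem_univ, true_and]
      exact ⟨k, rfl⟩
    rw [hT, Finset.mem_insert, Finset.mem_singleton] at this
    rcases this with rfl | rfl
    · exact ⟨b, hab.symm, hT⟩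
    · exact ⟨a, hab, by rw [hT, Finset.pair_comm]⟩
  have hiff : ∀ τ, (∃ k, K.side τ k = z) ↔ τ = t ∨ τ = t' := fun τ => by
    have : τ ∈ (Finset.univ.filter fun t => ∃ k, K.side t k = z) ↔ τ ∈ ({t, t'} : Finset Tri) := by
      rw [hpair]
    simpa using this
  obtain ⟨k', hk'⟩ := (hiff t').2 (Or.inr rfl)
  -- If the other triangle at z had a corner at v, z would either end in v, or be opposite to v and,
  -- being `mono`, already lie in S₀.
  have ht' : v ∉ Set.range (K.vert t') := by
    rintro ⟨m, hm⟩
    by_cases hmk : m = k'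
    · exact hz (hS1 ((hS₀ z).2 ⟨⟨t', k', hmk ▸ hm, hk'⟩, hzmono⟩))
    · exact hzv (hk' ▸ K.mem_ends_of_ne hm hmk)
  have hcount' : K.sideCount S t' ≤ 2 := by
    have h3 := K.sideCount_le (insert z S) t'
    rw [K.sideCount_insert hz, if_pos ⟨k', hk'⟩] at h3
    omega
  have hdiff : K.suppression v α β g (insert z S) - K.suppression v α β g S =
      (1 - α) + ((closureWeight β g 3 - closureWeight β g 2) +
        (closureWeight β g (K.sideCount S t' + 1) - closureWeight β g (K.sideCount S t'))) := by
    have h5 : ∑ τ with v ∉ Set.range (K.vert τ),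
        (closureWeight β g (K.sideCount (insert z S) τ) - closureWeight β g (K.sideCount S τ)) =
        ∑ τ ∈ {t, t'},
        (closureWeight β g (K.sideCount (insert z S) τ) - closureWeight β g (K.sideCount S τ)) := by
      symm
      refine Finset.sum_subset ?_ fun τ _ hτ => ?_
      · intro τ hτ
        simp only [Finset.mem_insert, Finset.mem_singleton] at hτ
        rcases hτ with rfl | rfl
        · exact Finset.mem_filter.2 ⟨Finset.mem_univ _, ht⟩
        · exact Finset.mem_filter.2 ⟨Finset.mem_univ _, ht'⟩
      · rw [K.sideCount_insert hz, if_neg, add_zero, sub_self]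
        rw [hiff]
        simpa using hτ
    rw [Finset.sum_pair htt'.symm, K.sideCount_insert hz, K.sideCount_insert hz,
      if_pos ⟨k, rfl⟩, if_pos ⟨k', hk'⟩, hcount, Finset.sum_sub_distrib] at h5
    have h6 : ((insert z S).card : ℝ) = S.card + 1 := by
      rw [Finset.card_insert_of_notMem hz]; push_cast; ring
    unfold suppression
    rw [h6]
    linarith
  have hle : K.suppression v α β g (insert z S) ≤ K.suppression v α β g S := by
    rw [← sub_nonpos, hdiff]
    -- If t' has at most one short side, it gains one and its weight rises by g, so `h₁` applies. If
    -- it has two, both triangles close at once, so `h₂` applies.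
    have : K.sideCount S t' = 0 ∨ K.sideCount S t' = 1 ∨ K.sideCount S t' = 2 := by omega
    rcases this with h | h | h <;> rw [h] <;> norm_num [closureWeight] <;> linarith
  have hins : insert z S ∈ C := Finset.mem_filter.2 ⟨Finset.mem_univ _,
    hS1.trans (Finset.subset_insert _ _), fun e he => by
      rcases Finset.mem_insert.1 he with rfl | he
      · exact ⟨hzv, hzmono⟩
      · exact hS2 e he, hle.trans hS3⟩
  have := hmax _ hins
  rw [Finset.card_insert_of_notMem hz] at this
  omega

-- Short sides are counted by triangles. The total is 2|S₀|; a triangle at `v` contributes only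
-- through the side opposite `v`. So the outer triangles carry 2|S₀| minus the number of spike
-- corners over S₀, and |S₀| is at most that number.
open Classical in
lemma suppression_opposite_le {v : Vert} {S₀ : Finset Link} (hS₀ : ∀ e ∈ S₀, K.IsOpposite v e)
    {α β g : ℝ} (h₁ : 0 ≤ 1 - α + 2 * g) (h₂ : -2 * β ≤ 3 * g) :
    K.suppression v α β g S₀ ≤
      (1 - α + g) * ∑ t, ∑ k, if K.vert t k = v ∧ K.side t k ∈ S₀ then (1 : ℝ) else 0 := by
  set Ns := ∑ t, ∑ k, if K.vert t k = v ∧ K.side t k ∈ S₀ then (1 : ℝ) else 0 with hNs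
  have hsplit := K.sum_sideCount S₀
  rw [← Finset.sum_filter_add_sum_filter_not Finset.univ fun t => v ∈ Set.range (K.vert t)] at hsplit
  have hspike : ∑ t with v ∈ Set.range (K.vert t), (K.sideCount S₀ t : ℝ) = Ns := by
    rw [hNs, Finset.sum_filter]
    refine Finset.sum_congr rfl fun t _ => ?_
    split_ifs with ht
    · rw [sideCount_eq_sum]
      refine Finset.sum_congr rfl fun k _ => ?_
      obtain ⟨j, hj⟩ := ht
      by_cases hk : K.side t k ∈ S₀
      · have : K.vert t k = v := by
          by_contra hne
          obtain ⟨t', k', hv, he⟩ := hS₀ _ hk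
          refine K.notMem_ends_opposite hv ?_
          rw [he]
          exact K.mem_ends_of_ne hj fun h => hne (h ▸ hj)
        simp [hk, this]
      · simp [hk]
    · symm
      refine Finset.sum_eq_zero fun k _ => if_neg fun h => ht ⟨k, h.1⟩
  have hcard : (S₀.card : ℝ) ≤ Ns := by
    rw [hNs, ← Finset.sum_product', Finset.sum_boole]
    norm_cast
    refine Finset.card_le_card_of_surjOn (fun p : Tri × Fin 3 => K.side p.1 p.2) fun e he => ?_
    obtain ⟨t, k, hv, rfl⟩ := hS₀ e he
    exact ⟨(t, k), by simpa [hv] using he, rfl⟩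
  have hweight : ∑ t with v ∉ Set.range (K.vert t), closureWeight β g (K.sideCount S₀ t) ≤
      g * ∑ t with v ∉ Set.range (K.vert t), (K.sideCount S₀ t : ℝ) := by
    rw [Finset.mul_sum]
    refine Finset.sum_le_sum fun t _ => ?_
    unfold closureWeight
    split_ifs with h
    · rw [h]; push_cast; linarith
    · exact le_rfl
  rw [hspike, ← eq_sub_iff_add_eq'] at hsplit
  rw [hsplit] at hweight
  unfold suppression
  linarith [mul_le_mul_of_nonneg_left hcard h₁]

/-- Two-colourings which cut at least half of the links around a vertex. -/
lemma exists_cut (v : Vert) : ∃ c : Vert → Bool,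
    (open Classical in
    ∑ t, ∑ k, (if K.vert t k = v ∧ c (K.vert t (k + 1)) = c (K.vert t (k + 2))
      then (1 : ℝ) else 0) ≤
    ∑ t, ∑ k, if K.vert t k = v ∧ c (K.vert t (k + 1)) ≠ c (K.vert t (k + 2))
      then (1 : ℝ) else 0) := by
  classical
  have := K.finite_vert
  have := Fintype.ofFinite Vert
  have hsum : ∑ c : Vert → Bool, ∑ t, ∑ k,
      (if K.vert t k = v ∧ c (K.vert t (k + 1)) = c (K.vert t (k + 2)) then (1 : ℝ) else 0) ≤
      ∑ c : Vert → Bool, ∑ t, ∑ k,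
      if K.vert t k = v ∧ c (K.vert t (k + 1)) ≠ c (K.vert t (k + 2)) then (1 : ℝ) else 0 := by
    have hswap : ∀ f : (Vert → Bool) → Tri → Fin 3 → ℝ,
        ∑ c, ∑ t, ∑ k, f c t k = ∑ t, ∑ k, ∑ c, f c t k := fun f => by
      rw [Finset.sum_comm]
      exact Finset.sum_congr rfl fun t _ => Finset.sum_comm
    rw [hswap, hswap]
    refine Finset.sum_le_sum fun t _ => ?_
    refine Finset.sum_le_sum fun k _ => le_of_eq ?_
    have hne := K.vert_ne t k
    set a := K.vert t (k + 1)
    set b := K.vert t (k + 2)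
    -- Averaging over all colourings: changing the colour of one end point exchanges the colourings
    -- that cut this side with those that do not.
    have hinv : Function.Involutive fun c : Vert → Bool => Function.update c a (!c a) := by
      intro c; simp
    refine Fintype.sum_equiv hinv.toPerm _ _ fun c => ?_
    simp only [Function.Involutive.coe_toPerm, Function.update_self, ne_eq,
      Function.update_of_ne hne.symm]
    congr 2
    cases c a <;> cases c b <;> simp
  obtain ⟨c, -, hc⟩ := Finset.exists_le_of_sum_le Finset.univ_nonempty hsum
  exact ⟨c, hc⟩

end ClosedTriangulation

namespace ClosedTriangulation

variable {Vert Link Tri : Type*} (K : ClosedTriangulation Vert Link Tri)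

/-! ### Areas of long and of small triangles -/

/-- In the factorization `heron_sq` the factor (x + x')² - y² is of order m² for a long triangle and
the other one is of order q², so the area is of order mq. -/
lemma heron_bounds_long {m q x x' y : ℝ} (hx : m / 2 ≤ x) (hx2 : x ≤ 2 * m)
    (hx' : m / 2 ≤ x') (hx2' : x' ≤ 2 * m) (hy : 0 < y) (hy2 : y ≤ m / 2)
    (hlow : q ^ 2 / 2 ≤ y ^ 2 - (x - x') ^ 2) (hup : y ^ 2 - (x - x') ^ 2 ≤ 2 * q ^ 2) :
    (m * q / 10) ^ 2 ≤ heron (y ^ 2) (x ^ 2) (x' ^ 2) ∧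
      heron (y ^ 2) (x ^ 2) (x' ^ 2) ≤ (2 * (m * q)) ^ 2 := by
  rw [heron_sq]
  have h1 : 3 / 4 * m ^ 2 ≤ (x + x') ^ 2 - y ^ 2 := by nlinarith
  have h2 : (x + x') ^ 2 - y ^ 2 ≤ 16 * m ^ 2 := by nlinarith
  have hq : 0 ≤ q ^ 2 := sq_nonneg q
  have hm : 0 ≤ m ^ 2 := sq_nonneg m
  have h3 := mul_le_mul hlow h1 (by positivity) ((by positivity : 0 ≤ q ^ 2 / 2).trans hlow)
  have h4 := mul_le_mul hup h2 ((by positivity : 0 ≤ 3 / 4 * m ^ 2).trans h1) (by positivity)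
  have h5 : 0 ≤ m ^ 2 * q ^ 2 := by positivity
  constructor <;> nlinarith

lemma heron_bounds_small {d x x' y : ℝ} (hd : 0 < d) (hx : 9 / 10 * d ≤ x) (hx2 : x ≤ 11 / 10 * d)
    (hx' : 9 / 10 * d ≤ x') (hx2' : x' ≤ 11 / 10 * d) (hy : 9 / 10 * d ≤ y)
    (hy2 : y ≤ 11 / 10 * d) :
    (d ^ 2 / 10) ^ 2 ≤ heron (y ^ 2) (x ^ 2) (x' ^ 2) ∧
      heron (y ^ 2) (x ^ 2) (x' ^ 2) ≤ (2 * d ^ 2) ^ 2 := by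
  rw [heron_sq]
  have hxx : (x - x') ^ 2 ≤ (d / 5) ^ 2 := sq_le_sq' (by linarith) (by linarith)
  have hyl : (9 / 10 * d) ^ 2 ≤ y ^ 2 := by gcongr
  have hyu : y ^ 2 ≤ (11 / 10 * d) ^ 2 := by gcongr; linarith
  have hsl : (9 / 5 * d) ^ 2 ≤ (x + x') ^ 2 := by gcongr; linarith
  have hsu : (x + x') ^ 2 ≤ (11 / 5 * d) ^ 2 := by gcongr <;> linarith
  have h1 : 1 / 2 * d ^ 2 ≤ y ^ 2 - (x - x') ^ 2 := by nlinarith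
  have h2 : y ^ 2 - (x - x') ^ 2 ≤ 2 * d ^ 2 := by nlinarith [sq_nonneg (x - x')]
  have h3 : d ^ 2 ≤ (x + x') ^ 2 - y ^ 2 := by nlinarith
  have h4 : (x + x') ^ 2 - y ^ 2 ≤ 5 * d ^ 2 := by nlinarith [sq_nonneg y]
  have h5 := mul_le_mul h1 h3 (by positivity) ((by positivity : 0 ≤ 1 / 2 * d ^ 2).trans h1)
  have h6 := mul_le_mul h2 h4 ((by positivity : 0 ≤ d ^ 2).trans h3) (by positivity)
  have h7 : 0 < d ^ 2 * d ^ 2 := by positivity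
  constructor <;> nlinarith

/-- With σ² = 1 the difference of squares factors, and the small factor is u²/2 - σδ. The excess
u²/2 built into the base thus survives every perturbation with small defect δ. -/
lemma folded_bounds {u σ δ y : ℝ} (hσ : σ ^ 2 = 1) (hu : u ^ 2 ≤ 1 / 100)
    (hy : 99 / 100 ≤ y) (hy2 : y ≤ 102 / 100) (hδ : |δ| ≤ u ^ 2 / 50) :
    u ^ 2 / 2 ≤ y ^ 2 - (σ + (δ + σ * (y - 1 - u ^ 2 / 2))) ^ 2 ∧
      y ^ 2 - (σ + (δ + σ * (y - 1 - u ^ 2 / 2))) ^ 2 ≤ 2 * u ^ 2 := by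
  have hσδ : |σ * δ| ≤ u ^ 2 / 50 := by
    rw [abs_mul, (pow_eq_one_iff_of_nonneg (abs_nonneg σ) two_ne_zero).1 ((sq_abs σ).trans hσ), one_mul]
    exact hδ
  have hfac : y ^ 2 - (σ + (δ + σ * (y - 1 - u ^ 2 / 2))) ^ 2 =
      (u ^ 2 / 2 - σ * δ) * (2 * y - u ^ 2 / 2 + σ * δ) := by
    linear_combination (-(y - u ^ 2 / 2) ^ 2 + δ ^ 2) * hσ
  rw [hfac]
  obtain ⟨h1, h2⟩ := abs_le.1 hσδ
  have hu0 : 0 ≤ u ^ 2 := sq_nonneg u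
  have hP1 : 48 / 100 * u ^ 2 ≤ u ^ 2 / 2 - σ * δ := by linarith
  have hP1' : u ^ 2 / 2 - σ * δ ≤ 52 / 100 * u ^ 2 := by linarith
  have hP2 : 19 / 10 ≤ 2 * y - u ^ 2 / 2 + σ * δ := by linarith
  have hP2' : 2 * y - u ^ 2 / 2 + σ * δ ≤ 21 / 10 := by linarith
  have h3 := mul_le_mul hP1 hP2 (by norm_num) (by linarith)
  have h4 := mul_le_mul hP1' hP2' (by linarith) (by positivity)
  constructor <;> linarith

/-! ### The region of spikes -/

variable [Fintype Link] [Fintype Tri]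

/-- Combinatorial data of a spike at `v`: the links in `S` are short, and the links that end in `v`
are long with lengths that differ by the offsets `o`. -/
structure IsSpikeShape (v : Vert) (S : Finset Link) (o : Link → ℝ) : Prop where
  notMem_ends : ∀ e ∈ S, v ∉ K.ends e
  offset_eq_zero : ∀ e, v ∉ K.ends e → o e = 0
  offset_mem : ∀ e, 0 ≤ o e ∧ o e ≤ 1
  spike : ∀ t j, K.vert t j = v →
    (K.side t j ∈ S ∧ o (K.side t (j + 1)) = o (K.side t (j + 2))) ∨
    (K.side t j ∉ S ∧ (o (K.side t (j + 1)) - o (K.side t (j + 2))) ^ 2 = 1)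
  outer : ∀ t, v ∉ Set.range (K.vert t) → K.sideCount S t ≠ 2

open Classical in
/-- The exponent of the length of a link. -/
noncomputable def lenExp (v : Vert) (S : Finset Link) (e : Link) : ℝ :=
  if v ∈ K.ends e then 1 else if e ∈ S then -1 else 0

open Classical in
/-- The exponent of the area of a triangle. -/
noncomputable def areaExp (v : Vert) (S : Finset Link) (t : Tri) : ℝ :=
  if v ∈ Set.range (K.vert t) then 0
  else if K.sideCount S t = 0 then 0 else if K.sideCount S t = 1 then -1 else -2

open Classical in
/-- The exponent of the tolerance for the difference of the other two sides of a triangle with a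
given side. -/
noncomputable def tolExp (S : Finset Link) (a : Tri × Fin 3) : ℝ :=
  if K.side a.1 a.2 ∈ S then -1 else -2

open Classical in
/-- The central link lengths of the region of spikes of height `k`. -/
noncomputable def spikeBase (v : Vert) (S : Finset Link) (o : Link → ℝ) (k : ℝ) (e : Link) : ℝ :=
  if v ∈ K.ends e then k + o e else if e ∈ S then k⁻¹ else 1 + (k⁻¹) ^ 2 / 2

/-- The coordinate `e` as a linear functional. -/
def coord (e : Link) : (Link → ℝ) →ₗ[ℝ] ℝ := LinearMap.proj e

/-- The difference of two coordinates as a linear functional. -/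
def coordDiff (e e₀ : Link) : (Link → ℝ) →ₗ[ℝ] ℝ := coord e - coord e₀

lemma coordDiff_apply (e e₀ : Link) (z : Link → ℝ) : coordDiff e e₀ z = z e - z e₀ := rfl

/-- The first order change of the excess length of two sides of a triangle over the third. -/
def defect (o : Link → ℝ) (a : Tri × Fin 3) : (Link → ℝ) →ₗ[ℝ] ℝ :=
  coordDiff (K.side a.1 (a.2 + 1)) (K.side a.1 (a.2 + 2)) -
    (o (K.side a.1 (a.2 + 1)) - o (K.side a.1 (a.2 + 2))) • coord (K.side a.1 a.2)

lemma defect_apply (o : Link → ℝ) (a : Tri × Fin 3) (z : Link → ℝ) :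
    K.defect o a z = z (K.side a.1 (a.2 + 1)) - z (K.side a.1 (a.2 + 2)) -
      (o (K.side a.1 (a.2 + 1)) - o (K.side a.1 (a.2 + 2))) * z (K.side a.1 a.2) := rfl

/-- The sides of thin triangles which are their bases. -/
def IsBase (v : Vert) (S : Finset Link) (a : Tri × Fin 3) : Prop :=
  K.vert a.1 a.2 = v ∨
    (v ∉ Set.range (K.vert a.1) ∧ K.sideCount S a.1 = 1 ∧ K.side a.1 a.2 ∈ S)

lemma sideCount_eq_zero {S : Finset Link} {t : Tri} (h : K.sideCount S t = 0) (k : Fin 3) :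
    K.side t k ∉ S := by
  classical
  intro hk
  have := Finset.card_eq_zero.1 h
  rw [Finset.filter_eq_empty_iff] at this
  exact this (Finset.mem_univ k) hk

lemma sideCount_eq_three {S : Finset Link} {t : Tri} (h : K.sideCount S t = 3) (k : Fin 3) :
    K.side t k ∈ S := by
  classical
  have h1 := Finset.eq_univ_of_card _ (h.trans (Fintype.card_fin 3).symm)
  exact Finset.filter_eq_self.1 h1 k (Finset.mem_univ k)

lemma sideCount_eq_one {S : Finset Link} {t : Tri} (h : K.sideCount S t = 1) :
    ∃ j, ∀ k, K.side t k ∈ S ↔ k = j := by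
  classical
  obtain ⟨j, hj⟩ := Finset.card_eq_one.1 h
  refine ⟨j, fun k => ?_⟩
  rw [← Finset.mem_singleton, ← hj, Finset.mem_filter]
  simp

section

variable {v : Vert} {S : Finset Link} {o : Link → ℝ} (hS : K.IsSpikeShape v S o) {k : ℝ}
  (hk : 100 ≤ k) {z : Link → ℝ} (hz : ∀ e, |z e| ≤ k ^ K.lenExp v S e / 100)

include hS hk hz

lemma spike_length_star {e : Link} (he : v ∈ K.ends e) :
    k / 2 ≤ (K.spikeBase v S o k + z) e ∧ (K.spikeBase v S o k + z) e ≤ 2 * k := by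
  have h1 := hz e
  rw [lenExp, if_pos he, Real.rpow_one, abs_le] at h1
  rw [Pi.add_apply, spikeBase, if_pos he]
  have := hS.offset_mem e
  constructor <;> linarith

lemma spike_length_short {e : Link} (he : e ∈ S) :
    99 / 100 * k⁻¹ ≤ (K.spikeBase v S o k + z) e ∧
      (K.spikeBase v S o k + z) e ≤ 101 / 100 * k⁻¹ := by
  have h1 := hz e
  rw [lenExp, if_neg (hS.notMem_ends e he), if_pos he, Real.rpow_neg_one, abs_le] at h1
  rw [Pi.add_apply, spikeBase, if_neg (hS.notMem_ends e he), if_pos he]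
  constructor <;> linarith

lemma spike_length_other {e : Link} (he : v ∉ K.ends e) (he' : e ∉ S) :
    99 / 100 ≤ (K.spikeBase v S o k + z) e ∧ (K.spikeBase v S o k + z) e ≤ 102 / 100 := by
  have h1 := hz e
  have h2 : 0 < k⁻¹ := inv_pos.2 (by linarith)
  have h3 : k⁻¹ ≤ 1 / 100 := by
    rw [inv_le_comm₀ (by linarith) (by norm_num)]; linarith
  rw [lenExp, if_neg he, if_neg he', Real.rpow_zero, abs_le] at h1
  rw [Pi.add_apply, spikeBase, if_neg he, if_neg he']
  constructor <;> nlinarith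

lemma spike_length (e : Link) :
    k ^ K.lenExp v S e / 2 ≤ (K.spikeBase v S o k + z) e ∧
      (K.spikeBase v S o k + z) e ≤ 2 * k ^ K.lenExp v S e := by
  have h2 : 0 < k⁻¹ := inv_pos.2 (by linarith)
  by_cases he : v ∈ K.ends e
  · rw [lenExp, if_pos he, Real.rpow_one]
    exact K.spike_length_star hS hk hz he
  by_cases he' : e ∈ S
  · rw [lenExp, if_neg he, if_pos he', Real.rpow_neg_one]
    have := K.spike_length_short hS hk hz he'
    constructor <;> linarith
  · rw [lenExp, if_neg he, if_neg he', Real.rpow_zero]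
    have := K.spike_length_other hS hk hz he he'
    constructor <;> linarith

variable (hd : ∀ a, K.IsBase v S a → |K.defect o a z| ≤ k ^ K.tolExp S a / 50)

include hd

lemma spike_areaSq_star {t : Tri} (ht : v ∈ Set.range (K.vert t)) :
    (k ^ K.areaExp v S t / 10) ^ 2 ≤ K.areaSq (fun e => (K.spikeBase v S o k + z) e ^ 2) t ∧
      K.areaSq (fun e => (K.spikeBase v S o k + z) e ^ 2) t ≤ (2 * k ^ K.areaExp v S t) ^ 2 := by
  have hk0 : 0 < k := by linarith
  have hu : 0 < k⁻¹ := inv_pos.2 hk0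
  have hu1 : k⁻¹ ≤ 1 / 100 := by
    rw [inv_le_comm₀ hk0 (by norm_num)]; linarith
  have hku : k * k⁻¹ = 1 := mul_inv_cancel₀ hk0.ne'
  rw [areaExp, if_pos ht, Real.rpow_zero, ← hku]
  obtain ⟨j, hj⟩ := ht
  rw [K.areaSq_eq _ t j]
  have hs1 : v ∈ K.ends (K.side t (j + 1)) := K.mem_ends_of_ne hj (add_one_ne j).symm
  have hs2 : v ∈ K.ends (K.side t (j + 2)) := K.mem_ends_of_ne hj (add_two_ne j).symm
  have hs0 := K.notMem_ends_opposite hj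
  have hx := K.spike_length_star hS hk hz hs1
  have hx' := K.spike_length_star hS hk hz hs2
  have hdef := hd (t, j) (Or.inl hj)
  rw [defect_apply] at hdef
  have hdiff : (K.spikeBase v S o k + z) (K.side t (j + 1)) -
      (K.spikeBase v S o k + z) (K.side t (j + 2)) =
      (o (K.side t (j + 1)) - o (K.side t (j + 2))) +
        (z (K.side t (j + 1)) - z (K.side t (j + 2))) := by
    simp only [Pi.add_apply, spikeBase, if_pos hs1, if_pos hs2]
    ring
  rcases hS.spike t j hj with ⟨hy, ho⟩ | ⟨hy, ho⟩
  · have hyb := K.spike_length_short hS hk hz hy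
    rw [tolExp, if_pos hy, Real.rpow_neg_one, ho, sub_self, zero_mul, sub_zero] at hdef
    rw [ho, sub_self, zero_add] at hdiff
    rw [← hdiff] at hdef
    have hsq := sq_le_sq' (abs_le.1 hdef).1 (abs_le.1 hdef).2
    refine heron_bounds_long hx.1 hx.2 hx'.1 hx'.2 ?_ ?_ ?_ ?_
    · linarith
    · linarith
    · nlinarith
    · nlinarith [sq_nonneg ((K.spikeBase v S o k + z) (K.side t (j + 1)) -
        (K.spikeBase v S o k + z) (K.side t (j + 2)))]
  · have hyb := K.spike_length_other hS hk hz hs0 hy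
    have hyz : (K.spikeBase v S o k + z) (K.side t j) = 1 + k⁻¹ ^ 2 / 2 + z (K.side t j) := by
      simp only [Pi.add_apply, spikeBase, if_neg hs0, if_neg hy]
    have htol : k ^ K.tolExp S (t, j) = k⁻¹ ^ 2 := by
      rw [tolExp, if_neg hy, Real.rpow_neg hk0.le, inv_pow]
      exact_mod_cast rfl
    rw [htol] at hdef
    have := folded_bounds (u := k⁻¹) (y := (K.spikeBase v S o k + z) (K.side t j)) ho
      (by nlinarith) hyb.1 hyb.2 hdef
    -- The argument of `folded_bounds` is the actual difference of the two long sides; the change of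
    -- the base cancels because the defect compensates for it.
    rw [show o (K.side t (j + 1)) - o (K.side t (j + 2)) + (z (K.side t (j + 1)) -
      z (K.side t (j + 2)) - (o (K.side t (j + 1)) - o (K.side t (j + 2))) * z (K.side t j) +
      (o (K.side t (j + 1)) - o (K.side t (j + 2))) *
      ((K.spikeBase v S o k + z) (K.side t j) - 1 - k⁻¹ ^ 2 / 2)) =
      o (K.side t (j + 1)) - o (K.side t (j + 2)) + (z (K.side t (j + 1)) - z (K.side t (j + 2)))
      by rw [hyz]; ring, ← hdiff] at this
    exact heron_bounds_long hx.1 hx.2 hx'.1 hx'.2 (by linarith) (by linarith) this.1 this.2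

lemma spike_areaSq_outer {t : Tri} (ht : v ∉ Set.range (K.vert t)) :
    (k ^ K.areaExp v S t / 10) ^ 2 ≤ K.areaSq (fun e => (K.spikeBase v S o k + z) e ^ 2) t ∧
      K.areaSq (fun e => (K.spikeBase v S o k + z) e ^ 2) t ≤ (2 * k ^ K.areaExp v S t) ^ 2 := by
  have hk0 : 0 < k := by linarith
  have hu : 0 < k⁻¹ := inv_pos.2 hk0
  have hu1 : k⁻¹ ≤ 1 / 100 := by
    rw [inv_le_comm₀ hk0 (by norm_num)]; linarith
  have hku : k * k⁻¹ = 1 := mul_inv_cancel₀ hk0.ne'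
  have hn := K.notMem_ends_of_outer ht
  have hc := K.sideCount_le S t
  have hc2 := hS.outer t ht
  obtain hc | hc | hc : K.sideCount S t = 0 ∨ K.sideCount S t = 1 ∨ K.sideCount S t = 3 := by
    omega
  · rw [areaExp, if_neg ht, if_pos hc, Real.rpow_zero]
    have hl := fun j => K.spike_length_other hS hk hz (hn j) (K.sideCount_eq_zero hc j)
    have := heron_bounds_small one_pos (x := (K.spikeBase v S o k + z) (K.side t 1))
      (x' := (K.spikeBase v S o k + z) (K.side t 2)) (y := (K.spikeBase v S o k + z) (K.side t 0))
      (by linarith [(hl 1).1]) (by linarith [(hl 1).2]) (by linarith [(hl 2).1])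
      (by linarith [(hl 2).2]) (by linarith [(hl 0).1]) (by linarith [(hl 0).2])
    rw [one_pow] at this
    exact this
  · have he : k ^ K.areaExp v S t = 1 * k⁻¹ := by
      rw [areaExp, if_neg ht, if_neg (by omega), if_pos hc, Real.rpow_neg_one, one_mul]
    rw [he]
    obtain ⟨j, hj⟩ := K.sideCount_eq_one hc
    have hy : K.side t j ∈ S := (hj j).2 rfl
    have hs1 : K.side t (j + 1) ∉ S := fun h => add_one_ne j ((hj _).1 h)
    have hs2 : K.side t (j + 2) ∉ S := fun h => add_two_ne j ((hj _).1 h)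
    rw [K.areaSq_eq _ t j]
    have hx := K.spike_length_other hS hk hz (hn _) hs1
    have hx' := K.spike_length_other hS hk hz (hn _) hs2
    have hyb := K.spike_length_short hS hk hz hy
    have hdef := hd (t, j) (Or.inr ⟨ht, hc, hy⟩)
    rw [defect_apply, tolExp, if_pos hy, Real.rpow_neg_one, hS.offset_eq_zero _ (hn _),
      hS.offset_eq_zero _ (hn _), sub_self, zero_mul, sub_zero] at hdef
    have hdiff : (K.spikeBase v S o k + z) (K.side t (j + 1)) -
        (K.spikeBase v S o k + z) (K.side t (j + 2)) =
        z (K.side t (j + 1)) - z (K.side t (j + 2)) := by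
      simp only [Pi.add_apply, spikeBase, if_neg (hn _), if_neg hs1, if_neg hs2]
      ring
    simp only at hdef
    rw [← hdiff] at hdef
    have hsq := sq_le_sq' (abs_le.1 hdef).1 (abs_le.1 hdef).2
    refine heron_bounds_long (by linarith) (by linarith) (by linarith) (by linarith) ?_ ?_ ?_ ?_
    · linarith
    · linarith
    · nlinarith
    · nlinarith [sq_nonneg ((K.spikeBase v S o k + z) (K.side t (j + 1)) -
        (K.spikeBase v S o k + z) (K.side t (j + 2)))]
  · have he : k ^ K.areaExp v S t = k⁻¹ ^ 2 := by
      rw [areaExp, if_neg ht, if_neg (by omega), if_neg (by omega), Real.rpow_neg hk0.le, inv_pow]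
      exact_mod_cast rfl
    rw [he]
    have hl := fun j => K.spike_length_short hS hk hz (K.sideCount_eq_three hc j)
    exact heron_bounds_small hu (by linarith [(hl 1).1]) (by linarith [(hl 1).2])
      (by linarith [(hl 2).1]) (by linarith [(hl 2).2]) (by linarith [(hl 0).1])
      (by linarith [(hl 0).2])

lemma spike_areaSq (t : Tri) :
    (k ^ K.areaExp v S t / 10) ^ 2 ≤ K.areaSq (fun e => (K.spikeBase v S o k + z) e ^ 2) t ∧
      K.areaSq (fun e => (K.spikeBase v S o k + z) e ^ 2) t ≤ (2 * k ^ K.areaExp v S t) ^ 2 := by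
  by_cases ht : v ∈ Set.range (K.vert t)
  · exact K.spike_areaSq_star hS hk hz hd ht
  · exact K.spike_areaSq_outer hS hk hz hd ht

lemma spike_area (t : Tri) :
    k ^ K.areaExp v S t / 10 ≤ K.area (K.spikeBase v S o k + z) t ∧
      K.area (K.spikeBase v S o k + z) t ≤ 2 * k ^ K.areaExp v S t := by
  have hk0 : 0 < k := by linarith
  have h := K.spike_areaSq hS hk hz hd t
  rw [area_eq]
  exact ⟨Real.le_sqrt_of_sq_le h.1, Real.sqrt_le_iff.2 ⟨by positivity, h.2⟩⟩

lemma spike_mem_admissible : K.spikeBase v S o k + z ∈ K.admissible := by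
  have hk0 : 0 < k := by linarith
  refine (K.mem_admissible_iff _).2 ⟨fun e => lt_of_lt_of_le ?_ (K.spike_length hS hk hz e).1,
    fun t => lt_of_lt_of_le ?_ (K.spike_areaSq hS hk hz hd t).1⟩ <;> positivity

lemma spike_totalArea :
    K.totalArea (K.spikeBase v S o k + z) ∈ Set.Icc (1 / 10 : ℝ) (Fintype.card Tri * 2) := by
  have hk1 : 1 ≤ k := by linarith
  constructor
  · obtain ⟨t, j, ht⟩ := K.exists_vert v
    refine le_trans ?_ (Finset.single_le_sum (fun t _ => K.area_nonneg _ t) (Finset.mem_univ t))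
    have := (K.spike_area hS hk hz hd t).1
    rwa [areaExp, if_pos ⟨j, ht⟩, Real.rpow_zero] at this
  · have : ∀ t, K.area (K.spikeBase v S o k + z) t ≤ 2 := fun t => by
      refine (K.spike_area hS hk hz hd t).2.trans ?_
      have : k ^ K.areaExp v S t ≤ 1 := by
        apply Real.rpow_le_one_of_one_le_of_nonpos hk1
        unfold areaExp
        split_ifs <;> norm_num
      linarith
    refine (Finset.sum_le_card_nsmul _ _ _ fun t _ => this t).trans ?_
    rw [nsmul_eq_mul, Finset.card_univ]

end

/-! ### The volume of the region of spikes -/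

open Classical in
/-- Small perturbations of the central link lengths of the region of spikes. -/
noncomputable def spikeBox (v : Vert) (S : Finset Link) (o : Link → ℝ) (e₀ : Link)
    (A : Finset (Tri × Fin 3)) (k w : ℝ) : Set (Link → ℝ) :=
  {z | ∀ e, |z e| ≤ k ^ K.lenExp v S e / 100} ∩
    {z | ∀ e ∈ (Finset.univ.filter fun e => v ∈ K.ends e).erase e₀,
      |coordDiff e e₀ z| ≤ k ^ w / 100} ∩
    {z | ∀ a ∈ A, |K.defect o a z| ≤ k ^ K.tolExp S a / 100}

lemma measurableSet_spikeBox (v : Vert) (S : Finset Link) (o : Link → ℝ) (e₀ : Link)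
    (A : Finset (Tri × Fin 3)) (k w : ℝ) : MeasurableSet (K.spikeBox v S o e₀ A k w) := by
  have hφ : ∀ (φ : (Link → ℝ) →ₗ[ℝ] ℝ) (c : ℝ), IsClosed {z | |φ z| ≤ c} := fun φ c =>
    isClosed_le (φ.continuous_of_finiteDimensional.abs) continuous_const
  refine IsClosed.measurableSet (IsClosed.inter (IsClosed.inter ?_ ?_) ?_)
  · simp only [Set.ofPred_forall]
    exact isClosed_iInter fun e => hφ (coord e) _
  · simp only [Set.ofPred_forall]
    exact isClosed_iInter fun e => isClosed_iInter fun _ => hφ _ _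
  · simp only [Set.ofPred_forall]
    exact isClosed_iInter fun e => isClosed_iInter fun _ => hφ _ _

lemma ofReal_div_le_of_le_mul {x y : ℝ} (hy : 0 < y) {V : ℝ≥0∞}
    (h : ENNReal.ofReal x ≤ ENNReal.ofReal y * V) : ENNReal.ofReal (x / y) ≤ V := by
  rw [ENNReal.ofReal_div_of_pos hy]
  exact ENNReal.div_le_of_le_mul' h

-- The full box has volume of order k to the sum of `lenExp`. Restricting each difference of a link
-- at `v` with `e₀` from size k to size kʷ costs k to the power w - 1. As w ≤ 0, every defect is
-- then of order 1, and restricting it costs k to the power `tolExp`.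
open Classical in
lemma exists_le_volume_spikeBox {v : Vert} {S : Finset Link} {o : Link → ℝ}
    (hS : K.IsSpikeShape v S o) (e₀ : Link) {A : Finset (Tri × Fin 3)}
    (hA : ∀ a ∈ A, K.IsBase v S a) {w : ℝ} (hw : w ≤ 0) :
    ∃ c > 0, ∀ k : ℝ, 1 ≤ k →
      ENNReal.ofReal (c * k ^ (∑ e, K.lenExp v S e +
        (((Finset.univ.filter fun e => v ∈ K.ends e).erase e₀).card * (w - 1) +
          ∑ a ∈ A, K.tolExp S a))) ≤ volume (K.spikeBox v S o e₀ A k w) := by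
  set E := (Finset.univ.filter fun e => v ∈ K.ends e).erase e₀ with hE
  set Λ := Fintype.card Link with hΛ
  refine ⟨(1 / 50) ^ Λ / ((2 ^ Λ * 6) ^ E.card * (2 ^ Λ * 9) ^ A.card), by positivity,
    fun k hk => ?_⟩
  have hk0 : 0 < k := by linarith
  have hkw : k ^ w ≤ 1 := Real.rpow_le_one_of_one_le_of_nonpos hk hw
  have hkw0 : 0 < k ^ w := Real.rpow_pos_of_pos hk0 w
  set B₀ : Set (Link → ℝ) := {z | ∀ e, |z e| ≤ k ^ K.lenExp v S e / 100} with hB₀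
  have hB₀sub : ∀ x ∈ B₀, ∀ y ∈ B₀, (1 / 2 : ℝ) • (x - y) ∈ B₀ := by
    intro x hx y hy e
    have h1 := abs_le.1 (hx e)
    have h2 := abs_le.1 (hy e)
    rw [Pi.smul_apply, Pi.sub_apply, smul_eq_mul, abs_le]
    constructor <;> linarith
  have hvol : volume B₀ = ENNReal.ofReal ((1 / 50) ^ Λ * k ^ ∑ e, K.lenExp v S e) := by
    have : B₀ = Set.Icc (fun e => -(k ^ K.lenExp v S e / 100)) fun e => k ^ K.lenExp v S e / 100 := by
      ext z
      simp only [hB₀, Set.mem_ofPred_eq, abs_le, Set.mem_Icc, Pi.le_def]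
      exact forall_and
    rw [this, Real.volume_Icc_pi, ← ENNReal.ofReal_prod_of_nonneg]
    · congr 1
      rw [Real.rpow_sum_of_pos hk0, hΛ, ← Finset.card_univ, ← Finset.prod_const,
        ← Finset.prod_mul_distrib]
      exact Finset.prod_congr rfl fun e _ => by ring
    · intro e _
      have : 0 < k ^ K.lenExp v S e := by positivity
      linarith
  have hlen : ∀ e, k ^ K.lenExp v S e ≤ k := fun e => by
    conv_rhs => rw [← Real.rpow_one k]
    apply Real.rpow_le_rpow_of_exponent_le hk
    unfold lenExp
    split_ifs <;> norm_num
  have hlen1 : ∀ e, v ∉ K.ends e → k ^ K.lenExp v S e ≤ 1 := fun e he => by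
    apply Real.rpow_le_one_of_one_le_of_nonpos hk
    rw [lenExp, if_neg he]
    split_ifs <;> norm_num
  have hstep1 := volume_le_mul_volume_slabs hB₀sub
    (fun e => coordDiff e e₀)
    (R := fun _ => k / 50) (δ := fun _ => k ^ w / 100) E (fun _ _ => by positivity)
    (fun _ _ => by linarith) fun e _ z hz => by
      rw [coordDiff_apply]
      have h1 := abs_sub (z e) (z e₀)
      linarith [hz e, hz e₀, hlen e, hlen e₀]
  set B₁ : Set (Link → ℝ) := B₀ ∩ {z | ∀ e ∈ E,
    |coordDiff e e₀ z| ≤ k ^ w / 100} with hB₁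
  have hB₁sub : ∀ x ∈ B₁, ∀ y ∈ B₁, (1 / 2 : ℝ) • (x - y) ∈ B₁ :=
    half_sub_mem_slabs hB₀sub _ (fun _ => k ^ w / 100) (E : Set Link)
  have htol : ∀ a, k ^ K.tolExp S a ≤ 1 := fun a => by
    apply Real.rpow_le_one_of_one_le_of_nonpos hk
    unfold tolExp
    split_ifs <;> norm_num
  have hstar : ∀ z ∈ B₁, ∀ e, v ∈ K.ends e → |z e - z e₀| ≤ 1 / 100 := by
    intro z hz e he
    by_cases hee : e = e₀
    · rw [hee, sub_self, abs_zero]; norm_num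
    · have := hz.2 e (Finset.mem_erase.2 ⟨hee, Finset.mem_filter.2 ⟨Finset.mem_univ _, he⟩⟩)
      rw [coordDiff_apply] at this
      linarith
  have hstep2 := volume_le_mul_volume_slabs hB₁sub (K.defect o) (R := fun _ => 3 / 100)
    (δ := fun a => k ^ K.tolExp S a / 100) A (fun a _ => by positivity)
    (fun a _ => by linarith [htol a]) fun a ha z hz => by
      rw [defect_apply]
      rcases hA a ha with hj | ⟨ht, hc, hy⟩
      · have h1 := abs_le.1 (hstar z hz _ (K.mem_ends_of_ne hj (add_one_ne a.2).symm))
        have h2 := abs_le.1 (hstar z hz _ (K.mem_ends_of_ne hj (add_two_ne a.2).symm))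
        have h3 := hlen1 _ (K.notMem_ends_opposite hj)
        have h4 : |z (K.side a.1 a.2)| ≤ 1 / 100 := by
          have := hz.1 (K.side a.1 a.2)
          linarith
        have h5 : |(o (K.side a.1 (a.2 + 1)) - o (K.side a.1 (a.2 + 2))) *
            z (K.side a.1 a.2)| ≤ 1 * (1 / 100) := by
          rw [abs_mul]
          refine mul_le_mul ?_ h4 (abs_nonneg _) zero_le_one
          have h6 := hS.offset_mem (K.side a.1 (a.2 + 1))
          have h7 := hS.offset_mem (K.side a.1 (a.2 + 2))
          rw [abs_le]
          constructor <;> linarith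
        have h6 := abs_le.1 h5
        rw [abs_le]
        constructor <;> linarith
      · have hn := K.notMem_ends_of_outer ht
        rw [hS.offset_eq_zero _ (hn _), hS.offset_eq_zero _ (hn _), sub_self, zero_mul, sub_zero]
        have h1 := abs_sub (z (K.side a.1 (a.2 + 1))) (z (K.side a.1 (a.2 + 2)))
        linarith [hz.1 (K.side a.1 (a.2 + 1)), hz.1 (K.side a.1 (a.2 + 2)),
          hlen1 _ (hn (a.2 + 1)), hlen1 _ (hn (a.2 + 2))]
  have hp1 : ∏ e ∈ E, 2 ^ Λ * (3 * (k / 50) / (k ^ w / 100)) =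
      (2 ^ Λ * 6) ^ E.card * k ^ (E.card * (1 - w)) := by
    rw [Finset.prod_const, mul_comm (E.card : ℝ), Real.rpow_mul hk0.le, Real.rpow_natCast,
      ← mul_pow, Real.rpow_sub hk0, Real.rpow_one]
    congr 1
    field_simp
    norm_num
  have hp2 : ∏ a ∈ A, 2 ^ Λ * (3 * (3 / 100) / (k ^ K.tolExp S a / 100)) =
      (2 ^ Λ * 9) ^ A.card * k ^ (-∑ a ∈ A, K.tolExp S a) := by
    rw [← Finset.sum_neg_distrib, Real.rpow_sum_of_pos hk0, ← Finset.prod_const,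
      ← Finset.prod_mul_distrib]
    refine Finset.prod_congr rfl fun a _ => ?_
    rw [Real.rpow_neg hk0.le]
    field_simp
    norm_num
  rw [hp1, hvol] at hstep1
  rw [hp2] at hstep2
  have hfin := hstep1.trans (mul_le_mul_right hstep2 _)
  rw [← mul_assoc, ← ENNReal.ofReal_mul (by positivity)] at hfin
  have := ofReal_div_le_of_le_mul (by positivity) hfin
  refine le_trans (le_of_eq ?_) this
  congr 1
  rw [Real.rpow_add hk0, Real.rpow_add hk0, Real.rpow_neg hk0.le,
    show (E.card : ℝ) * (1 - w) = -(E.card * (w - 1)) by ring, Real.rpow_neg hk0.le]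
  field_simp

end ClosedTriangulation

namespace ClosedTriangulation

variable {Vert Link Tri : Type*} (K : ClosedTriangulation Vert Link Tri)
variable [Fintype Link] [Fintype Tri]

/-! ### Divergence from the region of spikes -/

lemma rpow_scale_le {x y c d : ℝ} (hc : 0 < c) (hy : 0 < y) (hlow : c * y ≤ x) (hup : x ≤ d * y)
    (p : ℝ) : min (c ^ p) (d ^ p) * y ^ p ≤ x ^ p := by
  have h1 : x = x / y * y := by field_simp
  have hcx : c ≤ x / y := (le_div_iff₀ hy).2 hlow
  rw [h1, Real.mul_rpow (hc.le.trans hcx) hy.le]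
  gcongr
  exact min_rpow_le hc hcx ((div_le_iff₀ hy).2 hup) p

-- `hexp` adds the powers of k from the observable, the areas, the lengths and the volume of the
-- region. Some bases need no slab of their own: with w = -1 the links at `v` already agree up to
-- order k⁻¹, which settles triangles with a short side opposite `v`.
open Classical in
theorem diverges_of_spikeShape {v : Vert} {S : Finset Link} {o : Link → ℝ}
    (hS : K.IsSpikeShape v S o) {e₀ : Link} (he₀ : v ∈ K.ends e₀) {A : Finset (Tri × Fin 3)}
    (hA : ∀ a ∈ A, K.IsBase v S a) {w : ℝ} (hw : w ≤ 0)
    (hA' : ∀ a, K.IsBase v S a → a ∈ A ∨ (w = -1 ∧ K.vert a.1 a.2 = v ∧ K.side a.1 a.2 ∈ S))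
    {α β n : ℝ}
    (hexp : 0 ≤ n + ∑ t, -β * K.areaExp v S t + ∑ e, -α * K.lenExp v S e +
      (∑ e, K.lenExp v S e +
        (((Finset.univ.filter fun e => v ∈ K.ends e).erase e₀).card * (w - 1) +
          ∑ a ∈ A, K.tolExp S a))) {V : ℝ} (hV : 0 < V) :
    K.Diverges (K.localMeasure α β) V (linkPower e₀ n) := by
  refine K.diverges_of_homogeneous (K.localDensity_smul α β)
    (fun c hc l hl => K.linkPower_smul e₀ n hc hl) (a := 1 / 10) (b := Fintype.card Tri * 2)
    (by norm_num) ?_ hV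
  obtain ⟨c, hc, hvol⟩ := K.exists_le_volume_spikeBox hS e₀ hA hw
  set J : (Link → ℝ) → ℝ := fun l => (∏ t, K.area l t ^ (-β)) * ∏ e, l e ^ (-α) with hJ
  set f := linkPower e₀ n with hf
  set U : ℝ → Set (Link → ℝ) := fun k =>
    (fun l => -K.spikeBase v S o k + l) ⁻¹' K.spikeBox v S o e₀ A k w with hU
  have hUmeas : ∀ k, MeasurableSet (U k) := fun k =>
    (measurable_const_add _) (K.measurableSet_spikeBox v S o e₀ A k w)
  have hUz : ∀ k, 100 ≤ k → ∀ l ∈ U k, ∃ z, l = K.spikeBase v S o k + z ∧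
      (∀ e, |z e| ≤ k ^ K.lenExp v S e / 100) ∧
      ∀ a, K.IsBase v S a → |K.defect o a z| ≤ k ^ K.tolExp S a / 50 := by
    intro k hk l hl
    obtain ⟨⟨h1, h2⟩, h3⟩ := hl
    refine ⟨_, (add_neg_cancel_left (K.spikeBase v S o k) l).symm, h1, fun a ha => ?_⟩
    have hpos : 0 < k ^ K.tolExp S a := Real.rpow_pos_of_pos (by linarith) _
    rcases hA' a ha with haA | ⟨hw1, hv, hside⟩
    · exact (h3 a haA).trans (by linarith)
    · set z := -K.spikeBase v S o k + l
      have hstar : ∀ e, v ∈ K.ends e → |z e - z e₀| ≤ k⁻¹ / 100 := by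
        intro e he
        by_cases hee : e = e₀
        · rw [hee, sub_self, abs_zero]
          have : 0 < k⁻¹ := inv_pos.2 (by linarith)
          positivity
        · have := h2 e (Finset.mem_erase.2 ⟨hee, Finset.mem_filter.2 ⟨Finset.mem_univ _, he⟩⟩)
          rwa [coordDiff_apply, hw1, Real.rpow_neg_one] at this
      have ho : o (K.side a.1 (a.2 + 1)) = o (K.side a.1 (a.2 + 2)) := by
        rcases hS.spike a.1 a.2 hv with h | h
        · exact h.2
        · exact absurd hside h.1
      rw [defect_apply, ho, sub_self, zero_mul, sub_zero, tolExp, if_pos hside, Real.rpow_neg_one]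
      have h4 := abs_le.1 (hstar _ (K.mem_ends_of_ne hv (add_one_ne a.2).symm))
      have h5 := abs_le.1 (hstar _ (K.mem_ends_of_ne hv (add_two_ne a.2).symm))
      rw [abs_le]
      constructor <;> linarith
  set C := min ((1 / 2 : ℝ) ^ n) (2 ^ n) *
    ((∏ _t : Tri, min ((1 / 10 : ℝ) ^ (-β)) (2 ^ (-β))) *
      ∏ _e : Link, min ((1 / 2 : ℝ) ^ (-α)) (2 ^ (-α))) * c with hC
  have hCpos : 0 < C := by positivity
  have hint : ∀ k, 100 ≤ k → ENNReal.ofReal C ≤ ∫⁻ l in U k, f l ∂K.measureOfDensity J := by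
    intro k hk
    have hk0 : 0 < k := by linarith
    have hk1 : 1 ≤ k := by linarith
    have hadm : U k ⊆ K.admissible := by
      intro l hl
      obtain ⟨z, rfl, hz, hd⟩ := hUz k hk l hl
      exact K.spike_mem_admissible hS hk hz hd
    have hvolU : ENNReal.ofReal _ ≤ volume (U k) :=
      (hvol k hk1).trans_eq (measure_preimage_add _ _ _).symm
    refine le_trans ?_ (K.le_setLIntegral (hUmeas k) hadm (f := f) (J := J)
      (F := min ((1 / 2 : ℝ) ^ n) (2 ^ n) * k ^ n)
      (G := (∏ t, min ((1 / 10 : ℝ) ^ (-β)) (2 ^ (-β)) * (k ^ K.areaExp v S t) ^ (-β)) *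
        ∏ e, min ((1 / 2 : ℝ) ^ (-α)) (2 ^ (-α)) * (k ^ K.lenExp v S e) ^ (-α))
      (by positivity) (by positivity) ?_ ?_ hvolU)
    · refine ENNReal.ofReal_le_ofReal ?_
      have e1 : ∏ t, (k ^ K.areaExp v S t) ^ (-β) = k ^ ∑ t, -β * K.areaExp v S t := by
        rw [Real.rpow_sum_of_pos hk0]
        refine Finset.prod_congr rfl fun t _ => ?_
        rw [← Real.rpow_mul hk0.le, mul_comm]
      have e2 : ∏ e, (k ^ K.lenExp v S e) ^ (-α) = k ^ ∑ e, -α * K.lenExp v S e := by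
        rw [Real.rpow_sum_of_pos hk0]
        refine Finset.prod_congr rfl fun e _ => ?_
        rw [← Real.rpow_mul hk0.le, mul_comm]
      rw [Finset.prod_mul_distrib, Finset.prod_mul_distrib, e1, e2]
      have hone : 1 ≤ k ^ (n + ∑ t, -β * K.areaExp v S t + ∑ e, -α * K.lenExp v S e +
          (∑ e, K.lenExp v S e +
            (((Finset.univ.filter fun e => v ∈ K.ends e).erase e₀).card * (w - 1) +
              ∑ a ∈ A, K.tolExp S a))) := Real.one_le_rpow hk1 hexp
      rw [Real.rpow_add hk0, Real.rpow_add hk0, Real.rpow_add hk0] at hone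
      refine (le_mul_of_one_le_right hCpos.le hone).trans_eq ?_
      rw [hC]
      ring
    · intro l hl
      obtain ⟨z, rfl, hz, hd⟩ := hUz k hk l hl
      have h1 := K.spike_length_star hS hk hz he₀
      exact ENNReal.ofReal_le_ofReal
        (rpow_scale_le (by norm_num) hk0 (by linarith [h1.1]) h1.2 n)
    · intro l hl
      obtain ⟨z, rfl, hz, hd⟩ := hUz k hk l hl
      refine mul_le_mul (Finset.prod_le_prod (fun t _ => by positivity) fun t _ => ?_)
        (Finset.prod_le_prod (fun e _ => by positivity) fun e _ => ?_)
        (Finset.prod_nonneg fun e _ => by positivity)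
        (Finset.prod_nonneg fun t _ => Real.rpow_nonneg (K.area_nonneg _ _) _)
      · have h1 := K.spike_area hS hk hz hd t
        exact rpow_scale_le (by norm_num) (Real.rpow_pos_of_pos hk0 _) (by linarith [h1.1]) h1.2 _
      · have h1 := K.spike_length hS hk hz e
        exact rpow_scale_le (by norm_num) (Real.rpow_pos_of_pos hk0 _) (by linarith [h1.1]) h1.2 _
  -- On the region of height k the length of e₀ lies between k/2 and 2k, so a ratio above 4 makes
  -- the regions disjoint.
  set κ : ℕ → ℝ := fun i => 100 * 5 ^ i with hκ
  have hκ100 : ∀ i, 100 ≤ κ i := fun i => by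
    have : (1 : ℝ) ≤ 5 ^ i := one_le_pow₀ (by norm_num)
    simp only [hκ]
    linarith
  have hdisj : Pairwise (Function.onFun Disjoint fun i => U (κ i)) := by
    have key : ∀ i j, i < j → Disjoint (U (κ i)) (U (κ j)) := by
      intro i j hij
      rw [Set.disjoint_left]
      intro l hli hlj
      obtain ⟨z, hlz, hz, -⟩ := hUz _ (hκ100 i) l hli
      obtain ⟨z', hlz', hz', -⟩ := hUz _ (hκ100 j) l hlj
      have h1 := (K.spike_length_star hS (hκ100 i) hz he₀).2
      have h2 := (K.spike_length_star hS (hκ100 j) hz' he₀).1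
      rw [← hlz] at h1
      rw [← hlz'] at h2
      have h3 : 5 * κ i ≤ κ j := by
        have : (5 : ℝ) ^ (i + 1) ≤ 5 ^ j := pow_le_pow_right₀ (by norm_num) hij
        rw [pow_succ] at this
        simp only [hκ]
        linarith
      linarith [hκ100 i]
    intro i j hij
    rcases lt_or_gt_of_ne hij with h | h
    · exact key i j h
    · exact (key j i h).symm
  have hsub : (⋃ i, U (κ i)) ⊆ {l | K.totalArea l ∈ Set.Icc (1 / 10 : ℝ) (Fintype.card Tri * 2)} := by
    intro l hl
    obtain ⟨i, hi⟩ := Set.mem_iUnion.1 hl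
    obtain ⟨z, rfl, hz, hd⟩ := hUz _ (hκ100 i) l hi
    exact K.spike_totalArea hS (hκ100 i) hz hd
  rw [eq_top_iff]
  calc (∞ : ℝ≥0∞) = ∑' _ : ℕ, ENNReal.ofReal C :=
        (ENNReal.tsum_const_eq_top_of_ne_zero (by simpa using hCpos)).symm
    _ ≤ ∑' i, ∫⁻ l in U (κ i), f l ∂K.measureOfDensity J :=
        ENNReal.tsum_le_tsum fun i => hint _ (hκ100 i)
    _ = ∫⁻ l in ⋃ i, U (κ i), f l ∂K.measureOfDensity J :=
        (lintegral_iUnion (fun i => hUmeas _) hdisj _).symm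
    _ ≤ _ := lintegral_mono_set hsub

/-! ### Exponents -/

open Classical in
lemma sum_lenExp {v : Vert} {S : Finset Link} (hS : ∀ e ∈ S, v ∉ K.ends e) :
    ∑ e, K.lenExp v S e = K.order v - S.card := by
  have h1 : ∀ e, K.lenExp v S e =
      (if v ∈ K.ends e then 1 else 0) - if e ∈ S then (1 : ℝ) else 0 := by
    intro e
    unfold lenExp
    by_cases he : v ∈ K.ends e
    · have : e ∉ S := fun h => hS e h he
      simp [he, this]
    · by_cases he' : e ∈ S <;> simp [he, he']
  simp only [h1, Finset.sum_sub_distrib, Finset.sum_boole]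
  congr 2
  · rw [order, Set.ncard_eq_toFinset_card']
    congr 1
    ext e
    simp
  · simp

-- An outer triangle with one short side contributes β from its area and -1 from its tolerance; one
-- with three short sides contributes 2β. These are minus the closure weights for γ = 0; a positive
-- γ only raises the weight of the former.
open Classical in
lemma neg_suppression_le {v : Vert} {S : Finset Link} {o : Link → ℝ} (hS : K.IsSpikeShape v S o)
    {α β γ : ℝ} (hγ : 0 ≤ γ) :
    (1 - α) * K.order v - K.suppression v α β (1 - β + γ) S ≤
      ∑ t, -β * K.areaExp v S t + ∑ e, -α * K.lenExp v S e + ∑ e, K.lenExp v S e +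
      ∑ a : Tri × Fin 3 with v ∉ Set.range (K.vert a.1) ∧ K.sideCount S a.1 = 1 ∧
        K.side a.1 a.2 ∈ S, K.tolExp S a := by
  have h1 : ∑ a : Tri × Fin 3 with v ∉ Set.range (K.vert a.1) ∧ K.sideCount S a.1 = 1 ∧
        K.side a.1 a.2 ∈ S, K.tolExp S a =
      ∑ t, if v ∉ Set.range (K.vert t) ∧ K.sideCount S t = 1 then (-1 : ℝ) else 0 := by
    rw [Finset.sum_filter, Fintype.sum_prod_type]
    refine Finset.sum_congr rfl fun t _ => ?_
    by_cases ht : v ∉ Set.range (K.vert t) ∧ K.sideCount S t = 1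
    · rw [if_pos ht]
      have h2 := K.sideCount_eq_sum S t
      rw [ht.2, Nat.cast_one] at h2
      rw [h2, ← Finset.sum_neg_distrib]
      refine Finset.sum_congr rfl fun k _ => ?_
      by_cases hk : K.side t k ∈ S
      · rw [if_pos ⟨ht.1, ht.2, hk⟩, if_pos hk, tolExp, if_pos hk]
      · rw [if_neg fun h => hk h.2.2, if_neg hk, neg_zero]
    · rw [if_neg ht]
      exact Finset.sum_eq_zero fun k _ => if_neg fun h => ht ⟨h.1, h.2.1⟩
  rw [h1, ← Finset.mul_sum Finset.univ (K.lenExp v S), K.sum_lenExp hS.notMem_ends]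
  have h3 : -∑ t with v ∉ Set.range (K.vert t), closureWeight β (1 - β + γ) (K.sideCount S t) ≤
      ∑ t, -β * K.areaExp v S t +
        ∑ t, if v ∉ Set.range (K.vert t) ∧ K.sideCount S t = 1 then (-1 : ℝ) else 0 := by
    rw [Finset.sum_filter, ← Finset.sum_neg_distrib, ← Finset.sum_add_distrib]
    refine Finset.sum_le_sum fun t _ => ?_
    by_cases ht : v ∈ Set.range (K.vert t)
    · simp [areaExp, ht]
    · have hc := K.sideCount_le S t
      have hc2 := hS.outer t ht
      obtain hc | hc | hc : K.sideCount S t = 0 ∨ K.sideCount S t = 1 ∨ K.sideCount S t = 3 := by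
        omega
      · simp [areaExp, closureWeight, ht, hc]
      · simp [areaExp, closureWeight, ht, hc]
        linarith
      · simp [areaExp, closureWeight, ht, hc]
        linarith
  unfold suppression
  linarith

open Classical in
lemma card_star_erase {v : Vert} {e₀ : Link} (he₀ : v ∈ K.ends e₀) :
    (((Finset.univ.filter fun e => v ∈ K.ends e).erase e₀).card : ℝ) = K.order v - 1 := by
  have h1 : K.order v = (Finset.univ.filter fun e => v ∈ K.ends e).card := by
    rw [order, Set.ncard_eq_toFinset_card']
    congr 1
    ext e
    simp
  have h2 : e₀ ∈ Finset.univ.filter fun e => v ∈ K.ends e := by simpa using he₀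
  rw [Finset.card_erase_of_mem h2, ← h1, Nat.cast_sub, Nat.cast_one]
  rw [h1]
  exact Finset.card_pos.2 ⟨_, h2⟩

/-! ### Spikes prescribed by two-colourings -/

/-- A link is monochromatic for a colouring of the vertices. -/
def IsMono (c : Vert → Bool) (e : Link) : Prop := (Sym2.map c (K.ends e)).IsDiag

lemma isMono_side (c : Vert → Bool) (t : Tri) (k : Fin 3) :
    K.IsMono c (K.side t k) ↔ c (K.vert t (k + 1)) = c (K.vert t (k + 2)) := by
  rw [IsMono, K.ends_side, Sym2.map_mk, Sym2.mk_isDiag_iff]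

lemma isMono_side_of_two (c : Vert → Bool) (t : Tri) (i j k : Fin 3) (hij : i ≠ j)
    (hi : K.IsMono c (K.side t i)) (hj : K.IsMono c (K.side t j)) : K.IsMono c (K.side t k) := by
  rw [isMono_side] at *
  fin_cases i <;> fin_cases j <;> fin_cases k <;> simp_all

open Classical in
/-- The lengths of the links at `v` differ according to the colours of their end points. -/
noncomputable def colourOffset (v : Vert) (c : Vert → Bool) (e : Link) : ℝ :=
  if v ∈ K.ends e ∧ ¬K.IsMono c e then 1 else 0

/-- A link at `v` is longer by 1 if its other end has a different colour from `v`. So the two long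
sides of a triangle at `v` differ by 1 exactly when the third side is bichromatic, and these third
sides never become short since S stays monochromatic. -/
lemma isSpikeShape_colourOffset {v : Vert} {c : Vert → Bool} {S : Finset Link}
    (hS₁ : ∀ e, K.IsOpposite v e → K.IsMono c e → e ∈ S)
    (hS₂ : ∀ e ∈ S, v ∉ K.ends e ∧ K.IsMono c e)
    (hS₃ : ∀ t, v ∉ Set.range (K.vert t) → K.sideCount S t ≠ 2) :
    K.IsSpikeShape v S (K.colourOffset v c) where
  notMem_ends e he := (hS₂ e he).1
  offset_eq_zero e he := if_neg fun h => he h.1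
  offset_mem e := by unfold colourOffset; split_ifs <;> norm_num
  outer := hS₃
  spike t j hj := by
    have h1 : v ∈ K.ends (K.side t (j + 1)) := K.mem_ends_of_ne hj (add_one_ne j).symm
    have h2 : v ∈ K.ends (K.side t (j + 2)) := K.mem_ends_of_ne hj (add_two_ne j).symm
    have e1 : j + 1 + 1 = j + 2 := by fin_cases j <;> rfl
    have e2 : j + 1 + 2 = j := by fin_cases j <;> rfl
    have e3 : j + 2 + 1 = j := by fin_cases j <;> rfl
    have e4 : j + 2 + 2 = j + 1 := by fin_cases j <;> rfl
    have hmem : K.side t j ∈ S ↔ c (K.vert t (j + 1)) = c (K.vert t (j + 2)) := by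
      rw [← isMono_side]
      exact ⟨fun h => (hS₂ _ h).2, hS₁ _ ⟨t, j, hj, rfl⟩⟩
    rw [hmem]
    simp only [colourOffset, h1, h2, true_and, isMono_side, e1, e2, e3, e4]
    cases c (K.vert t j) <;> cases c (K.vert t (j + 1)) <;> cases c (K.vert t (j + 2)) <;> simp

-- The conditions are those of `exists_closed` and `suppression_opposite_le` for g = 1 - β + γ; the
-- remaining one, β ≤ 3 + 3γ, is the sum of `h₁` and `h₃`.
open Classical in
lemma exists_spikeShape {v : Vert} (c : Vert → Bool) {α β γ : ℝ} (h₁ : 0 ≤ α + β + γ)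
    (h₂ : 0 ≤ 3 + α + 4 * γ) (h₃ : 0 ≤ 3 - α - 2 * β + 2 * γ) :
    ∃ S : Finset Link, K.IsSpikeShape v S (K.colourOffset v c) ∧
      (∀ t k, K.vert t k = v →
        (K.side t k ∈ S ↔ c (K.vert t (k + 1)) = c (K.vert t (k + 2)))) ∧
      K.suppression v α β (1 - β + γ) S ≤ (2 - α - β + γ) *
        ∑ t, ∑ k, if K.vert t k = v ∧ c (K.vert t (k + 1)) = c (K.vert t (k + 2))
          then (1 : ℝ) else 0 := by
  set S₀ : Finset Link := Finset.univ.filter fun e => K.IsOpposite v e ∧ K.IsMono c e with hS₀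
  have hmem : ∀ e, e ∈ S₀ ↔ K.IsOpposite v e ∧ K.IsMono c e := fun e => by simp [hS₀]
  obtain ⟨S, hS1, hS2, hS3, hS4⟩ := K.exists_closed (K.isMono_side_of_two c) hmem
    (α := α) (β := β) (g := 1 - β + γ) (by linarith) (by linarith)
  have hle := K.suppression_opposite_le (fun e he => ((hmem e).1 he).1) (α := α) (β := β)
    (g := 1 - β + γ) (S₀ := S₀) (by linarith) (by linarith)
  refine ⟨S, K.isSpikeShape_colourOffset (fun e h h' => hS1 ((hmem e).2 ⟨h, h'⟩)) hS2 hS3,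
    fun t k hk => ?_, hS4.trans (hle.trans_eq ?_)⟩
  · rw [← isMono_side]
    exact ⟨fun h => (hS2 _ h).2, fun h => hS1 ((hmem _).2 ⟨⟨t, k, hk, rfl⟩, h⟩)⟩
  · rw [show 1 - α + (1 - β + γ) = 2 - α - β + γ by ring]
    congr 1
    refine Finset.sum_congr rfl fun t _ => Finset.sum_congr rfl fun k _ => ?_
    refine if_congr (and_congr_right fun hk => ?_) rfl rfl
    rw [hmem, isMono_side]
    exact and_iff_right ⟨t, k, hk, rfl⟩

/-! ### The explicit exponent at a vertex -/

open Classical in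
theorem localMeasure_diverges_at_vertex {α β : ℝ} {v : Vert}
    (hαβ : α + 2 * β < 3 - 1 / (K.order v : ℝ)) {n : ℝ} (hn : (K.order v : ℝ) * (3 - β) - 2 ≤ n)
    {V : ℝ} (hV : 0 < V) {e : Link} (he : v ∈ K.ends e) :
    K.Diverges (K.localMeasure α β) V (linkPower e n) := by
  have hαβ3 : α + 2 * β ≤ 3 := by
    have : 0 ≤ 1 / (K.order v : ℝ) := by positivity
    linarith
  have hcorner := K.sum_corners_eq_order v
  have hstar := K.card_star_erase he
  rcases le_or_gt 0 (α + β) with hpos | hneg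
  · obtain ⟨S, hS, hside, hsup⟩ := K.exists_spikeShape (v := v) (fun _ => true) (α := α) (β := β)
      (γ := 0) (by linarith) (by linarith) (by linarith)
    simp only [and_true, hcorner] at hsup
    have hexp := K.neg_suppression_le hS (α := α) (β := β) (γ := 0) le_rfl
    refine K.diverges_of_spikeShape hS he (w := -1)
      (A := Finset.univ.filter fun a => v ∉ Set.range (K.vert a.1) ∧ K.sideCount S a.1 = 1 ∧
        K.side a.1 a.2 ∈ S) (fun a ha => Or.inr (Finset.mem_filter.1 ha).2) (by norm_num)
      (fun a ha => ?_) ?_ hV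
    · rcases ha with ha | ha
      · exact Or.inr ⟨rfl, ha, (hside _ _ ha).2 rfl⟩
      · exact Or.inl (Finset.mem_filter.2 ⟨Finset.mem_univ _, ha⟩)
    · rw [hstar]
      linarith
  · obtain ⟨c, hc⟩ := K.exists_cut v
    -- This is the least γ for which closing one triangle costs nothing.
    obtain ⟨S, hS, hside, hsup⟩ := K.exists_spikeShape (v := v) c (α := α) (β := β)
      (γ := -α - β) (by linarith) (by linarith) (by linarith)
    have hexp := K.neg_suppression_le hS (α := α) (β := β) (γ := -α - β) (by linarith)
    set Ns := ∑ t, ∑ k, if K.vert t k = v ∧ c (K.vert t (k + 1)) = c (K.vert t (k + 2))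
      then (1 : ℝ) else 0 with hNs
    set Nd := ∑ t, ∑ k, if K.vert t k = v ∧ c (K.vert t (k + 1)) ≠ c (K.vert t (k + 2))
      then (1 : ℝ) else 0 with hNd
    have hsum : Ns + Nd = K.order v := by
      rw [← hcorner, hNs, hNd, ← Finset.sum_add_distrib]
      refine Finset.sum_congr rfl fun t _ => ?_
      rw [← Finset.sum_add_distrib]
      refine Finset.sum_congr rfl fun k _ => ?_
      by_cases h1 : K.vert t k = v <;>
        by_cases h2 : c (K.vert t (k + 1)) = c (K.vert t (k + 2)) <;> simp [h1, h2]
    have hNd1 : 1 ≤ Nd := by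
      obtain ⟨m, hm⟩ : ∃ m : ℕ, Nd = m := by
        rw [hNd, ← Finset.sum_product', Finset.sum_boole]
        exact ⟨_, rfl⟩
      rw [hm]
      have : (0 : ℝ) < m := by
        rw [← hm]
        have : (0 : ℝ) ≤ (((Finset.univ.filter fun e => v ∈ K.ends e).erase e).card : ℝ) :=
          Nat.cast_nonneg _
        linarith
      exact_mod_cast this
    have htol : ∑ a : Tri × Fin 3 with K.vert a.1 a.2 = v, K.tolExp S a = -Ns - 2 * Nd := by
      rw [Finset.sum_filter, Fintype.sum_prod_type, hNs, hNd, Finset.mul_sum,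
        ← Finset.sum_neg_distrib, ← Finset.sum_sub_distrib]
      refine Finset.sum_congr rfl fun t _ => ?_
      rw [Finset.mul_sum, ← Finset.sum_neg_distrib, ← Finset.sum_sub_distrib]
      refine Finset.sum_congr rfl fun k _ => ?_
      by_cases h1 : K.vert t k = v
      · simp only [tolExp, hside t k h1, h1, true_and, if_true]
        by_cases h2 : c (K.vert t (k + 1)) = c (K.vert t (k + 2)) <;> simp [h2]
      · simp [h1]
    refine K.diverges_of_spikeShape hS he (w := 0)
      (A := (Finset.univ.filter fun a => K.vert a.1 a.2 = v) ∪
        Finset.univ.filter fun a => v ∉ Set.range (K.vert a.1) ∧ K.sideCount S a.1 = 1 ∧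
        K.side a.1 a.2 ∈ S) (fun a ha => ?_) le_rfl (fun a ha => Or.inl ?_) ?_ hV
    · rcases Finset.mem_union.1 ha with ha | ha
      · exact Or.inl (Finset.mem_filter.1 ha).2
      · exact Or.inr (Finset.mem_filter.1 ha).2
    · rcases ha with ha | ha
      · exact Finset.mem_union_left _ (Finset.mem_filter.2 ⟨Finset.mem_univ _, ha⟩)
      · exact Finset.mem_union_right _ (Finset.mem_filter.2 ⟨Finset.mem_univ _, ha⟩)
    -- At n = N(3-β)-2 the lower bound for the exponent is (Nd - 1) - (α + β)(Nd - Ns). It is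
    -- nonnegative because the cut has Nd ≥ Ns and Nd ≥ 1, and α + β < 0.
    · rw [hstar, Finset.sum_union, htol]
      · nlinarith
      · rw [Finset.disjoint_filter]
        rintro a - h1 ⟨h2, -⟩
        exact h2 ⟨_, h1⟩

end ClosedTriangulation

theorem theorem1 {Vert Link Tri : Type*} [Fintype Link] [Fintype Tri] [DecidableEq Link]
    (K : ClosedTriangulation Vert Link Tri) :
    -- the local measures
    (∀ α β : ℝ, ∃ n₀ : ℝ, ∀ n : ℝ, n₀ ≤ n → ∀ V : ℝ, 0 < V →
      (∀ e : Link, K.Diverges (K.localMeasure α β) V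
        (ClosedTriangulation.linkPower e n)) ∧
      K.Diverges (K.localMeasure α β) V (K.radiusPower n)) ∧
    -- the DeWitt-like measures
    (∀ β : ℝ, K.deWittMeasure β ≠ 0 → ∃ n₀ : ℝ, ∀ n : ℝ, n₀ ≤ n → ∀ V : ℝ, 0 < V →
      (∀ e : Link, K.Diverges (K.deWittMeasure β) V
        (ClosedTriangulation.linkPower e n)) ∧
      K.Diverges (K.deWittMeasure β) V (K.radiusPower n)) ∧
    -- the explicit exponent for the local measures, at the links of a vertex of order `N`
    (∀ α β : ℝ, ∀ v : Vert, α + 2 * β < 3 - 1 / (K.order v : ℝ) →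
      ∀ n : ℝ, (K.order v : ℝ) * (3 - β) - 2 ≤ n → ∀ V : ℝ, 0 < V →
        ∀ e : Link, v ∈ K.ends e → K.Diverges (K.localMeasure α β) V
          (ClosedTriangulation.linkPower e n)) :=
  ⟨fun α β => K.localMeasure_diverges α β, fun _ hβ => K.deWittMeasure_diverges hβ,
    fun _ _ _ h _ hn _ hV _ he => K.localMeasure_diverges_at_vertex h hn hV he⟩
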